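/- **Setting.** Let $d\ge 1$, let $\Omega\subset\mathbb R^d$ be a bounded open set (in particular, any bounded Lipschitz domain), $T>0$, $0<\alpha<1$, $\eta>0$. Write $\langle\cdot,\cdot\rangle$, $\|\cdot\|$ for the inner product and norm of $L_2(\Omega)$ or $L_2(\Omega)^d$ (real-valued functions), and let $H^1_0(\Omega)$ be the closure of $C_c^\infty(\Omega)$ in $H^1(\Omega)$. Put $\omega_\alpha(t)=t^{\alpha-1}/\Gamma(\alpha)$, $$\mathcal I^\alpha\phi(t)=\int_0^t\omega_\alpha(t-s)\phi(s)\,ds,\qquad \partial_t^{1-\alpha}\phi=\partial_t\,\mathcal I^\alpha\phi .$$ Let the coefficients satisfy $$\kappa\in L_\infty(\Omega)^{d\times d},\qquad \vec F,\vec G\in C^2\bigl([0,T];W^1_\infty(\Omega)^d\bigr),\qquad a,b\in C^1\bigl([0,T];L_\infty(\Omega)\bigr),$$ where, for almost every $x\in\Omega$, $\kappa(x)$ is symmetric with minimal eigenvalue at least $\kappa_0$, for some constant $\kappa_0>0$. Put $$\vec B_1\phi(t)=\int_0^t\bigl(\vec F(s)\,\partial_s^{1-\alpha}\phi(s)+\vec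 G(s)\phi(s)\bigr)ds,\qquad B_2\phi(t)=\int_0^t\bigl(a(s)\,\partial_s^{1-\alpha}\phi(s)+b(s)\phi(s)\bigr)ds .$$ **Theorem.** There is a constant $C$, depending only on $\Omega$, $T$, $\alpha$, $\eta$ and the coefficients $\kappa,\vec F,\vec G,a,b$, such that the following holds. Let $M>0$, let $g:(0,T]\to L_2(\Omega)$ be measurable with $\|g(t)\|\le Mt^{\eta-1}$ for $0<t\le T$, let $u_0\in L_2(\Omega)$, and put $f(t)=u_0+\int_0^t g(s)\,ds$. Then the initial-boundary value problem $$\partial_tu-\nabla\cdot\bigl(\kappa\nabla\partial_t^{1-\alpha}u-\vec F\partial_t^{1-\alpha}u-\vec Gu\bigr)+a\,\partial_t^{1-\alpha}u+bu=g\ \text{ in }\Omega\times(0,T],\qquad u|_{\partial\Omega}=0,\qquad u(0)=u_0,$$ has a weak solution in the following sense: there is a function $u:[0,T]\to L_2(\Omega)$ such that 1. the restriction $u:(0,T]\to L_2(\Omega)$ is continuous; 2. for $0<t\le T$, $u(t)\in H^1_0(\Omega)$ and $\|u(t)\|+t^{\alpha/2}\|\nabla u(t)\|\le C\bigl(\|u_0\|+Mt^\eta\bigr)$;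 3. for $0\le t\le T$ the Bochner integrals defining $\mathcal I^\alpha u(t)$ and $\mathcal I^\alpha\nabla u(t)$ exist; $\mathcal I^\alpha u:[0,T]\to L_2(\Omega)$ is absolutely continuous, differentiable almost everywhere, and the integral of its derivative $\partial_t^{1-\alpha}u\in L_1\bigl((0,T);L_2(\Omega)\bigr)$ (so $\vec B_1u$ and $B_2u$ are well defined); $\mathcal I^\alpha u$ and $B_2u$ are continuous from $[0,T]$ to $L_2(\Omega)$, and $\mathcal I^\alpha\nabla u$ and $\vec B_1u$ are continuous from $[0,T]$ to $L_2(\Omega)^d$; 4. at $t=0$, $\mathcal I^\alpha u=B_2u=0$, $\mathcal I^\alpha\nabla u=\vec B_1u=0$ and $u(0)=u_0$; 5. $\langle u(t),v\rangle\to\langle u(0),v\rangle$ as $t\to0^+$, for each $v\in L_2(\Omega)$; 6. for $0\le t\le T$ and $v\in H^1_0(\Omega)$, $$\langle u(t),v\rangle+\bigl\langle\kappa\,(\mathcal I^\alpha\nabla u)(t),\nabla v\bigr\rangle-\bigl\langle(\vec B_1u)(t),\nabla v\bigr\rangle+\bigl\langle(B_2u)(t),v\bigr\rangle=\langle f(t),v\rangle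 .$$ -/

import Mathlib

open MeasureTheory Set Filter Topology
open scoped ENNReal

namespace FracPDE

/-- The space `L_2(Ω)` of real functions on `Ω ⊆ ℝ^d`. -/
noncomputable abbrev L2 {d : ℕ} (Ω : Set (EuclideanSpace ℝ (Fin d))) :=
  Lp ℝ 2 (volume.restrict Ω)

/-- The Hilbert space `L_2(Ω)^d`, with `⟪p, q⟫ = ∑ i, ⟪p i, q i⟫`. -/
noncomputable abbrev L2Vec {d : ℕ} (Ω : Set (EuclideanSpace ℝ (Fin d))) :=
  PiLp 2 (fun _ : Fin d => L2 Ω)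

/-- The space `L_∞(Ω)`. -/
noncomputable abbrev LInf {d : ℕ} (Ω : Set (EuclideanSpace ℝ (Fin d))) :=
  Lp ℝ (⊤ : ℝ≥0∞) (volume.restrict Ω)

/-- `φ ∈ C_c^∞(Ω)`. -/
structure IsTestFunction {d : ℕ} (Ω : Set (EuclideanSpace ℝ (Fin d)))
    (φ : EuclideanSpace ℝ (Fin d) → ℝ) : Prop where
  smooth : ContDiff ℝ ((⊤ : ℕ∞) : WithTop ℕ∞) φ
  compact : HasCompactSupport φ
  support : tsupport φ ⊆ Ω

/-- The classical partial derivative `∂φ/∂x_i` at `x`. -/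
noncomputable def partialDeriv {d : ℕ} (i : Fin d) (φ : EuclideanSpace ℝ (Fin d) → ℝ)
    (x : EuclideanSpace ℝ (Fin d)) : ℝ :=
  fderiv ℝ φ x (EuclideanSpace.single i 1)

theorem IsTestFunction.integrable_mul {d : ℕ} {Ω : Set (EuclideanSpace ℝ (Fin d))}
    {φ : EuclideanSpace ℝ (Fin d) → ℝ} (hφ : IsTestFunction Ω φ) (f : LInf Ω) :
    Integrable (fun x => f x * φ x) (volume.restrict Ω) := by
  have h1 : Integrable φ (volume.restrict Ω) :=
    (hφ.smooth.continuous.integrable_of_hasCompactSupport hφ.compact).restrict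
  have h2 : MemLp f (⊤ : ℝ≥0∞) (volume.restrict Ω) := Lp.memLp f
  exact (memLp_one_iff_integrable.2 h1).integrable_mul h2 |>.congr
    (Eventually.of_forall fun x => mul_comm _ _)

theorem IsTestFunction.integrable_mul_partialDeriv {d : ℕ}
    {Ω : Set (EuclideanSpace ℝ (Fin d))} {φ : EuclideanSpace ℝ (Fin d) → ℝ}
    (hφ : IsTestFunction Ω φ) (i : Fin d) (f : LInf Ω) :
    Integrable (fun x => f x * partialDeriv i φ x) (volume.restrict Ω) := by
  have hc : Continuous (partialDeriv i φ) :=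
    (hφ.smooth.continuous_fderiv (by simp)).clm_apply continuous_const
  have hs : HasCompactSupport (partialDeriv i φ) :=
    hφ.compact.fderiv_apply ℝ (EuclideanSpace.single i 1)
  have h1 : Integrable (partialDeriv i φ) (volume.restrict Ω) :=
    (hc.integrable_of_hasCompactSupport hs).restrict
  have h2 : MemLp f (⊤ : ℝ≥0∞) (volume.restrict Ω) := Lp.memLp f
  exact (memLp_one_iff_integrable.2 h1).integrable_mul h2 |>.congr
    (Eventually.of_forall fun x => mul_comm _ _)

/-- The Sobolev space `W^1_∞(Ω)`: a function `f ∈ L_∞(Ω)` together with its weak partial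
derivatives `D i ∈ L_∞(Ω)`, where `∫ f ∂_i φ = - ∫ (D i) φ` for all test functions `φ`.
The norm inherited from the product is `max (‖f‖_∞, max_i ‖∂_i f‖_∞)`. -/
noncomputable def W1Inf {d : ℕ} (Ω : Set (EuclideanSpace ℝ (Fin d))) :
    Submodule ℝ (LInf Ω × (Fin d → LInf Ω)) where
  carrier := {q | ∀ φ, IsTestFunction Ω φ → ∀ i : Fin d,
    ∫ x in Ω, q.1 x * partialDeriv i φ x = - ∫ x in Ω, q.2 i x * φ x}
  zero_mem' := by
    intro φ _ i
    have h : ⇑(0 : LInf Ω) =ᵐ[volume.restrict Ω] 0 := Lp.coeFn_zero _ _ _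
    have h1 : (fun x => (0 : LInf Ω) x * partialDeriv i φ x) =ᵐ[volume.restrict Ω]
        fun _ => 0 := by
      filter_upwards [h] with x hx
      rw [hx, Pi.zero_apply, zero_mul]
    have h2 : (fun x => (0 : LInf Ω) x * φ x) =ᵐ[volume.restrict Ω] fun _ => 0 := by
      filter_upwards [h] with x hx
      rw [hx, Pi.zero_apply, zero_mul]
    change ∫ x in Ω, (0 : LInf Ω) x * partialDeriv i φ x = - ∫ x in Ω, (0 : LInf Ω) x * φ x
    rw [integral_congr_ae h1, integral_congr_ae h2]
    simp
  add_mem' := by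
    intro p q hp hq φ hφ i
    have h1 : (fun x => (p.1 + q.1) x * partialDeriv i φ x) =ᵐ[volume.restrict Ω]
        fun x => p.1 x * partialDeriv i φ x + q.1 x * partialDeriv i φ x := by
      filter_upwards [Lp.coeFn_add p.1 q.1] with x hx
      rw [hx, Pi.add_apply, add_mul]
    have h2 : (fun x => (p.2 i + q.2 i) x * φ x) =ᵐ[volume.restrict Ω]
        fun x => p.2 i x * φ x + q.2 i x * φ x := by
      filter_upwards [Lp.coeFn_add (p.2 i) (q.2 i)] with x hx
      rw [hx, Pi.add_apply, add_mul]
    change ∫ x in Ω, (p.1 + q.1) x * partialDeriv i φ x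
      = - ∫ x in Ω, (p.2 i + q.2 i) x * φ x
    rw [integral_congr_ae h1, integral_congr_ae h2,
      integral_add (hφ.integrable_mul_partialDeriv i _) (hφ.integrable_mul_partialDeriv i _),
      integral_add (hφ.integrable_mul _) (hφ.integrable_mul _), hp φ hφ i, hq φ hφ i]
    ring
  smul_mem' := by
    intro c p hp φ hφ i
    have h1 : (fun x => (c • p.1) x * partialDeriv i φ x) =ᵐ[volume.restrict Ω]
        fun x => c * (p.1 x * partialDeriv i φ x) := by
      filter_upwards [Lp.coeFn_smul c p.1] with x hx
      rw [hx, Pi.smul_apply, smul_eq_mul, mul_assoc]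
    have h2 : (fun x => (c • p.2 i) x * φ x) =ᵐ[volume.restrict Ω]
        fun x => c * (p.2 i x * φ x) := by
      filter_upwards [Lp.coeFn_smul c (p.2 i)] with x hx
      rw [hx, Pi.smul_apply, smul_eq_mul, mul_assoc]
    change ∫ x in Ω, (c • p.1) x * partialDeriv i φ x = - ∫ x in Ω, (c • p.2 i) x * φ x
    rw [integral_congr_ae h1, integral_congr_ae h2, integral_const_mul, integral_const_mul,
      hp φ hφ i]
    ring

/-- `v ∈ H^1_0(Ω)` with gradient `∇v = Dv`: the pair `(v, Dv)` is a limit in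
`L_2(Ω) × L_2(Ω)^d` of pairs `(φ, ∇φ)` with `φ ∈ C_c^∞(Ω)`. This is the closure of
`C_c^∞(Ω)` in the `H^1(Ω)` norm; the limit `Dv` is the weak gradient of `v`, so it is
determined by `v`. -/
def HasH10Grad {d : ℕ} (Ω : Set (EuclideanSpace ℝ (Fin d))) (v : L2 Ω) (Dv : L2Vec Ω) : Prop :=
  (v, Dv) ∈ closure {q : L2 Ω × L2Vec Ω | ∃ φ, IsTestFunction Ω φ ∧
    q.1 =ᵐ[volume.restrict Ω] φ ∧ ∀ i : Fin d, q.2 i =ᵐ[volume.restrict Ω] partialDeriv i φ}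

/-- Pointwise product of `c ∈ L_∞(Ω)` with `v ∈ L_2(Ω)`, as an element of `L_2(Ω)`. -/
noncomputable def mulL2 {d : ℕ} {Ω : Set (EuclideanSpace ℝ (Fin d))} (c : LInf Ω) (v : L2 Ω) :
    L2 Ω :=
  c • v

theorem coeFn_mulL2 {d : ℕ} {Ω : Set (EuclideanSpace ℝ (Fin d))} (c : LInf Ω) (v : L2 Ω) :
    mulL2 c v =ᵐ[volume.restrict Ω] fun x => c x * v x :=
  Lp.coeFn_lpSMul c v

/-- The kernel `ω_α(t) = t^(α-1) / Γ(α)`. -/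
noncomputable def omega (α t : ℝ) : ℝ := t ^ (α - 1) / Real.Gamma α

/-- The fractional integral `(I^α φ)(t) = ∫_0^t ω_α(t-s) φ(s) ds` (a Bochner integral). -/
noncomputable def fracInt {V : Type*} [NormedAddCommGroup V] [NormedSpace ℝ V]
    (α : ℝ) (φ : ℝ → V) (t : ℝ) : V :=
  ∫ s in (0 : ℝ)..t, omega α (t - s) • φ s

/-- The Riemann--Liouville derivative `∂_t^{1-α} φ = ∂_t (I^α φ)` of order `1 - α`. -/
noncomputable def rlDeriv {V : Type*} [NormedAddCommGroup V] [NormedSpace ℝ V]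
    (α : ℝ) (φ : ℝ → V) (t : ℝ) : V :=
  deriv (fracInt α φ) t

/-- `∫_0^t (c(s) ∂_s^{1-α} φ(s) + e(s) φ(s)) ds` for scalar coefficients `c`, `e`. With
`(c, e) = (a, b)` this is `B_2 φ`. -/
noncomputable def opB {d : ℕ} {Ω : Set (EuclideanSpace ℝ (Fin d))} (α : ℝ) (c e : ℝ → LInf Ω)
    (φ : ℝ → L2 Ω) (t : ℝ) : L2 Ω :=
  ∫ s in (0 : ℝ)..t, (mulL2 (c s) (rlDeriv α φ s) + mulL2 (e s) (φ s))

/-- The vector `B_1 φ(t) = ∫_0^t (F(s) ∂_s^{1-α} φ(s) + G(s) φ(s)) ds`, componentwise, for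
vector fields `F(s), G(s) ∈ W^1_∞(Ω)^d`. -/
noncomputable def opBVec {d : ℕ} {Ω : Set (EuclideanSpace ℝ (Fin d))} (α : ℝ)
    (F G : ℝ → Fin d → W1Inf Ω) (φ : ℝ → L2 Ω) (t : ℝ) : L2Vec Ω :=
  WithLp.toLp 2 fun i => opB α (fun s => (F s i).1.1) (fun s => (G s i).1.1) φ t

/-- The matrix-vector product `κ p ∈ L_2(Ω)^d` for `κ ∈ L_∞(Ω)^{d×d}` and `p ∈ L_2(Ω)^d`. -/
noncomputable def matMul {d : ℕ} {Ω : Set (EuclideanSpace ℝ (Fin d))}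
    (κ : Matrix (Fin d) (Fin d) (LInf Ω)) (p : L2Vec Ω) : L2Vec Ω :=
  WithLp.toLp 2 fun i => ∑ j, mulL2 (κ i j) (p j)

/-- For almost every `x ∈ Ω` the matrix `κ(x)` is symmetric with all eigenvalues at least
`κ₀`, for some `κ₀ > 0` independent of `x`. -/
def UniformlyElliptic {d : ℕ} {Ω : Set (EuclideanSpace ℝ (Fin d))}
    (κ : Matrix (Fin d) (Fin d) (LInf Ω)) : Prop :=
  (∀ᵐ x ∂(volume.restrict Ω), ∀ i j, κ i j x = κ j i x) ∧
  ∃ κ₀ : ℝ, 0 < κ₀ ∧ ∀ᵐ x ∂(volume.restrict Ω), ∀ ξ : Fin d → ℝ,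
    κ₀ * ∑ i, ξ i ^ 2 ≤ ∑ i, ∑ j, κ i j x * ξ j * ξ i

end FracPDE

open FracPDE

/-! Let H = L_2(Ω), and let W be H^1_0(Ω) with inner product ⟨κ∇w,∇z⟩ + ⟨w,z⟩; coercivity of κ makes
W a Hilbert space with a contractive inclusion ι : W → H. The basic unknown is v = ∂_t^{1-α}u rather
than u. Then I^α u = ∫ v and u = I^{1-α}v, so every lower-order term has the form ∫ (P v + Q
I^{1-α}v) with bounded operators P(t), Q(t) : H → W. With u = ιU the variational equation becomes
ι*ιU + I^α U = ι*f + ∫ (P v + Q ιU), ιU = I^{1-α}v. The zeroth-order part of the inner product of W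
adds I^α u to the left side; since I^α u = ∫ v, adding ι* to P compensates for it.

The operator A(h, w) = (ιw, ι*h) on H ⊕ W is a symmetric contraction, and A² acts on W as ι*ι. The
unperturbed equation A²U + I^α U = f is solved by functions of A. With λ = y^{-2}, put φ(t,y) = λ
E_α(-λ t^α) and χ(t,y) = ∂_t^{1-α}(y φ). Then y²φ + I^α φ = 1 and I^{1-α}χ = yφ, and, uniformly in
y, φ = O(t^{-α}), yφ = O(t^{-α/2}), χ = O(t^{α/2-1}), yχ = O(t^{α-1}). Both kernels extend
continuously to y = 0, so a functional calculus on C([-1,1]) (`exists_functionalCalculus`) gives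
operators Φ, χ with the same identities and bounds (`exists_solutionOperators`). Neither compactness
of ι nor an eigenfunction expansion is needed.

The scalar facts come from the resolvent r of ω_α, defined by r + I^α r = ω_α. A first-zero argument
gives r > 0 (`IsResolvent.pos`); then e = I^{1-α}r, which is E_α(-t^α), is decreasing with values in
[0, 1], and integral identities give the decay of r and e and the limit of t^α e(t) at infinity
(`IsResolvent.tendsto_relax_mul_rpow`). That limit is the value of φ at y = 0.

If v₀, U₀ solve the unperturbed problem and w = P v + Q I^{1-α}v, Duhamel's formula reads v = v₀ + χ
* w, U = U₀ + Φ * w. The first is a Volterra equation whose kernel O(t^{α/2-1}) is integrable; it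
has a fixed point in the sup norm weighted by t^{β-1}e^{νt} for large ν
(`exists_volterra_solution`). The second then defines U (`exists_isSolution_of_free`). For the
initial value, v₀ = Aχ u₀ and U₀ = AΦ u₀, with β = α; for the source, v₀ = Aχ * g and U₀ = AΦ * g,
with β = η + α. The bounds on Aχ and AΦ give exactly the powers of t in the a priori estimate.

Weak continuity at 0 is read off from the variational equation for test elements in H^1_0(Ω), and
extends to L_2(Ω) by density and boundedness of u. -/

namespace FracPDE

set_option linter.unusedSectionVars false

/-! ### Beta integrals -/

section BetaKernel

theorem intervalIntegrable_rpow_mul_sub_rpow {b c t : ℝ} (hb : 0 < b) (hc : 0 < c) (ht : 0 < t) :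
    IntervalIntegrable (fun s => s ^ (b - 1) * (t - s) ^ (c - 1)) volume 0 t := by
  have left : ∀ {b : ℝ} (c : ℝ), 0 < b →
      IntervalIntegrable (fun s => s ^ (b - 1) * (t - s) ^ (c - 1)) volume 0 (t / 2) := by
    intro b c hb
    apply IntervalIntegrable.mul_continuousOn
    · exact intervalIntegral.intervalIntegrable_rpow' (by linarith)
    · intro x hx
      rw [uIcc_of_le (by positivity)] at hx
      exact (ContinuousAt.rpow_const (by fun_prop)
        (Or.inl (by linarith [hx.2]))).continuousWithinAt
  refine (left c hb).trans ?_
  have h := (left b hc).comp_sub_left t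
  rw [sub_zero, sub_half] at h
  refine (h.symm).congr fun s _ => ?_
  simp only [sub_sub_cancel]
  rw [mul_comm]

theorem integral_rpow_mul_sub_rpow {b c t : ℝ} (hb : 0 < b) (hc : 0 < c) (ht : 0 < t) :
    ∫ s in (0 : ℝ)..t, s ^ (b - 1) * (t - s) ^ (c - 1)
      = ProbabilityTheory.beta b c * t ^ (b + c - 1) := by
  have h := Complex.betaIntegral_scaled (b : ℂ) (c : ℂ) ht
  rw [Complex.betaIntegral_eq_Gamma_mul_div _ _ (by simpa) (by simpa)] at h
  apply Complex.ofReal_injective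
  rw [← intervalIntegral.integral_ofReal]
  have e : ∀ s ∈ uIoc 0 t, ((s ^ (b - 1) * (t - s) ^ (c - 1) : ℝ) : ℂ)
      = (s : ℂ) ^ ((b : ℂ) - 1) * ((t : ℂ) - s) ^ ((c : ℂ) - 1) := by
    intro s hs
    rw [uIoc_of_le ht.le] at hs
    rw [Complex.ofReal_mul, Complex.ofReal_cpow hs.1.le, Complex.ofReal_cpow (by linarith [hs.2])]
    push_cast
    rfl
  rw [intervalIntegral.integral_congr_ae (Eventually.of_forall e), h, ProbabilityTheory.beta]
  push_cast [Complex.ofReal_cpow ht.le, Complex.Gamma_ofReal]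
  rw [← Complex.ofReal_add, Complex.Gamma_ofReal]
  push_cast
  ring

end BetaKernel

/-! ### Functions with a power singularity at 0 and their half-line convolutions -/

variable {E E' E'' F F' G : Type*} [NormedAddCommGroup E] [NormedSpace ℝ E]
  [NormedAddCommGroup E'] [NormedSpace ℝ E'] [NormedAddCommGroup E''] [NormedSpace ℝ E'']
  [NormedAddCommGroup F] [NormedSpace ℝ F] [NormedAddCommGroup F'] [NormedSpace ℝ F']
  [NormedAddCommGroup G] [NormedSpace ℝ G]

/-- `f` is measurable on `(0, ∞)` and `O(t^(γ-1))` on every bounded interval `(0, T]`. -/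
structure Sing (γ : ℝ) (f : ℝ → E) : Prop where
  meas : AEStronglyMeasurable f (volume.restrict (Ioi 0))
  bdd : ∀ T > 0, ∃ C, 0 ≤ C ∧ ∀ t, 0 < t → t ≤ T → ‖f t‖ ≤ C * t ^ (γ - 1)

/-- The convolution `∫_0^t L (f s) (g (t - s)) ds` on the half line. -/
noncomputable def hconv (L : E →L[ℝ] E' →L[ℝ] F) (f : ℝ → E) (g : ℝ → E') (t : ℝ) : F :=
  ∫ s in (0 : ℝ)..t, L (f s) (g (t - s))

theorem Sing.norm {γ : ℝ} {f : ℝ → E} (hf : Sing γ f) : Sing γ (fun t => ‖f t‖) :=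
  ⟨hf.meas.norm, fun T hT => by
    obtain ⟨C, hC, h⟩ := hf.bdd T hT
    exact ⟨C, hC, fun t h0 h1 => by simpa using h t h0 h1⟩⟩

theorem Sing.of_le {γ C : ℝ} {f : ℝ → E} (hf : AEStronglyMeasurable f (volume.restrict (Ioi 0)))
    (h : ∀ t, 0 < t → ‖f t‖ ≤ C * t ^ (γ - 1)) : Sing γ f :=
  ⟨hf, fun _ _ => ⟨max C 0, le_max_right _ _, fun t h0 _ => (h t h0).trans
    (mul_le_mul_of_nonneg_right (le_max_left _ _) (Real.rpow_nonneg h0.le _))⟩⟩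

theorem Sing.congr {γ : ℝ} {f g : ℝ → E} (hf : Sing γ f) (h : ∀ t, 0 < t → f t = g t) :
    Sing γ g :=
  ⟨hf.meas.congr ((ae_restrict_iff' measurableSet_Ioi).2 (Eventually.of_forall h)), fun T hT => by
    obtain ⟨C, hC, h'⟩ := hf.bdd T hT
    exact ⟨C, hC, fun t h0 h1 => h t h0 ▸ h' t h0 h1⟩⟩

theorem Sing.mono {γ δ : ℝ} {f : ℝ → E} (hf : Sing γ f) (h : δ ≤ γ) : Sing δ f := by
  refine ⟨hf.meas, fun T hT => ?_⟩
  obtain ⟨C, hC, h'⟩ := hf.bdd T hT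
  refine ⟨C * T ^ (γ - δ), by positivity, fun t h0 h1 => (h' t h0 h1).trans ?_⟩
  rw [mul_assoc]
  refine mul_le_mul_of_nonneg_left ?_ hC
  calc t ^ (γ - 1) = t ^ (γ - δ) * t ^ (δ - 1) := by rw [← Real.rpow_add h0]; ring_nf
    _ ≤ _ := mul_le_mul_of_nonneg_right
      (Real.rpow_le_rpow h0.le h1 (by linarith)) (Real.rpow_nonneg h0.le _)

theorem Sing.add {γ : ℝ} {f g : ℝ → E} (hf : Sing γ f) (hg : Sing γ g) :
    Sing γ (fun t => f t + g t) := by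
  refine ⟨hf.meas.add hg.meas, fun T hT => ?_⟩
  obtain ⟨C, hC, h⟩ := hf.bdd T hT
  obtain ⟨D, hD, h'⟩ := hg.bdd T hT
  refine ⟨C + D, by positivity, fun t h0 h1 => ?_⟩
  rw [add_mul]
  exact norm_add_le_of_le (h t h0 h1) (h' t h0 h1)

theorem Sing.clm {γ : ℝ} {f : ℝ → E} (hf : Sing γ f) (L : E →L[ℝ] F) :
    Sing γ (fun t => L (f t)) := by
  refine ⟨L.continuous.comp_aestronglyMeasurable hf.meas, fun T hT => ?_⟩
  obtain ⟨C, hC, h⟩ := hf.bdd T hT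
  refine ⟨‖L‖ * C, by positivity, fun t h0 h1 => ?_⟩
  rw [mul_assoc]
  exact (L.le_opNorm _).trans (mul_le_mul_of_nonneg_left (h t h0 h1) (norm_nonneg _))

/-- Application of a bounded measurable family of operators. -/
theorem Sing.clm_apply {γ C : ℝ} {f : ℝ → E} (hf : Sing γ f) {P : ℝ → E →L[ℝ] F}
    (hP : AEStronglyMeasurable P (volume.restrict (Ioi 0))) (hC : ∀ t, ‖P t‖ ≤ C) :
    Sing γ (fun t => P t (f t)) := by
  refine ⟨(ContinuousLinearMap.id ℝ (E →L[ℝ] F)).aestronglyMeasurable_comp₂ hP hf.meas, fun T hT => ?_⟩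
  obtain ⟨D, hD, h⟩ := hf.bdd T hT
  have hC0 : 0 ≤ C := (norm_nonneg _).trans (hC 0)
  refine ⟨C * D, by positivity, fun t h0 h1 => ?_⟩
  rw [mul_assoc]
  exact ((P t).le_opNorm _).trans (mul_le_mul (hC t) (h t h0 h1) (norm_nonneg _) hC0)

theorem Sing.intervalIntegrable {γ : ℝ} {f : ℝ → E} (hf : Sing γ f) (hγ : 0 < γ) {t : ℝ}
    (ht : 0 ≤ t) : IntervalIntegrable f volume 0 t := by
  rcases ht.eq_or_lt with rfl | ht
  · exact IntervalIntegrable.refl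
  obtain ⟨C, hC, h⟩ := hf.bdd t ht
  have h1 : IntervalIntegrable (fun s : ℝ => C * s ^ (γ - 1)) volume 0 t :=
    (intervalIntegral.intervalIntegrable_rpow' (by linarith)).const_mul C
  refine h1.mono_fun' ?_ ?_
  · rw [uIoc_of_le ht.le]
    exact hf.meas.mono_set Ioc_subset_Ioi_self
  · rw [uIoc_of_le ht.le]
    exact (ae_restrict_iff' measurableSet_Ioc).2
      (Eventually.of_forall fun s hs => h s hs.1 hs.2)

section

variable (L : E →L[ℝ] E' →L[ℝ] F) {f : ℝ → E} {g : ℝ → E'} {β γ : ℝ}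

theorem norm_hconv_integrand_le {t C D : ℝ} (hf : ∀ s, 0 < s → s ≤ t → ‖f s‖ ≤ C * s ^ (β - 1))
    (hg : ∀ s, 0 < s → s ≤ t → ‖g s‖ ≤ D * s ^ (γ - 1)) {s : ℝ} (h0 : 0 < s) (h1 : s < t) :
    ‖L (f s) (g (t - s))‖ ≤ ‖L‖ * C * D * (s ^ (β - 1) * (t - s) ^ (γ - 1)) := by
  calc _ ≤ ‖L‖ * ‖f s‖ * ‖g (t - s)‖ := L.le_opNorm₂ _ _
    _ ≤ ‖L‖ * (C * s ^ (β - 1)) * (D * (t - s) ^ (γ - 1)) := by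
      have a := hf s h0 h1.le
      have b := hg (t - s) (by linarith) (by linarith)
      have := (norm_nonneg _).trans a
      gcongr
    _ = _ := by ring

theorem norm_hconv_le (hβ : 0 < β) (hγ : 0 < γ) {t C D : ℝ} (ht : 0 < t)
    (hf : ∀ s, 0 < s → s ≤ t → ‖f s‖ ≤ C * s ^ (β - 1))
    (hg : ∀ s, 0 < s → s ≤ t → ‖g s‖ ≤ D * s ^ (γ - 1)) :
    ‖hconv L f g t‖ ≤ ‖L‖ * C * D * ProbabilityTheory.beta β γ * t ^ (β + γ - 1) := by
  rw [mul_assoc, ← integral_rpow_mul_sub_rpow hβ hγ ht, ← intervalIntegral.integral_const_mul]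
  refine intervalIntegral.norm_integral_le_of_norm_le ht.le ?_
    ((intervalIntegrable_rpow_mul_sub_rpow hβ hγ ht).const_mul _)
  filter_upwards [(measure_eq_zero_iff_ae_notMem.1 (measure_singleton t) : ∀ᵐ s, s ∉ ({t} : Set ℝ))]
    with s hs hs'
  exact norm_hconv_integrand_le L hf hg hs'.1 (lt_of_le_of_ne hs'.2 hs)

theorem convolution_integrand_indicator (t s : ℝ) :
    L ((Ioi 0).indicator f s) ((Ioi 0).indicator g (t - s))
      = (Ioo 0 t).indicator (fun s => L (f s) (g (t - s))) s := by
  by_cases h0 : 0 < s <;> by_cases h1 : s < t <;>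
    simp [indicator, h0, h1]

/-- Extension by zero to negative times turns `hconv` into the convolution on ℝ, so that
measurability and associativity are inherited from the latter. -/
theorem convolution_indicator (t : ℝ) :
    convolution ((Ioi 0).indicator f) ((Ioi 0).indicator g) L volume t
      = (Ioi 0).indicator (hconv L f g) t := by
  simp only [convolution, convolution_integrand_indicator]
  rw [integral_indicator measurableSet_Ioo]
  by_cases ht : 0 < t
  · rw [indicator_of_mem (mem_Ioi.2 ht), hconv, intervalIntegral.integral_of_le ht.le, integral_Ioc_eq_integral_Ioo]
  · rw [indicator_of_notMem (by simpa using ht), Ioo_eq_empty ht]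
    simp

theorem convolutionExistsAt_indicator (hf : Sing β f) (hg : Sing γ g) (hβ : 0 < β) (hγ : 0 < γ)
    (t : ℝ) : ConvolutionExistsAt ((Ioi 0).indicator f) ((Ioi 0).indicator g) t L volume := by
  have hm : AEStronglyMeasurable (fun s => L ((Ioi 0).indicator f s)
      ((Ioi 0).indicator g (t - s))) volume :=
    AEStronglyMeasurable.convolution_integrand_snd L
      ((aestronglyMeasurable_indicator_iff measurableSet_Ioi).2 hf.meas)
      ((aestronglyMeasurable_indicator_iff measurableSet_Ioi).2 hg.meas) t
  unfold ConvolutionExistsAt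
  simp only [convolution_integrand_indicator] at hm ⊢
  rw [integrable_indicator_iff measurableSet_Ioo]
  rw [aestronglyMeasurable_indicator_iff measurableSet_Ioo] at hm
  by_cases ht : 0 < t
  · obtain ⟨C, hC, hC'⟩ := hf.bdd t ht
    obtain ⟨D, hD, hD'⟩ := hg.bdd t ht
    have h := ((intervalIntegrable_rpow_mul_sub_rpow hβ hγ ht).const_mul (‖L‖ * C * D))
    rw [intervalIntegrable_iff_integrableOn_Ioo_of_le ht.le] at h
    refine Integrable.mono' h hm ((ae_restrict_iff' measurableSet_Ioo).2
      (Eventually.of_forall fun s hs => norm_hconv_integrand_le L hC' hD' hs.1 hs.2))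
  · rw [Ioo_eq_empty ht]
    exact integrableOn_empty

theorem intervalIntegrable_hconv (hf : Sing β f) (hg : Sing γ g) (hβ : 0 < β) (hγ : 0 < γ)
    {t : ℝ} (ht : 0 ≤ t) :
    IntervalIntegrable (fun s => L (f s) (g (t - s))) volume 0 t := by
  have h := convolutionExistsAt_indicator L hf hg hβ hγ t
  unfold ConvolutionExistsAt at h
  simp only [convolution_integrand_indicator] at h
  rwa [integrable_indicator_iff measurableSet_Ioo,
    ← intervalIntegrable_iff_integrableOn_Ioo_of_le ht] at h

theorem Sing.hconv (hf : Sing β f) (hg : Sing γ g) (hβ : 0 < β) (hγ : 0 < γ) :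
    Sing (β + γ) (hconv L f g) := by
  constructor
  · have hm := (AEStronglyMeasurable.convolution_integrand (μ := volume) (ν := volume) L
      ((aestronglyMeasurable_indicator_iff measurableSet_Ioi).2 hf.meas)
      ((aestronglyMeasurable_indicator_iff measurableSet_Ioi).2 hg.meas)).integral_prod_right'
    rw [← aestronglyMeasurable_indicator_iff measurableSet_Ioi]
    exact hm.congr (Eventually.of_forall fun t => convolution_indicator L t)
  · intro T hT
    obtain ⟨C, hC, hC'⟩ := hf.bdd T hT
    obtain ⟨D, hD, hD'⟩ := hg.bdd T hT
    have := (ProbabilityTheory.beta_pos hβ hγ).le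
    exact ⟨‖L‖ * C * D * ProbabilityTheory.beta β γ, by positivity, fun t h0 h1 =>
      norm_hconv_le L hβ hγ h0 (fun s h0' h => hC' s h0' (h.trans h1))
        fun s h0' h => hD' s h0' (h.trans h1)⟩

/-- Associativity of convolution on the half line. -/
theorem hconv_assoc [CompleteSpace F] [CompleteSpace F'] [CompleteSpace G]
    (L : E →L[ℝ] E' →L[ℝ] F) (L₂ : F →L[ℝ] E'' →L[ℝ] G)
    (L₃ : E →L[ℝ] F' →L[ℝ] G) (L₄ : E' →L[ℝ] E'' →L[ℝ] F')
    (hL : ∀ x y z, L₂ (L x y) z = L₃ x (L₄ y z)) {k : ℝ → E''} {δ : ℝ}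
    (hf : Sing β f) (hg : Sing γ g) (hk : Sing δ k) (hβ : 0 < β) (hγ : 0 < γ) (hδ : 0 < δ)
    {t : ℝ} (ht : 0 < t) :
    FracPDE.hconv L₂ (FracPDE.hconv L f g) k t = FracPDE.hconv L₃ f (FracPDE.hconv L₄ g k) t := by
  have key : convolution (convolution ((Ioi 0).indicator f) ((Ioi 0).indicator g) L volume)
      ((Ioi 0).indicator k) L₂ volume t = convolution ((Ioi 0).indicator f)
      (convolution ((Ioi 0).indicator g) ((Ioi 0).indicator k) L₄ volume) L₃ volume t := by
    refine convolution_assoc L L₂ L₃ L₄ hL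
      ((aestronglyMeasurable_indicator_iff measurableSet_Ioi).2 hf.meas)
      ((aestronglyMeasurable_indicator_iff measurableSet_Ioi).2 hg.meas)
      ((aestronglyMeasurable_indicator_iff measurableSet_Ioi).2 hk.meas)
      (Eventually.of_forall fun x => convolutionExistsAt_indicator L hf hg hβ hγ x)
      (Eventually.of_forall fun x => ?_) ?_
    · simp only [norm_indicator_eq_indicator_norm]
      exact convolutionExistsAt_indicator _ hg.norm hk.norm hγ hδ x
    · simp only [norm_indicator_eq_indicator_norm]
      have : convolution ((Ioi 0).indicator fun x => ‖g x‖) ((Ioi 0).indicator fun x => ‖k x‖)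
          (ContinuousLinearMap.mul ℝ ℝ) volume = (Ioi 0).indicator
            (FracPDE.hconv (ContinuousLinearMap.mul ℝ ℝ) (fun x => ‖g x‖) fun x => ‖k x‖) := by
        ext x
        exact convolution_indicator _ x
      rw [this]
      exact convolutionExistsAt_indicator _ hf.norm (hg.norm.hconv _ hk.norm hγ hδ) hβ
        (by positivity) t
  have e1 : convolution ((Ioi 0).indicator f) ((Ioi 0).indicator g) L volume
      = (Ioi 0).indicator (FracPDE.hconv L f g) := funext (convolution_indicator L)
  have e2 : convolution ((Ioi 0).indicator g) ((Ioi 0).indicator k) L₄ volume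
      = (Ioi 0).indicator (FracPDE.hconv L₄ g k) := funext (convolution_indicator L₄)
  rw [e1, e2, convolution_indicator, convolution_indicator, indicator_of_mem (mem_Ioi.2 ht),
    indicator_of_mem (mem_Ioi.2 ht)] at key
  exact key

end

end FracPDE

/-! ### Continuity of singular convolutions -/

namespace FracPDE

set_option linter.unusedSectionVars false

variable {E E' F : Type*} [NormedAddCommGroup E] [NormedSpace ℝ E]
  [NormedAddCommGroup E'] [NormedSpace ℝ E'] [NormedAddCommGroup F] [NormedSpace ℝ F]

/-- Powers are monotone in one direction or the other, so the sum of the endpoint values is a bound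
that needs no case split on the sign of the exponent. -/
theorem rpow_le_rpow_add_rpow {a s b : ℝ} (ha : 0 < a) (has : a ≤ s) (hsb : s ≤ b) (p : ℝ) :
    s ^ p ≤ a ^ p + b ^ p := by
  have hs := ha.trans_le has
  rcases le_total 0 p with hp | hp
  · have := Real.rpow_le_rpow hs.le hsb hp
    have := Real.rpow_nonneg ha.le p
    linarith
  · have := Real.rpow_le_rpow_of_nonpos ha has hp
    have := Real.rpow_nonneg (hs.le.trans hsb) p
    linarith

/-- A continuous cutoff, `0` on `(-∞, δ]` and `1` on `[2δ, ∞)`. -/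
noncomputable def cutoff (δ s : ℝ) : ℝ := max 0 (min 1 (s / δ - 1))

theorem cutoff_nonneg (δ s : ℝ) : 0 ≤ cutoff δ s := le_max_left _ _

theorem cutoff_le_one (δ s : ℝ) : cutoff δ s ≤ 1 := max_le zero_le_one (min_le_left _ _)

theorem cutoff_eq_zero {δ s : ℝ} (hδ : 0 < δ) (h : s ≤ δ) : cutoff δ s = 0 := by
  refine max_eq_left ((min_le_right _ _).trans ?_)
  rw [sub_nonpos, div_le_one hδ]
  exact h

theorem cutoff_eq_one {δ s : ℝ} (hδ : 0 < δ) (h : 2 * δ ≤ s) : cutoff δ s = 1 := by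
  have : 2 ≤ s / δ := by rwa [le_div_iff₀ hδ]
  rw [cutoff, min_eq_left (by linarith), max_eq_right zero_le_one]

theorem continuous_cutoff (δ : ℝ) : Continuous (cutoff δ) := by
  unfold cutoff
  fun_prop

theorem continuous_cutoff_smul {g : ℝ → E} (hg : ContinuousOn g (Ioi 0)) {δ : ℝ} (hδ : 0 < δ) :
    Continuous fun s => cutoff δ s • g s := by
  rw [continuous_iff_continuousAt]
  intro s
  rcases lt_or_ge 0 s with h | h
  · exact (continuous_cutoff δ).continuousAt.smul (hg.continuousAt (Ioi_mem_nhds h))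
  · refine (continuousAt_const (y := (0 : E))).congr ?_
    filter_upwards [Iio_mem_nhds (h.trans_lt hδ)] with x hx
    rw [cutoff_eq_zero hδ (le_of_lt hx), zero_smul]

theorem norm_cutoff_smul_le {g : ℝ → E} {γ D T : ℝ} (hD : 0 ≤ D)
    (hg : ∀ s, 0 < s → s ≤ T → ‖g s‖ ≤ D * s ^ (γ - 1)) {δ : ℝ} (hδ : 0 < δ) {s : ℝ}
    (hs : s ≤ T) :
    ‖cutoff δ s • g s‖ ≤ D * (δ ^ (γ - 1) + |T| ^ (γ - 1)) := by
  rcases le_total s δ with h | h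
  · rw [cutoff_eq_zero hδ h, zero_smul, norm_zero]
    positivity
  · rw [norm_smul, Real.norm_of_nonneg (cutoff_nonneg _ _)]
    have h0 := hδ.trans_le h
    calc cutoff δ s * ‖g s‖ ≤ 1 * ‖g s‖ :=
          mul_le_mul_of_nonneg_right (cutoff_le_one _ _) (norm_nonneg _)
      _ ≤ D * s ^ (γ - 1) := by rw [one_mul]; exact hg s h0 hs
      _ ≤ _ := mul_le_mul_of_nonneg_left
        (rpow_le_rpow_add_rpow hδ h (hs.trans (le_abs_self _)) _) hD

/-- The cutoff only matters for s ≤ 2δ, where s^(γ/2) ≤ (2δ)^(γ/2). Half of the exponent pays for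
smallness and the other half keeps the singularity integrable. -/
theorem norm_sub_cutoff_smul_le {g : ℝ → E} {γ D T : ℝ} (hγ : 0 < γ) (hD : 0 ≤ D)
    (hg : ∀ s, 0 < s → s ≤ T → ‖g s‖ ≤ D * s ^ (γ - 1)) {δ : ℝ} (hδ : 0 < δ) {s : ℝ}
    (h0 : 0 < s) (hs : s ≤ T) :
    ‖g s - cutoff δ s • g s‖ ≤ D * (2 * δ) ^ (γ / 2) * s ^ (γ / 2 - 1) := by
  rcases le_total (2 * δ) s with h | h
  · rw [cutoff_eq_one hδ h, one_smul, sub_self, norm_zero]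
    positivity
  · have e : g s - cutoff δ s • g s = (1 - cutoff δ s) • g s := by rw [sub_smul, one_smul]
    rw [e, norm_smul, Real.norm_of_nonneg (sub_nonneg.2 (cutoff_le_one _ _))]
    calc (1 - cutoff δ s) * ‖g s‖ ≤ 1 * ‖g s‖ :=
          mul_le_mul_of_nonneg_right (by linarith [cutoff_nonneg δ s]) (norm_nonneg _)
      _ ≤ D * s ^ (γ - 1) := by rw [one_mul]; exact hg s h0 hs
      _ = D * (s ^ (γ / 2) * s ^ (γ / 2 - 1)) := by rw [← Real.rpow_add h0]; ring_nf
      _ ≤ D * ((2 * δ) ^ (γ / 2) * s ^ (γ / 2 - 1)) := by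
        have := Real.rpow_le_rpow h0.le h (by positivity : 0 ≤ γ / 2)
        have := Real.rpow_nonneg h0.le (γ / 2 - 1)
        gcongr
      _ = _ := by ring

variable (L : E →L[ℝ] E' →L[ℝ] F) {f : ℝ → E} {g : ℝ → E'} {β γ : ℝ}

/-- The cut-off factor is continuous on all of ℝ and vanishes on negative arguments. Near t the
upper limit may thus be frozen at t + 1, and dominated convergence applies. -/
theorem continuousAt_hconv_cutoff (hf : Sing β f) (hβ : 0 < β) (hg : Sing γ g)
    (hgc : ContinuousOn g (Ioi 0)) {δ : ℝ} (hδ : 0 < δ) {t : ℝ} (ht : 0 < t) :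
    ContinuousAt (hconv L f fun s => cutoff δ s • g s) t := by
  obtain ⟨D, hD, hD'⟩ := hg.bdd (t + 1) (by positivity)
  set k : ℝ → E' := fun s => cutoff δ s • g s with hk
  have hkc : Continuous k := continuous_cutoff_smul hgc hδ
  have hfi := hf.intervalIntegrable hβ (by positivity : 0 ≤ t + 1)
  have h1 : ContinuousAt (fun x => ∫ s in (0 : ℝ)..(t + 1), L (f s) (k (x - s))) t := by
    refine intervalIntegral.continuousAt_of_dominated_interval
      (bound := fun s => ‖L‖ * ‖f s‖ * (D * (δ ^ (γ - 1) + |t + 1| ^ (γ - 1))))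
      (Eventually.of_forall fun x => ?_) ?_ ?_ ?_
    · rw [uIoc_of_le (by positivity)]
      exact L.aestronglyMeasurable_comp₂ (hf.meas.mono_set Ioc_subset_Ioi_self)
        (hkc.comp (by fun_prop)).aestronglyMeasurable
    · filter_upwards [Iio_mem_nhds (lt_add_one t)] with x hx
      refine Eventually.of_forall fun s hs => (L.le_opNorm₂ _ _).trans ?_
      rw [uIoc_of_le (by positivity)] at hs
      refine mul_le_mul_of_nonneg_left (norm_cutoff_smul_le hD hD' hδ ?_) (by positivity)
      have := hs.1
      have := mem_Iio.1 hx
      linarith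
    · exact (hfi.norm.const_mul _).mul_const _
    · exact Eventually.of_forall fun s _ =>
        ((L (f s)).continuous.comp (hkc.comp (by fun_prop))).continuousAt
  refine h1.congr ?_
  filter_upwards [Ioo_mem_nhds ht (lt_add_one t)] with x hx
  have hz : ∀ s ∈ Ioc x (t + 1), L (f s) (k (x - s)) = 0 := fun s hs => by
    rw [hk]
    simp only
    rw [cutoff_eq_zero hδ (by linarith [hs.1]), zero_smul, map_zero]
  have hi : ∀ y, 0 ≤ y → y ≤ t + 1 →
      IntervalIntegrable (fun s => L (f s) (k (x - s))) volume 0 y := by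
    intro y hy hy'
    have hfi := hf.intervalIntegrable hβ hy
    refine ((hfi.norm.const_mul ‖L‖).mul_const
      (D * (δ ^ (γ - 1) + |t + 1| ^ (γ - 1)))).mono_fun' ?_ ?_
    · rw [uIoc_of_le hy]
      exact L.aestronglyMeasurable_comp₂ (hf.meas.mono_set Ioc_subset_Ioi_self)
        (hkc.comp (by fun_prop)).aestronglyMeasurable
    · rw [uIoc_of_le hy]
      refine (ae_restrict_iff' measurableSet_Ioc).2 (Eventually.of_forall fun s hs => ?_)
      refine (L.le_opNorm₂ _ _).trans ?_
      refine mul_le_mul_of_nonneg_left (norm_cutoff_smul_le hD hD' hδ ?_) (by positivity)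
      linarith [hs.1, hx.2]
  have hxt : IntervalIntegrable (fun s => L (f s) (k (x - s))) volume x (t + 1) :=
    (hi x hx.1.le hx.2.le).symm.trans (hi (t + 1) (by positivity) le_rfl)
  rw [hconv, ← intervalIntegral.integral_add_adjacent_intervals (hi x hx.1.le hx.2.le) hxt]
  rw [intervalIntegral.integral_of_le hx.2.le, setIntegral_congr_fun measurableSet_Ioc hz]
  simp [hk]

/-- The convolutions with the cut-off factor are continuous and converge locally uniformly as δ → 0,
so continuity is required of one factor only. -/
theorem continuousOn_hconv (hf : Sing β f) (hg : Sing γ g) (hβ : 0 < β) (hγ : 0 < γ)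
    (hgc : ContinuousOn g (Ioi 0)) : ContinuousOn (hconv L f g) (Ioi 0) := by
  refine continuousOn_of_locally_uniform_approx_of_continuousWithinAt fun t ht u hu => ?_
  obtain ⟨ε, hε, hεu⟩ := Metric.mem_uniformity_dist.1 hu
  have ht : 0 < t := ht
  obtain ⟨C, hC, hC'⟩ := hf.bdd (t + 1) (by positivity)
  obtain ⟨D, hD, hD'⟩ := hg.bdd (t + 1) (by positivity)
  set p := β + γ / 2 - 1
  have hB := ProbabilityTheory.beta_pos hβ (half_pos hγ)
  set K := ‖L‖ * C * D * ProbabilityTheory.beta β (γ / 2) * ((t / 2) ^ p + (t + 1) ^ p) with hK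
  have hK0 : 0 ≤ K := by positivity
  -- Solves (2δ)^(γ/2) = ε/(K + 1), where K collects the other constants in the error.
  set δ := (ε / (K + 1)) ^ (2 / γ) / 2 with hδd
  have hδ : 0 < δ := by positivity
  have hδ2 : (2 * δ) ^ (γ / 2) = ε / (K + 1) := by
    rw [hδd, mul_div_cancel₀ _ two_ne_zero, ← Real.rpow_mul (by positivity)]
    rw [div_mul_div_cancel₀ hγ.ne', div_self two_ne_zero, Real.rpow_one]
  refine ⟨Ioo (t / 2) (t + 1), mem_nhdsWithin_of_mem_nhds
    (Ioo_mem_nhds (by linarith) (by linarith)), _,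
    (continuousAt_hconv_cutoff L hf hβ hg hgc hδ ht).continuousWithinAt, fun x hx => hεu ?_⟩
  have hx0 : 0 < x := by linarith [hx.1]
  have hkc : Continuous fun s => cutoff δ s • g s := continuous_cutoff_smul hgc hδ
  have hks : Sing γ fun s => cutoff δ s • g s := by
    refine ⟨hkc.aestronglyMeasurable, fun T hT => ?_⟩
    obtain ⟨D, hD, hD'⟩ := hg.bdd T hT
    refine ⟨D, hD, fun s h0 h1 => le_trans ?_ (hD' s h0 h1)⟩
    rw [norm_smul, Real.norm_of_nonneg (cutoff_nonneg _ _)]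
    exact mul_le_of_le_one_left (norm_nonneg _) (cutoff_le_one _ _)
  have hd : hconv L f g x - hconv L f (fun s => cutoff δ s • g s) x
      = hconv L f (fun s => g s - cutoff δ s • g s) x := by
    simp only [hconv]
    rw [← intervalIntegral.integral_sub (intervalIntegrable_hconv L hf hg hβ hγ hx0.le)
      (intervalIntegrable_hconv L hf hks hβ hγ hx0.le)]
    simp only [map_sub]
  rw [dist_eq_norm, hd]
  calc _ ≤ ‖L‖ * C * (D * (2 * δ) ^ (γ / 2)) * ProbabilityTheory.beta β (γ / 2)
        * x ^ (β + γ / 2 - 1) :=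
        norm_hconv_le L hβ (half_pos hγ) hx0 (fun s h0 h1 => hC' s h0 (h1.trans hx.2.le))
          fun s h0 h1 => norm_sub_cutoff_smul_le hγ hD hD' hδ h0 (h1.trans hx.2.le)
    _ ≤ ‖L‖ * C * (D * (2 * δ) ^ (γ / 2)) * ProbabilityTheory.beta β (γ / 2)
        * ((t / 2) ^ p + (t + 1) ^ p) :=
      mul_le_mul_of_nonneg_left (rpow_le_rpow_add_rpow (by positivity) hx.1.le hx.2.le _)
        (by positivity)
    _ = ε * (K / (K + 1)) := by rw [hδ2, hK]; ring
    _ < ε := by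
      refine mul_lt_of_lt_one_right hε ?_
      rw [div_lt_one (by positivity)]
      linarith

end FracPDE

/-! ### Fractional integrals: semigroup law and scaling -/

namespace FracPDE

set_option linter.unusedSectionVars false

variable {E E' F : Type*} [NormedAddCommGroup E] [NormedSpace ℝ E]
  [NormedAddCommGroup E'] [NormedSpace ℝ E'] [NormedAddCommGroup F] [NormedSpace ℝ F]

theorem omega_pos {a t : ℝ} (ha : 0 < a) (ht : 0 < t) : 0 < omega a t :=
  div_pos (Real.rpow_pos_of_pos ht _) (Real.Gamma_pos_of_pos ha)

theorem omega_nonneg {a t : ℝ} (ha : 0 < a) (ht : 0 ≤ t) : 0 ≤ omega a t :=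
  div_nonneg (Real.rpow_nonneg ht _) (Real.Gamma_pos_of_pos ha).le

theorem omega_one (t : ℝ) : omega 1 t = 1 := by simp [omega]

theorem norm_omega {a t : ℝ} (ha : 0 < a) (ht : 0 < t) :
    ‖omega a t‖ = (Real.Gamma a)⁻¹ * t ^ (a - 1) := by
  rw [Real.norm_of_nonneg (omega_pos ha ht).le, omega, div_eq_inv_mul]

theorem continuousOn_omega (a : ℝ) : ContinuousOn (omega a) (Ioi 0) := fun t ht =>
  ((Real.continuousAt_rpow_const t _ (Or.inl (ne_of_gt ht))).div_const _).continuousWithinAt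

theorem sing_omega {a : ℝ} (ha : 0 < a) : Sing a (omega a) :=
  Sing.of_le ((continuousOn_omega a).aestronglyMeasurable measurableSet_Ioi)
    fun _ ht => (norm_omega ha ht).le

theorem fracInt_eq_hconv (a : ℝ) (φ : ℝ → E) :
    fracInt a φ = hconv (ContinuousLinearMap.lsmul ℝ ℝ).flip φ (omega a) := rfl

theorem intervalIntegrable_fracInt {a β : ℝ} {φ : ℝ → E} (ha : 0 < a) (hβ : 0 < β)
    (hφ : Sing β φ) {t : ℝ} (ht : 0 ≤ t) :
    IntervalIntegrable (fun s => omega a (t - s) • φ s) volume 0 t :=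
  intervalIntegrable_hconv (ContinuousLinearMap.lsmul ℝ ℝ).flip hφ (sing_omega ha) hβ ha ht

theorem Sing.fracInt {a β : ℝ} {φ : ℝ → E} (hφ : Sing β φ) (ha : 0 < a) (hβ : 0 < β) :
    Sing (β + a) (fracInt a φ) := by
  rw [fracInt_eq_hconv]
  exact hφ.hconv _ (sing_omega ha) hβ ha

theorem continuousOn_fracInt {a β : ℝ} {φ : ℝ → E} (ha : 0 < a) (hβ : 0 < β) (hφ : Sing β φ) :
    ContinuousOn (fracInt a φ) (Ioi 0) := by
  rw [fracInt_eq_hconv]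
  exact continuousOn_hconv _ hφ (sing_omega ha) hβ ha (continuousOn_omega a)

theorem norm_fracInt_le {a β C t : ℝ} {φ : ℝ → E} (ha : 0 < a) (hβ : 0 < β) (ht : 0 < t)
    (hφ : ∀ s, 0 < s → s ≤ t → ‖φ s‖ ≤ C * s ^ (β - 1)) :
    ‖fracInt a φ t‖ ≤ Real.Gamma β / Real.Gamma (β + a) * C * t ^ (β + a - 1) := by
  have hC : 0 ≤ C := by
    have h := (norm_nonneg _).trans (hφ t ht le_rfl)
    exact nonneg_of_mul_nonneg_left h (Real.rpow_pos_of_pos ht _)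
  have hL : ‖(ContinuousLinearMap.lsmul ℝ ℝ : ℝ →L[ℝ] E →L[ℝ] E).flip‖ ≤ 1 := by
    rw [ContinuousLinearMap.opNorm_flip]
    exact ContinuousLinearMap.opNorm_lsmul_le
  have h := norm_hconv_le (ContinuousLinearMap.lsmul ℝ ℝ).flip hβ ha ht hφ
    fun s h0 _ => (norm_omega ha h0).le
  rw [fracInt_eq_hconv]
  have h1 := (Real.Gamma_pos_of_pos ha)
  have h2 := (Real.Gamma_pos_of_pos hβ)
  have h3 := (Real.Gamma_pos_of_pos (add_pos hβ ha))
  have h4 := Real.rpow_pos_of_pos ht (β + a - 1)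
  refine h.trans ?_
  calc _ ≤ 1 * C * (Real.Gamma a)⁻¹ * ProbabilityTheory.beta β a * t ^ (β + a - 1) := by
        have := ProbabilityTheory.beta_pos hβ ha
        gcongr
    _ = _ := by rw [ProbabilityTheory.beta]; field_simp

theorem fracInt_omega {a b t : ℝ} (ha : 0 < a) (hb : 0 < b) (ht : 0 < t) :
    fracInt a (omega b) t = omega (b + a) t := by
  have h1 := (Real.Gamma_pos_of_pos ha)
  have h2 := (Real.Gamma_pos_of_pos hb)
  have h3 := (Real.Gamma_pos_of_pos (add_pos hb ha))
  have e : ∀ s, omega a (t - s) • omega b s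
      = (Real.Gamma a)⁻¹ * (Real.Gamma b)⁻¹ * (s ^ (b - 1) * (t - s) ^ (a - 1)) := fun s => by
    simp only [omega, smul_eq_mul]
    field_simp
  simp only [fracInt, e]
  rw [intervalIntegral.integral_const_mul, integral_rpow_mul_sub_rpow hb ha ht,
    ProbabilityTheory.beta, omega]
  field_simp

theorem fracInt_one (φ : ℝ → E) (t : ℝ) : fracInt 1 φ t = ∫ s in (0 : ℝ)..t, φ s := by
  simp [fracInt, omega_one]

theorem fracInt_zero_right (a : ℝ) (φ : ℝ → E) : fracInt a φ 0 = 0 := by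
  simp [fracInt]

theorem fracInt_congr {a t : ℝ} {φ ψ : ℝ → E} (ht : 0 ≤ t)
    (h : ∀ s, 0 < s → s ≤ t → φ s = ψ s) : fracInt a φ t = fracInt a ψ t := by
  refine intervalIntegral.integral_congr_ae (Eventually.of_forall fun s hs => ?_)
  rw [uIoc_of_le ht] at hs
  rw [h s hs.1 hs.2]

theorem fracInt_add {a β t : ℝ} {φ ψ : ℝ → E} (ha : 0 < a) (hβ : 0 < β) (hφ : Sing β φ)
    (hψ : Sing β ψ) (ht : 0 ≤ t) :
    fracInt a (fun s => φ s + ψ s) t = fracInt a φ t + fracInt a ψ t := by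
  simp only [fracInt, smul_add]
  exact intervalIntegral.integral_add (intervalIntegrable_fracInt ha hβ hφ ht)
    (intervalIntegrable_fracInt ha hβ hψ ht)

theorem fracInt_smul (a c t : ℝ) (φ : ℝ → E) :
    fracInt a (fun s => c • φ s) t = c • fracInt a φ t := by
  simp only [fracInt, smul_comm _ c]
  exact intervalIntegral.integral_smul _ _

theorem fracInt_clm [CompleteSpace E] [CompleteSpace F] {a β t : ℝ} {φ : ℝ → E} (L : E →L[ℝ] F)
    (ha : 0 < a) (hβ : 0 < β) (hφ : Sing β φ) (ht : 0 ≤ t) :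
    fracInt a (fun s => L (φ s)) t = L (fracInt a φ t) := by
  simp only [fracInt, ← map_smul]
  exact L.intervalIntegral_comp_comm (intervalIntegrable_fracInt ha hβ hφ ht)

/-- Fractional integration of a convolution falls on the second factor. -/
theorem fracInt_hconv [CompleteSpace E'] [CompleteSpace F] (L : E →L[ℝ] E' →L[ℝ] F) {f : ℝ → E}
    {g : ℝ → E'} {a β γ t : ℝ} (hf : Sing β f) (hg : Sing γ g) (hβ : 0 < β) (hγ : 0 < γ)
    (ha : 0 < a) (ht : 0 < t) :
    fracInt a (hconv L f g) t = hconv L f (fracInt a g) t := by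
  rw [fracInt_eq_hconv, fracInt_eq_hconv]
  exact hconv_assoc L _ L _ (fun x y z => by simp) hf hg (sing_omega ha) hβ hγ ha ht

theorem hconv_congr_right (L : E →L[ℝ] E' →L[ℝ] F) {f : ℝ → E} {g g' : ℝ → E'} {t : ℝ}
    (ht : 0 ≤ t) (h : ∀ s, 0 < s → s ≤ t → g s = g' s) : hconv L f g t = hconv L f g' t := by
  refine intervalIntegral.integral_congr_ae ?_
  filter_upwards [(measure_eq_zero_iff_ae_notMem.1 (measure_singleton t) : ∀ᵐ s, s ∉ ({t} : Set ℝ))]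
    with s hs hs'
  rw [uIoc_of_le ht] at hs'
  have : s < t := lt_of_le_of_ne hs'.2 hs
  rw [h (t - s) (by linarith) (by linarith [hs'.1])]

theorem fracInt_fracInt [CompleteSpace E] {a b β t : ℝ} {φ : ℝ → E} (ha : 0 < a) (hb : 0 < b)
    (hβ : 0 < β) (hφ : Sing β φ) (ht : 0 < t) :
    fracInt a (fracInt b φ) t = fracInt (b + a) φ t := by
  rw [fracInt_eq_hconv b, fracInt_hconv _ hφ (sing_omega hb) hβ hb ha ht,
    hconv_congr_right _ ht.le fun s h0 _ => fracInt_omega ha hb h0]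
  rfl

/-- Homogeneity of the kernel under s ↦ μs. It reduces every eigenvalue parameter λ to the case λ =
1, with μ = λ^(1/α). -/
theorem fracInt_comp_mul {a μ t : ℝ} (hμ : 0 < μ) (φ : ℝ → E) (ht : 0 < t) :
    fracInt a (fun s => φ (μ * s)) t = μ ^ (-a) • fracInt a φ (μ * t) := by
  have h := intervalIntegral.integral_comp_mul_left (a := 0) (b := t)
    (fun s => omega a (μ * t - s) • φ s) hμ.ne'
  rw [mul_zero, eq_comm, inv_smul_eq_iff₀ hμ.ne'] at h
  rw [fracInt, fracInt, h, ← intervalIntegral.integral_smul, ← intervalIntegral.integral_smul]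
  refine intervalIntegral.integral_congr_ae (Eventually.of_forall fun s hs => ?_)
  rw [uIoc_of_le ht.le] at hs
  simp only [smul_smul]
  congr 1
  rw [← mul_sub, omega, omega, Real.mul_rpow hμ.le (by linarith [hs.2]), Real.rpow_neg hμ.le,
    Real.rpow_sub hμ, Real.rpow_one]
  have := Real.rpow_pos_of_pos hμ a
  field_simp

end FracPDE

/-! ### Exponentially weighted convolution estimates -/

namespace FracPDE

set_option linter.unusedSectionVars false

variable {E E' F : Type*} [NormedAddCommGroup E] [NormedSpace ℝ E]
  [NormedAddCommGroup E'] [NormedSpace ℝ E'] [NormedAddCommGroup F] [NormedSpace ℝ F]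

theorem exp_neg_le_rpow_neg {y γ : ℝ} (hy : 0 < y) (hγ : 0 < γ) (hγ1 : γ ≤ 1) :
    Real.exp (-y) ≤ y ^ (-γ) := by
  rw [Real.exp_neg, Real.rpow_neg hy.le]
  refine inv_anti₀ (Real.rpow_pos_of_pos hy _) ?_
  have h1 := Real.add_one_le_exp y
  rcases le_total y 1 with h | h
  · have := Real.rpow_le_one hy.le h hγ.le
    linarith
  · have := Real.rpow_le_rpow_of_exponent_le h hγ1
    rw [Real.rpow_one] at this
    linarith

/-- The constant in the exponentially weighted estimate for convolutions. -/
noncomputable def weightConst (β γ : ℝ) : ℝ := 2 / β + ((1 / 2) ^ (β - 1) + 1) * Real.Gamma γ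

theorem weightConst_pos {β γ : ℝ} (hβ : 0 < β) (hγ : 0 < γ) : 0 < weightConst β γ := by
  have := Real.Gamma_pos_of_pos hγ
  unfold weightConst
  positivity

/-- Split at t/2. On the left half e^{-x} ≤ x^{-γ} with x = ν(t-s) leaves ν^{-γ}(t-s)^{-1} ≤
2ν^{-γ}/t; on the right half s^(β-1) is comparable to t^(β-1), and the exponential is kept for the
later integration. -/
theorem weight_integrand_le {β γ ν t s : ℝ} (hγ : 0 < γ) (hγ1 : γ ≤ 1) (hν : 0 < ν)
    (h0 : 0 < s) (hs : s < t) :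
    s ^ (β - 1) * (t - s) ^ (γ - 1) * Real.exp (-ν * (t - s))
      ≤ ν ^ (-γ) * (2 / t) * s ^ (β - 1)
        + ((1 / 2) ^ (β - 1) + 1) * t ^ (β - 1) *
          ((t - s) ^ (γ - 1) * Real.exp (-ν * (t - s))) := by
  have ht : 0 < t := h0.trans hs
  have hts : 0 < t - s := sub_pos.2 hs
  have a1 := Real.rpow_pos_of_pos h0 (β - 1)
  have a2 := Real.rpow_pos_of_pos hts (γ - 1)
  have a3 := Real.exp_pos (-ν * (t - s))
  have a4 := Real.rpow_pos_of_pos hν (-γ)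
  have a5 := Real.rpow_pos_of_pos ht (β - 1)
  have a6 : (0 : ℝ) < (1 / 2) ^ (β - 1) := by positivity
  rcases le_total s (t / 2) with h | h
  · refine le_trans ?_ (le_add_of_nonneg_right (by positivity))
    have e := exp_neg_le_rpow_neg (mul_pos hν hts) hγ hγ1
    rw [← neg_mul] at e
    calc _ ≤ s ^ (β - 1) * (t - s) ^ (γ - 1) * (ν * (t - s)) ^ (-γ) := by gcongr
      _ = ν ^ (-γ) * (t - s)⁻¹ * s ^ (β - 1) := by
        rw [Real.mul_rpow hν.le hts.le, Real.rpow_sub hts, Real.rpow_one, Real.rpow_neg hts.le]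
        have := Real.rpow_pos_of_pos hts γ
        field_simp
      _ ≤ _ := by
        have : (t - s)⁻¹ ≤ 2 / t := by
          rw [inv_le_comm₀ hts (by positivity), inv_div]
          linarith
        gcongr
  · refine le_trans ?_ (le_add_of_nonneg_left (by positivity))
    have := rpow_le_rpow_add_rpow (half_pos ht) h hs.le (β - 1)
    have e : (t / 2) ^ (β - 1) = (1 / 2) ^ (β - 1) * t ^ (β - 1) := by
      rw [← Real.mul_rpow (by norm_num) ht.le]
      ring_nf
    rw [e] at this
    rw [mul_assoc]
    refine mul_le_mul_of_nonneg_right ?_ (by positivity)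
    linarith

theorem intervalIntegrable_rpow_mul_exp {γ : ℝ} (hγ : 0 < γ) (ν t : ℝ) :
    IntervalIntegrable (fun s => (t - s) ^ (γ - 1) * Real.exp (-ν * (t - s))) volume 0 t := by
  have h : IntervalIntegrable (fun s : ℝ => s ^ (γ - 1) * Real.exp (-ν * s)) volume 0 t :=
    (intervalIntegral.intervalIntegrable_rpow' (by linarith)).mul_continuousOn
      (Continuous.continuousOn (by fun_prop))
  simpa using (h.comp_sub_left t).symm

theorem integral_rpow_mul_exp_le {γ ν t : ℝ} (hγ : 0 < γ) (hν : 0 < ν) (ht : 0 < t) :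
    ∫ s in (0 : ℝ)..t, (t - s) ^ (γ - 1) * Real.exp (-ν * (t - s)) ≤ ν ^ (-γ) * Real.Gamma γ := by
  rw [intervalIntegral.integral_comp_sub_left
    (fun s : ℝ => s ^ (γ - 1) * Real.exp (-ν * s)) t, sub_self, sub_zero,
    intervalIntegral.integral_of_le ht.le]
  have h := Real.integral_rpow_mul_exp_neg_mul_Ioi hγ hν
  have e : ν ^ (-γ) * Real.Gamma γ = (1 / ν) ^ γ * Real.Gamma γ := by
    rw [one_div, Real.inv_rpow hν.le, Real.rpow_neg hν.le]
  rw [e, ← h]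
  simp only [neg_mul]
  refine setIntegral_mono_set ?_ ?_ (Eventually.of_forall Ioc_subset_Ioi_self)
  · have := integrableOn_rpow_mul_exp_neg_mul_rpow (p := 1) (s := γ - 1) (by linarith) one_pos hν
    simpa using this
  · exact (ae_restrict_iff' measurableSet_Ioi).2 (Eventually.of_forall fun s hs =>
      mul_nonneg (Real.rpow_nonneg (le_of_lt hs) _) (Real.exp_pos _).le)

/-- The weight t^(β-1) e^(νt) is reproduced exactly and a factor ν^(-γ) is gained. This factor makes
Volterra operators contractions for large ν, without restriction on the length of the time interval.
-/
theorem norm_hconv_le_exp (L : E →L[ℝ] E' →L[ℝ] F) {f : ℝ → E} {g : ℝ → E'} {β γ ν t A D : ℝ}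
    (hβ : 0 < β) (hγ : 0 < γ) (hγ1 : γ ≤ 1) (hν : 0 < ν) (ht : 0 < t) (hA : 0 ≤ A) (hD : 0 ≤ D)
    (hf : ∀ s, 0 < s → ‖f s‖ ≤ A * (s ^ (β - 1) * Real.exp (ν * s)))
    (hg : ∀ s, 0 < s → ‖g s‖ ≤ D * s ^ (γ - 1)) :
    ‖hconv L f g t‖
      ≤ ‖L‖ * A * D * weightConst β γ * ν ^ (-γ) * (t ^ (β - 1) * Real.exp (ν * t)) := by
  have hi1 : IntervalIntegrable (fun s : ℝ => ν ^ (-γ) * (2 / t) * s ^ (β - 1)) volume 0 t :=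
    (intervalIntegral.intervalIntegrable_rpow' (by linarith)).const_mul _
  have hi2 := (intervalIntegrable_rpow_mul_exp hγ ν t).const_mul
    (((1 / 2) ^ (β - 1) + 1) * t ^ (β - 1))
  have h : ‖hconv L f g t‖ ≤ ∫ s in (0 : ℝ)..t, ‖L‖ * A * D * Real.exp (ν * t) *
      (ν ^ (-γ) * (2 / t) * s ^ (β - 1) + ((1 / 2) ^ (β - 1) + 1) * t ^ (β - 1) *
          ((t - s) ^ (γ - 1) * Real.exp (-ν * (t - s)))) := by
    refine intervalIntegral.norm_integral_le_of_norm_le ht.le ?_ ((hi1.add hi2).const_mul _)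
    filter_upwards [(measure_eq_zero_iff_ae_notMem.1 (measure_singleton t) :
      ∀ᵐ s, s ∉ ({t} : Set ℝ))] with s hs hs'
    have hst : s < t := lt_of_le_of_ne hs'.2 hs
    have h0 := hs'.1
    calc _ ≤ ‖L‖ * ‖f s‖ * ‖g (t - s)‖ := L.le_opNorm₂ _ _
      _ ≤ ‖L‖ * (A * (s ^ (β - 1) * Real.exp (ν * s))) * (D * (t - s) ^ (γ - 1)) := by
        have a := hf s h0
        have b := hg (t - s) (by linarith)
        have := (norm_nonneg _).trans a
        gcongr
      _ = ‖L‖ * A * D * Real.exp (ν * t) *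
          (s ^ (β - 1) * (t - s) ^ (γ - 1) * Real.exp (-ν * (t - s))) := by
        have : Real.exp (ν * s) = Real.exp (ν * t) * Real.exp (-ν * (t - s)) := by
          rw [← Real.exp_add]; ring_nf
        rw [this]; ring
      _ ≤ _ := mul_le_mul_of_nonneg_left (weight_integrand_le hγ hγ1 hν h0 hst) (by positivity)
  refine h.trans ?_
  rw [intervalIntegral.integral_const_mul, intervalIntegral.integral_add hi1 hi2,
    intervalIntegral.integral_const_mul, intervalIntegral.integral_const_mul,
    integral_rpow (Or.inl (by linarith)), sub_add_cancel, Real.zero_rpow hβ.ne', sub_zero]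
  have a := integral_rpow_mul_exp_le hγ hν ht
  calc _ ≤ ‖L‖ * A * D * Real.exp (ν * t) * (ν ^ (-γ) * (2 / t) * (t ^ β / β)
        + ((1 / 2) ^ (β - 1) + 1) * t ^ (β - 1) * (ν ^ (-γ) * Real.Gamma γ)) := by gcongr
    _ = _ := by
      rw [weightConst, Real.rpow_sub ht, Real.rpow_one]
      field_simp

theorem Sing.of_le_exp {β ν A : ℝ} (hν : 0 ≤ ν) {f : ℝ → E}
    (hm : AEStronglyMeasurable f (volume.restrict (Ioi 0)))
    (hf : ∀ s, 0 < s → ‖f s‖ ≤ A * (s ^ (β - 1) * Real.exp (ν * s))) : Sing β f := by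
  refine ⟨hm, fun T hT => ⟨|A| * Real.exp (ν * T), by positivity, fun t h0 h1 =>
    (hf t h0).trans ?_⟩⟩
  have := Real.rpow_pos_of_pos h0 (β - 1)
  calc A * (t ^ (β - 1) * Real.exp (ν * t)) ≤ |A| * (t ^ (β - 1) * Real.exp (ν * T)) := by
        gcongr
        exact le_abs_self A
    _ = _ := by ring

theorem norm_lsmul_flip_le :
    ‖(ContinuousLinearMap.lsmul ℝ ℝ : ℝ →L[ℝ] E →L[ℝ] E).flip‖ ≤ 1 := by
  rw [ContinuousLinearMap.opNorm_flip]
  exact ContinuousLinearMap.opNorm_lsmul_le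

/-- Evaluation `x ↦ (T ↦ T x)` as a bounded bilinear map. -/
noncomputable def evalL (E F : Type*) [NormedAddCommGroup E] [NormedSpace ℝ E]
    [NormedAddCommGroup F] [NormedSpace ℝ F] : E →L[ℝ] (E →L[ℝ] F) →L[ℝ] F :=
  (ContinuousLinearMap.id ℝ (E →L[ℝ] F)).flip

@[simp]
theorem evalL_apply (x : E) (T : E →L[ℝ] F) : evalL E F x T = T x := rfl

set_option maxSynthPendingDepth 3 in
theorem norm_evalL_le : ‖evalL E F‖ ≤ 1 := by
  rw [evalL, ContinuousLinearMap.opNorm_flip]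
  exact ContinuousLinearMap.norm_id_le

section Volterra

variable (P Q : ℝ → E →L[ℝ] F) (δ : ℝ)

/-- The lower-order term `P v + Q (I^δ v)`. -/
noncomputable def lowerOrder (v : ℝ → E) (s : ℝ) : F := P s (v s) + Q s (fracInt δ v s)

variable {P Q δ} {p : ℝ} (hPm : AEStronglyMeasurable P (volume.restrict (Ioi 0)))
  (hQm : AEStronglyMeasurable Q (volume.restrict (Ioi 0)))
  (hP : ∀ t, ‖P t‖ ≤ p) (hQ : ∀ t, ‖Q t‖ ≤ p) (hδ : 0 < δ) {β : ℝ} (hβ : 0 < β)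

include hPm hQm hP hQ hδ hβ in
theorem Sing.lowerOrder {v : ℝ → E} (hv : Sing β v) : Sing β (lowerOrder P Q δ v) :=
  (hv.clm_apply hPm hP).add (((hv.fracInt hδ hβ).mono (by linarith)).clm_apply hQm hQ)

include hδ hβ in
theorem lowerOrder_add {v w : ℝ → E} (hv : Sing β v) (hw : Sing β w) {t : ℝ} (ht : 0 ≤ t) :
    FracPDE.lowerOrder P Q δ (fun s => v s + w s) t
      = FracPDE.lowerOrder P Q δ v t + FracPDE.lowerOrder P Q δ w t := by
  simp only [FracPDE.lowerOrder, fracInt_add hδ hβ hv hw ht, map_add]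
  abel

include hP hQ hδ hβ in
theorem norm_lowerOrder_le (hδ1 : δ ≤ 1) {v : ℝ → E} {ν A : ℝ} (hν : 1 ≤ ν) (hA : 0 ≤ A)
    (hv : ∀ s, 0 < s → ‖v s‖ ≤ A * (s ^ (β - 1) * Real.exp (ν * s))) {t : ℝ} (ht : 0 < t) :
    ‖FracPDE.lowerOrder P Q δ v t‖ ≤ p * (1 + (Real.Gamma δ)⁻¹ * weightConst β δ) * A
      * (t ^ (β - 1) * Real.exp (ν * t)) := by
  have hp : 0 ≤ p := (norm_nonneg _).trans (hP 0)
  have hG := Real.Gamma_pos_of_pos hδ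
  have hW := weightConst_pos hβ hδ
  have hν0 : 0 < ν := by linarith
  have ht' := Real.rpow_pos_of_pos ht (β - 1)
  have h1 : ‖fracInt δ v t‖ ≤ (Real.Gamma δ)⁻¹ * weightConst β δ * A
      * (t ^ (β - 1) * Real.exp (ν * t)) := by
    rw [fracInt_eq_hconv]
    refine (norm_hconv_le_exp _ hβ hδ hδ1 hν0 ht hA (by positivity : 0 ≤ (Real.Gamma δ)⁻¹) hv
      fun s hs => (norm_omega hδ hs).le).trans ?_
    -- The gain is discarded here: the lower-order map need only be bounded uniformly in ν, as
    -- smallness comes from the outer convolution with K.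
    have h2 : ν ^ (-δ) ≤ 1 := Real.rpow_le_one_of_one_le_of_nonpos hν (by linarith)
    calc _ ≤ 1 * A * (Real.Gamma δ)⁻¹ * weightConst β δ * 1 * (t ^ (β - 1) * Real.exp (ν * t)) := by
          gcongr
          exact norm_lsmul_flip_le
      _ = _ := by ring
  calc _ ≤ p * ‖v t‖ + p * ‖fracInt δ v t‖ :=
        norm_add_le_of_le ((P t).le_of_opNorm_le (hP t) _) ((Q t).le_of_opNorm_le (hQ t) _)
    _ ≤ p * (A * (t ^ (β - 1) * Real.exp (ν * t))) + p * ((Real.Gamma δ)⁻¹ * weightConst β δ * A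
      * (t ^ (β - 1) * Real.exp (ν * t))) := by
        have := hv t ht
        gcongr
    _ = _ := by ring

end Volterra

end FracPDE

/-! ### Weakly singular Volterra equations -/

namespace FracPDE

open scoped BoundedContinuousFunction NNReal

set_option linter.unusedSectionVars false

variable {E F : Type*} [NormedAddCommGroup E] [NormedSpace ℝ E]
  [NormedAddCommGroup F] [NormedSpace ℝ F]

/-- The weight `t^(β-1) e^(νt)`. -/
noncomputable def expWeight (β ν t : ℝ) : ℝ := t ^ (β - 1) * Real.exp (ν * t)

theorem expWeight_pos {β ν t : ℝ} (ht : 0 < t) : 0 < expWeight β ν t :=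
  mul_pos (Real.rpow_pos_of_pos ht _) (Real.exp_pos _)

theorem continuousOn_expWeight (β ν : ℝ) : ContinuousOn (expWeight β ν) (Ioi 0) := fun t ht =>
  ((Real.continuousAt_rpow_const t _ (Or.inl (ne_of_gt ht))).mul
    (by fun_prop)).continuousWithinAt

/-- The function on the real line with `unweight z t = t^(β-1) e^(νt) z t` for `t > 0`. -/
noncomputable def unweight (β ν : ℝ) (z : Ioi (0 : ℝ) →ᵇ E) (t : ℝ) : E :=
  if h : 0 < t then expWeight β ν t • z ⟨t, h⟩ else 0

theorem unweight_of_pos {β ν t : ℝ} (z : Ioi (0 : ℝ) →ᵇ E) (ht : 0 < t) :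
    unweight β ν z t = expWeight β ν t • z ⟨t, ht⟩ := dif_pos ht

theorem continuousOn_unweight (β ν : ℝ) (z : Ioi (0 : ℝ) →ᵇ E) :
    ContinuousOn (unweight β ν z) (Ioi 0) := by
  rw [continuousOn_iff_continuous_domRestrict]
  have : (Ioi (0 : ℝ)).domRestrict (unweight β ν z)
      = fun t : Ioi (0 : ℝ) => expWeight β ν t • z t := by
    ext t
    exact unweight_of_pos z t.2
  rw [this]
  exact ((continuousOn_iff_continuous_domRestrict.1 (continuousOn_expWeight β ν)).smul z.continuous)

theorem norm_unweight_le {β ν t : ℝ} (z : Ioi (0 : ℝ) →ᵇ E) (ht : 0 < t) :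
    ‖unweight β ν z t‖ ≤ ‖z‖ * (t ^ (β - 1) * Real.exp (ν * t)) := by
  rw [unweight_of_pos z ht, norm_smul, Real.norm_of_nonneg (expWeight_pos ht).le, mul_comm]
  exact mul_le_mul_of_nonneg_right (z.norm_coe_le_norm _) (expWeight_pos ht).le

theorem sing_unweight {β ν : ℝ} (hν : 0 ≤ ν) (z : Ioi (0 : ℝ) →ᵇ E) :
    Sing β (unweight β ν z) :=
  Sing.of_le_exp hν ((continuousOn_unweight β ν z).aestronglyMeasurable measurableSet_Ioi)
    fun _ hs => norm_unweight_le z hs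

/-- Division by the weight, as a bounded continuous function. -/
noncomputable def weigh (β ν : ℝ) (f : ℝ → E) (hf : ContinuousOn f (Ioi 0)) (A : ℝ)
    (hA : ∀ t, 0 < t → ‖f t‖ ≤ A * (t ^ (β - 1) * Real.exp (ν * t))) : Ioi (0 : ℝ) →ᵇ E :=
  BoundedContinuousFunction.ofNormedAddCommGroup
    (fun t => (expWeight β ν t)⁻¹ • f t)
    (((continuousOn_iff_continuous_domRestrict.1 (continuousOn_expWeight β ν)).inv₀
      fun t => (expWeight_pos t.2).ne').smul (continuousOn_iff_continuous_domRestrict.1 hf)) A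
    fun t => by
      rw [norm_smul, norm_inv, Real.norm_of_nonneg (expWeight_pos t.2).le,
        inv_mul_le_iff₀ (expWeight_pos t.2), mul_comm]
      exact hA t t.2

/-- Linear Volterra equations of the second kind with weakly singular kernels. -/
theorem exists_volterra_solution [CompleteSpace E] {γ δ β D p : ℝ} (hγ : 0 < γ) (hγ1 : γ ≤ 1)
    (hδ : 0 < δ) (hδ1 : δ ≤ 1) (hβ : 0 < β) {K : ℝ → F →L[ℝ] E}
    (hKc : ContinuousOn K (Ioi 0)) (hK : ∀ t, 0 < t → ‖K t‖ ≤ D * t ^ (γ - 1))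
    {P Q : ℝ → E →L[ℝ] F} (hPm : AEStronglyMeasurable P (volume.restrict (Ioi 0)))
    (hQm : AEStronglyMeasurable Q (volume.restrict (Ioi 0)))
    (hP : ∀ t, ‖P t‖ ≤ p) (hQ : ∀ t, ‖Q t‖ ≤ p) :
    ∃ ν, 0 ≤ ν ∧ ∀ (N : ℝ) (f : ℝ → E), ContinuousOn f (Ioi 0) →
      (∀ t, 0 < t → ‖f t‖ ≤ N * t ^ (β - 1)) → ∃ v : ℝ → E, ContinuousOn v (Ioi 0) ∧
        (∀ t, 0 < t → ‖v t‖ ≤ 2 * N * (t ^ (β - 1) * Real.exp (ν * t))) ∧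
        ∀ t, 0 < t → v t = f t + hconv (evalL F E) (lowerOrder P Q δ v) K t := by
  have hp : 0 ≤ p := (norm_nonneg _).trans (hP 0)
  have hD : 0 ≤ D := by simpa using (norm_nonneg _).trans (hK 1 one_pos)
  have hGi : 0 < (Real.Gamma δ)⁻¹ := inv_pos.2 (Real.Gamma_pos_of_pos hδ)
  have hWδ := weightConst_pos hβ hδ
  have hWγ := weightConst_pos hβ hγ
  set p' := p * (1 + (Real.Gamma δ)⁻¹ * weightConst β δ) with hp'
  have hp'0 : 0 ≤ p' := by positivity
  -- The left side of the second inequality bounds the Lipschitz constant of the Picard map; ν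
  -- depends on the coefficients and the kernel only, never on the data f.
  obtain ⟨ν, hν1, hν2⟩ : ∃ ν : ℝ, 1 ≤ ν ∧ p' * D * weightConst β γ * ν ^ (-γ) < 1 / 2 := by
    have h := (tendsto_rpow_neg_atTop hγ).const_mul (p' * D * weightConst β γ)
    rw [mul_zero] at h
    exact ((eventually_ge_atTop 1).and (h.eventually (gt_mem_nhds one_half_pos))).exists
  have hν0 : 0 < ν := by linarith
  refine ⟨ν, hν0.le, fun N f hfc hf => ?_⟩
  have hN : 0 ≤ N := by simpa using (norm_nonneg _).trans (hf 1 one_pos)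
  have hKs : Sing γ K := Sing.of_le (hKc.aestronglyMeasurable measurableSet_Ioi) hK
  have step : ∀ (z : Ioi (0 : ℝ) →ᵇ E) {t : ℝ}, 0 < t →
      ‖hconv (evalL F E) (lowerOrder P Q δ (unweight β ν z)) K t‖
        ≤ 1 / 2 * ‖z‖ * (t ^ (β - 1) * Real.exp (ν * t)) := by
    intro z t ht
    have hpos := mul_pos (Real.rpow_pos_of_pos ht (β - 1)) (Real.exp_pos (ν * t))
    have h := norm_hconv_le_exp (evalL F E) (ν := ν) hβ hγ hγ1 hν0 ht
      (by positivity : 0 ≤ p' * ‖z‖) hD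
      (fun s hs => norm_lowerOrder_le hP hQ hδ hβ hδ1 hν1 (norm_nonneg z)
        (fun s hs => norm_unweight_le z hs) hs) hK
    refine h.trans (mul_le_mul_of_nonneg_right ?_ hpos.le)
    have hνγ := Real.rpow_pos_of_pos hν0 (-γ)
    have hev := norm_evalL_le (E := F) (F := E)
    calc _ ≤ 1 * (p' * ‖z‖) * D * weightConst β γ * ν ^ (-γ) := by gcongr
      _ = p' * D * weightConst β γ * ν ^ (-γ) * ‖z‖ := by ring
      _ ≤ _ := by gcongr
  have singL : ∀ z : Ioi (0 : ℝ) →ᵇ E, Sing β (lowerOrder P Q δ (unweight β ν z)) := fun z =>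
    Sing.lowerOrder hPm hQm hP hQ hδ hβ (sing_unweight hν0.le z)
  have contK : ∀ z : Ioi (0 : ℝ) →ᵇ E,
      ContinuousOn (hconv (evalL F E) (lowerOrder P Q δ (unweight β ν z)) K) (Ioi 0) := fun z =>
    continuousOn_hconv _ (singL z) hKs hβ hγ hKc
  have bnd : ∀ (z : Ioi (0 : ℝ) →ᵇ E) (t : ℝ), 0 < t →
      ‖f t + hconv (evalL F E) (lowerOrder P Q δ (unweight β ν z)) K t‖
        ≤ (N + 1 / 2 * ‖z‖) * (t ^ (β - 1) * Real.exp (ν * t)) := by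
    intro z t ht
    rw [add_mul]
    refine norm_add_le_of_le ((hf t ht).trans ?_) (step z ht)
    have h1 : (1 : ℝ) ≤ Real.exp (ν * t) := Real.one_le_exp (by positivity)
    have h2 := Real.rpow_pos_of_pos ht (β - 1)
    exact mul_le_mul_of_nonneg_left (le_mul_of_one_le_right h2.le h1) hN
  -- The Picard map, conjugated by the weight so that it acts on bounded continuous functions on (0,
  -- ∞).
  let S : (Ioi (0 : ℝ) →ᵇ E) → (Ioi (0 : ℝ) →ᵇ E) := fun z =>
    weigh β ν (fun t => f t + hconv (evalL F E) (lowerOrder P Q δ (unweight β ν z)) K t)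
      (hfc.add (contK z)) _ (bnd z)
  have hS : ∀ z (t : Ioi (0 : ℝ)), S z t = (expWeight β ν t)⁻¹ •
      (f t + hconv (evalL F E) (lowerOrder P Q δ (unweight β ν z)) K t) := fun _ _ => rfl
  have hlip : ∀ z w, ‖S z - S w‖ ≤ 1 / 2 * ‖z - w‖ := by
    intro z w
    refine (BoundedContinuousFunction.norm_le (by positivity)).2 fun t => ?_
    have ht : (0 : ℝ) < t := t.2
    have hu : ∀ s, 0 < s → unweight β ν z s = unweight β ν (z - w) s + unweight β ν w s := by
      intro s hs
      simp only [unweight_of_pos _ hs, ← smul_add]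
      simp
    have hl : ∀ s, 0 < s → lowerOrder P Q δ (unweight β ν z) s
        = lowerOrder P Q δ (unweight β ν (z - w)) s + lowerOrder P Q δ (unweight β ν w) s := by
      intro s hs
      rw [← lowerOrder_add hδ hβ (sing_unweight hν0.le _) (sing_unweight hν0.le _) hs.le]
      simp only [lowerOrder]
      rw [hu s hs, fracInt_congr hs.le fun r hr _ => hu r hr]
    have hh : hconv (evalL F E) (lowerOrder P Q δ (unweight β ν z)) K t
        = hconv (evalL F E) (lowerOrder P Q δ (unweight β ν (z - w))) K t
          + hconv (evalL F E) (lowerOrder P Q δ (unweight β ν w)) K t := by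
      simp only [hconv]
      rw [← intervalIntegral.integral_add
        (intervalIntegrable_hconv _ (singL _) hKs hβ hγ ht.le)
        (intervalIntegrable_hconv _ (singL _) hKs hβ hγ ht.le)]
      refine intervalIntegral.integral_congr_ae (Eventually.of_forall fun s hs => ?_)
      rw [uIoc_of_le ht.le] at hs
      rw [hl s hs.1, map_add, add_apply]
    rw [BoundedContinuousFunction.coe_sub, Pi.sub_apply, hS, hS, ← smul_sub, hh,
      add_sub_add_left_eq_sub, add_sub_cancel_right, norm_smul, norm_inv,
      Real.norm_of_nonneg (expWeight_pos ht).le, inv_mul_le_iff₀ (expWeight_pos ht), mul_comm]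
    exact step (z - w) ht
  have hc : ContractingWith (1 / 2) S := by
    refine ⟨by norm_num, LipschitzWith.of_dist_le_mul fun z w => ?_⟩
    rw [dist_eq_norm, dist_eq_norm]
    simpa using hlip z w
  let z := ContractingWith.fixedPoint S hc
  have hz : S z = z := hc.fixedPoint_isFixedPt
  have hv : ∀ t, 0 < t → unweight β ν z t
      = f t + hconv (evalL F E) (lowerOrder P Q δ (unweight β ν z)) K t := by
    intro t ht
    conv_lhs => rw [unweight_of_pos z ht, ← hz, hS]
    rw [smul_inv_smul₀ (expWeight_pos ht).ne']
  have hzn : ‖z‖ ≤ 2 * N := by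
    have : ‖z‖ ≤ N + 1 / 2 * ‖z‖ := by
      conv_lhs => rw [← hz]
      refine (BoundedContinuousFunction.norm_le (by positivity)).2 fun t => ?_
      have ht : (0 : ℝ) < t := t.2
      rw [hS, norm_smul, norm_inv, Real.norm_of_nonneg (expWeight_pos ht).le,
        inv_mul_le_iff₀ (expWeight_pos ht), mul_comm]
      exact bnd z t ht
    linarith
  refine ⟨unweight β ν z, continuousOn_unweight β ν z, fun t ht => ?_, hv⟩
  exact (norm_unweight_le z ht).trans (mul_le_mul_of_nonneg_right hzn (expWeight_pos ht).le)

end FracPDE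

/-! ### The scalar resolvent and its positivity -/

namespace FracPDE

/-- `r` is the resolvent of `ω_α`, that is, `r(t) = t^(α-1) E_{α,α}(-t^α)`. -/
structure IsResolvent (α : ℝ) (r : ℝ → ℝ) : Prop where
  cont : ContinuousOn r (Ioi 0)
  sing : Sing α r
  eq : ∀ t, 0 < t → r t + fracInt α r t = omega α t

theorem exists_isResolvent {α : ℝ} (hα : 0 < α) (hα1 : α ≤ 1) : ∃ r, IsResolvent α r := by
  have hG := Real.Gamma_pos_of_pos hα
  let K : ℝ → ℝ →L[ℝ] ℝ := fun t => omega α t • ContinuousLinearMap.id ℝ ℝ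
  have hKc : ContinuousOn K (Ioi 0) := (continuousOn_omega α).smul continuousOn_const
  have hK : ∀ t, 0 < t → ‖K t‖ ≤ (Real.Gamma α)⁻¹ * t ^ (α - 1) := by
    intro t ht
    rw [← norm_omega hα ht, norm_smul]
    exact mul_le_of_le_one_right (norm_nonneg _) ContinuousLinearMap.norm_id_le
  obtain ⟨ν, hν, h⟩ := exists_volterra_solution (E := ℝ) (F := ℝ) (β := α) (p := 1) hα hα1 one_pos
    le_rfl hα hKc hK (P := fun _ => -ContinuousLinearMap.id ℝ ℝ) (Q := fun _ => 0)
    aestronglyMeasurable_const aestronglyMeasurable_const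
    (fun _ => by rw [norm_neg]; exact ContinuousLinearMap.norm_id_le) (fun _ => by simp)
  obtain ⟨r, hrc, hrb, hr⟩ := h (Real.Gamma α)⁻¹ (omega α) (continuousOn_omega α)
    fun t ht => (norm_omega hα ht).le
  refine ⟨r, hrc, Sing.of_le_exp hν (hrc.aestronglyMeasurable measurableSet_Ioi) hrb,
    fun t ht => ?_⟩
  have e : hconv (evalL ℝ ℝ) (lowerOrder (fun _ => -ContinuousLinearMap.id ℝ ℝ) (fun _ => 0) 1 r) K t
      = - fracInt α r t := by
    simp only [hconv, fracInt, lowerOrder, K, ← intervalIntegral.integral_neg]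
    refine intervalIntegral.integral_congr fun s _ => ?_
    simp
  have := hr t ht
  rw [e] at this
  linarith

namespace IsResolvent

variable {α : ℝ} {r : ℝ → ℝ} (hr : IsResolvent α r) (hα : 0 < α)

include hr hα in
-- Since r = ω_α - I^α r with I^α r = O(t^(2α-1)), the term ω_α, of order t^(α-1), dominates near 0.
theorem exists_pos_near_zero : ∃ δ > 0, ∀ t, 0 < t → t ≤ δ → 0 < r t := by
  have hG := Real.Gamma_pos_of_pos hα
  obtain ⟨C, hC, hC'⟩ := (hr.sing.fracInt hα hα).bdd 1 one_pos
  have h0 : Tendsto (fun t : ℝ => C * t ^ α) (𝓝 0) (𝓝 (C * 0)) := by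
    have := (Real.continuousAt_rpow_const 0 α (Or.inr hα.le)).tendsto
    rw [Real.zero_rpow hα.ne'] at this
    exact this.const_mul C
  rw [mul_zero] at h0
  obtain ⟨δ, hδ, h⟩ := Metric.eventually_nhds_iff.1 (h0.eventually (gt_mem_nhds (inv_pos.2 hG)))
  refine ⟨min (δ / 2) 1, by positivity, fun t ht ht' => ?_⟩
  have h1 : C * t ^ α < (Real.Gamma α)⁻¹ := h (by
    rw [Real.dist_0_eq_abs, abs_of_pos ht]
    linarith [min_le_left (δ / 2) 1])
  have h2 := (abs_le.1 (hC' t ht (ht'.trans (min_le_right _ _)))).2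
  have h3 := hr.eq t ht
  have h4 := Real.rpow_pos_of_pos ht (α - 1)
  have h5 : t ^ (α + α - 1) = t ^ α * t ^ (α - 1) := by rw [← Real.rpow_add ht]; ring_nf
  rw [h5, ← mul_assoc] at h2
  have h6 : C * t ^ α * t ^ (α - 1) < (Real.Gamma α)⁻¹ * t ^ (α - 1) :=
    mul_lt_mul_of_pos_right h1 h4
  rw [omega, div_eq_inv_mul] at h3
  linarith

/-- Amounts to t₀(t - s) ≤ t(t₀ - s), raised to the nonpositive power α - 1. It compares the memory
of the past at time t₀ with that at time t. -/
theorem omega_sub_le {α t t₀ s : ℝ} (hα : 0 < α) (hα1 : α ≤ 1) (hs : 0 < s) (hst : s < t)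
    (ht : t ≤ t₀) : omega α (t₀ - s) ≤ omega α t₀ / omega α t * omega α (t - s) := by
  have hG := Real.Gamma_pos_of_pos hα
  have h0 : 0 < t := hs.trans hst
  have h1 : 0 < t₀ := h0.trans_le ht
  have h2 : 0 < t - s := sub_pos.2 hst
  have h3 : 0 < t₀ - s := by linarith
  rw [div_mul_eq_mul_div, le_div_iff₀ (omega_pos hα h0)]
  simp only [omega, div_mul_div_comm]
  refine div_le_div_of_nonneg_right ?_ (by positivity)
  rw [← Real.mul_rpow h3.le h0.le, ← Real.mul_rpow h1.le h2.le]
  refine Real.rpow_le_rpow_of_nonpos (by positivity) ?_ (by linarith)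
  nlinarith

theorem integral_omega_sub {α t t₀ : ℝ} (hα : 0 < α) (ht : t < t₀) :
    ∫ s in t..t₀, omega α (t₀ - s) = omega (α + 1) (t₀ - t) := by
  rw [intervalIntegral.integral_comp_sub_left (omega α), sub_self, ← fracInt_one,
    fracInt_omega one_pos hα (by linarith)]

include hr hα in
-- At a first zero t₀, choose t slightly earlier and put c = ω_α(t₀)/ω_α(t). The memory of (0, t) in
-- I^α r(t₀) is at most c I^α r(t) = ω_α(t₀) - c r(t), and that of (t, t₀) is less than r(t)/2. As c
-- ≥ 1/2, I^α r(t₀) < ω_α(t₀), that is r(t₀) > 0, a contradiction.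
theorem pos (hα1 : α < 1) : ∀ t, 0 < t → 0 < r t := by
  obtain ⟨δ, hδ, hpos⟩ := hr.exists_pos_near_zero hα
  by_contra! hcon
  obtain ⟨τ, hτ, hτr⟩ := hcon
  set S := Ici δ ∩ r ⁻¹' Iic 0
  have hScl : IsClosed S :=
    (hr.cont.mono fun x hx => hδ.trans_le hx).preimage_isClosed_of_isClosed isClosed_Ici isClosed_Iic
  have hτS : τ ∈ S := ⟨by
    by_contra hlt
    exact absurd (hpos τ hτ (le_of_lt (not_le.1 hlt))) (not_lt.2 hτr), hτr⟩
  have hSb : BddBelow S := ⟨δ, fun x hx => hx.1⟩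
  set t₀ := sInf S
  have ht₀S : t₀ ∈ S := hScl.csInf_mem ⟨τ, hτS⟩ hSb
  have ht₀ : 0 < t₀ := hδ.trans_le ht₀S.1
  have hbefore : ∀ t, 0 < t → t < t₀ → 0 < r t := by
    intro t h0 h1
    by_contra hle
    rcases le_total t δ with h | h
    · exact hle (hpos t h0 h)
    · exact absurd (csInf_le hSb (⟨h, not_lt.1 hle⟩ : t ∈ S)) (not_le.2 h1)
  have hG1 := Real.Gamma_pos_of_pos (by linarith : 0 < α + 1)
  obtain ⟨h, hh0, hht, hhs⟩ : ∃ h : ℝ, 0 < h ∧ h ≤ t₀ / 2 ∧ ∀ x, 0 < x → x ≤ h →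
      omega (α + 1) x < 1 / 2 := by
    have h0 : Tendsto (fun t : ℝ => t ^ α) (𝓝 0) (𝓝 0) := by
      have := (Real.continuousAt_rpow_const 0 α (Or.inr hα.le)).tendsto
      rwa [Real.zero_rpow hα.ne'] at this
    obtain ⟨ε, hε, h'⟩ := Metric.eventually_nhds_iff.1 (h0.eventually
      (gt_mem_nhds (by positivity : 0 < 1 / 2 * Real.Gamma (α + 1))))
    refine ⟨min (ε / 2) (t₀ / 2), by positivity, min_le_right _ _, fun x hx hx' => ?_⟩
    rw [omega, div_lt_iff₀ hG1, add_sub_cancel_right]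
    refine h' ?_
    rw [Real.dist_0_eq_abs, abs_of_pos hx]
    linarith [min_le_left (ε / 2) (t₀ / 2)]
  -- Taking t as a maximum point of r near t₀ bounds the recent memory on (t, t₀) by r(t) times the
  -- integral of the kernel.
  obtain ⟨t, htI, htmax⟩ := isCompact_Icc.exists_isMaxOn (nonempty_Icc.2 (by linarith : t₀ - h ≤ t₀))
    (hr.cont.mono fun x hx => by
      have := hx.1
      exact mem_Ioi.2 (by linarith))
  have hth : t₀ - h ≤ t := htI.1
  have ht : 0 < t := by linarith
  have hrt : 0 < r t := (hbefore (t₀ - h) (by linarith) (by linarith)).trans_le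
    (htmax (left_mem_Icc.2 (by linarith)))
  have htt : t < t₀ := lt_of_le_of_ne htI.2 fun e => absurd ht₀S.2 (by
    rw [← e]
    simpa using hrt)
  set c := omega α t₀ / omega α t with hc
  -- c = (t₀/t)^(α-1) ≥ t/t₀, and t ≥ t₀/2 because h ≤ t₀/2.
  have hc2 : 1 / 2 ≤ c := by
    have hG := Real.Gamma_pos_of_pos hα
    rw [hc, omega, omega, div_div_div_cancel_right₀ hG.ne', ← Real.div_rpow ht₀.le ht.le]
    calc (1 / 2 : ℝ) ≤ t / t₀ := by rw [div_le_div_iff₀ two_pos ht₀]; linarith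
      _ = (t₀ / t) ^ (-1 : ℝ) := by rw [Real.rpow_neg_one, inv_div]
      _ ≤ _ := Real.rpow_le_rpow_of_exponent_le (by rw [le_div_iff₀ ht]; linarith) (by linarith)
  have hi0 := intervalIntegrable_fracInt hα hα hr.sing ht₀.le
  have hi1 : IntervalIntegrable (fun s => omega α (t₀ - s) • r s) volume 0 t :=
    hi0.mono_set (by rw [uIcc_of_le ht.le, uIcc_of_le ht₀.le]; exact Icc_subset_Icc_right htt.le)
  have hi2 : IntervalIntegrable (fun s => omega α (t₀ - s) • r s) volume t t₀ :=
    hi0.mono_set (by rw [uIcc_of_le htt.le, uIcc_of_le ht₀.le]; exact Icc_subset_Icc_left ht.le)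
  have hi3 := intervalIntegrable_fracInt hα hα hr.sing ht.le
  have e0 := hr.eq t₀ ht₀
  have e1 := hr.eq t ht
  have b1 : ∫ s in (0 : ℝ)..t, omega α (t₀ - s) • r s ≤ c * fracInt α r t := by
    rw [fracInt, ← intervalIntegral.integral_const_mul]
    refine intervalIntegral.integral_mono_on_of_le_Ioo ht.le hi1 (hi3.const_mul c) fun s hs => ?_
    rw [smul_eq_mul, smul_eq_mul, ← mul_assoc]
    exact mul_le_mul_of_nonneg_right (omega_sub_le hα hα1.le hs.1 hs.2 htt.le)
      (hbefore s hs.1 (hs.2.trans htt)).le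
  have b2 : ∫ s in t..t₀, omega α (t₀ - s) • r s ≤ omega (α + 1) (t₀ - t) * r t := by
    rw [← integral_omega_sub hα htt, ← intervalIntegral.integral_mul_const]
    refine intervalIntegral.integral_mono_on_of_le_Ioo htt.le hi2 ?_ fun s hs => ?_
    · have := ((sing_omega hα).intervalIntegrable hα (sub_pos.2 htt).le).comp_sub_left t₀
      rw [sub_zero, sub_sub_cancel] at this
      exact this.symm.mul_const _
    · exact mul_le_mul_of_nonneg_left (htmax ⟨hth.trans hs.1.le, hs.2.le⟩)
        (omega_pos hα (sub_pos.2 hs.2)).le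
  have b3 := hhs (t₀ - t) (sub_pos.2 htt) (by linarith)
  have hsum : fracInt α r t₀ = (∫ s in (0 : ℝ)..t, omega α (t₀ - s) • r s)
      + ∫ s in t..t₀, omega α (t₀ - s) • r s :=
    (intervalIntegral.integral_add_adjacent_intervals hi1 hi2).symm
  have hct : c * omega α t = omega α t₀ := div_mul_cancel₀ _ (omega_pos hα ht).ne'
  have hr0 : r t₀ ≤ 0 := ht₀S.2
  have : c * r t + c * fracInt α r t = c * omega α t := by rw [← mul_add, e1]
  nlinarith

end IsResolvent

end FracPDE

/-! ### Bounds and asymptotics of r and of the relaxation function e = I^{1-α} r -/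

namespace FracPDE

theorem omega_add_one {α t : ℝ} (hα : 0 < α) (ht : 0 < t) :
    t * omega α t = α * omega (α + 1) t := by
  have hG := Real.Gamma_pos_of_pos hα
  rw [omega, omega, Real.Gamma_add_one hα.ne', add_sub_cancel_right, Real.rpow_sub ht,
    Real.rpow_one]
  field_simp

theorem fracInt_nonneg {a t : ℝ} {φ : ℝ → ℝ} (ha : 0 < a) (ht : 0 ≤ t)
    (h : ∀ s, 0 < s → s ≤ t → 0 ≤ φ s) : 0 ≤ fracInt a φ t := by
  rw [fracInt, intervalIntegral.integral_of_le ht]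
  exact setIntegral_nonneg measurableSet_Ioc fun s hs =>
    mul_nonneg (omega_nonneg ha (by linarith [hs.2])) (h s hs.1 hs.2)

namespace IsResolvent

variable {α : ℝ} {r : ℝ → ℝ} (hr : IsResolvent α r) (hα : 0 < α) (hα1 : α < 1)

include hr hα hα1 in
-- The operator I^{1-α} applied to the resolvent equation, with I^{1-α}ω_α = 1. Hence 1 - e is a
-- primitive of r > 0, which yields 0 ≤ e ≤ 1 and monotonicity.
theorem relax_add_integral {t : ℝ} (ht : 0 < t) :
    fracInt (1 - α) r t + fracInt 1 r t = 1 := by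
  have h1 : 0 < 1 - α := by linarith
  have h := fracInt_congr (a := 1 - α) ht.le fun s h0 _ => hr.eq s h0
  rw [fracInt_add h1 hα hr.sing ((hr.sing.fracInt hα hα).mono (by linarith)) ht.le,
    fracInt_fracInt h1 hα hα hr.sing ht, fracInt_omega h1 hα ht, add_sub_cancel, omega_one] at h
  exact h

include hr hα hα1 in
theorem relax_add_fracInt {t : ℝ} (ht : 0 < t) :
    fracInt (1 - α) r t + fracInt α (fracInt (1 - α) r) t = 1 := by
  have h1 : 0 < 1 - α := by linarith
  rw [fracInt_fracInt hα h1 hα hr.sing ht, sub_add_cancel]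
  exact hr.relax_add_integral hα hα1 ht

include hr hα hα1 in
theorem relax_nonneg {t : ℝ} (ht : 0 < t) : 0 ≤ fracInt (1 - α) r t :=
  fracInt_nonneg (by linarith) ht.le fun s h0 _ => (hr.pos hα hα1 s h0).le

include hr hα hα1 in
theorem relax_antitone {s t : ℝ} (hs : 0 < s) (hst : s ≤ t) :
    fracInt (1 - α) r t ≤ fracInt (1 - α) r s := by
  have h1 := hr.relax_add_integral hα hα1 hs
  have h2 := hr.relax_add_integral hα hα1 (hs.trans_le hst)
  rw [fracInt_one] at h1 h2
  have hi := hr.sing.intervalIntegrable hα (hs.le.trans hst)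
  have h3 : ∫ x in (0 : ℝ)..s, r x ≤ ∫ x in (0 : ℝ)..t, r x := by
    refine intervalIntegral.integral_mono_interval le_rfl hs.le hst ?_ hi
    exact (ae_restrict_iff' measurableSet_Ioc).2
      (Eventually.of_forall fun x hx => (hr.pos hα hα1 x hx.1).le)
  linarith

include hr hα hα1 in
theorem relax_le_one {t : ℝ} (ht : 0 < t) : fracInt (1 - α) r t ≤ 1 := by
  have := hr.relax_add_integral hα hα1 ht
  have := fracInt_nonneg one_pos ht.le fun s h0 _ => (hr.pos hα hα1 s h0).le
  linarith

include hr hα in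
theorem sing_relax (hα1 : α < 1) : Sing 1 (fracInt (1 - α) r) := by
  have := hr.sing.fracInt (by linarith : 0 < 1 - α) hα
  rwa [add_sub_cancel] at this

include hr hα hα1 in
-- As e is decreasing, 1 ≥ I^α e(t) ≥ e(t) ω_{1+α}(t).
theorem relax_mul_rpow_le {t : ℝ} (ht : 0 < t) :
    fracInt (1 - α) r t * t ^ α ≤ Real.Gamma (1 + α) := by
  have hG := Real.Gamma_pos_of_pos (by linarith : 0 < 1 + α)
  have h1 := hr.relax_add_fracInt hα hα1 ht
  have h2 := hr.relax_nonneg hα hα1 ht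
  have h3 : fracInt (1 - α) r t * omega (1 + α) t ≤ fracInt α (fracInt (1 - α) r) t := by
    have e : omega (1 + α) t = ∫ s in (0 : ℝ)..t, omega α (t - s) := by
      rw [integral_omega_sub hα ht, sub_zero, add_comm]
    rw [e, ← intervalIntegral.integral_const_mul, fracInt]
    refine intervalIntegral.integral_mono_on_of_le_Ioo ht.le ?_
      (intervalIntegrable_fracInt hα one_pos (hr.sing_relax hα hα1) ht.le) fun s hs => ?_
    · have := ((sing_omega hα).intervalIntegrable hα ht.le).comp_sub_left t
      rw [sub_zero, sub_self] at this
      exact this.symm.const_mul _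
    · rw [smul_eq_mul, mul_comm]
      exact mul_le_mul_of_nonneg_left (hr.relax_antitone hα hα1 hs.1 hs.2.le)
        (omega_pos hα (sub_pos.2 hs.2)).le
  rw [omega, add_sub_cancel_left, ← mul_div_assoc] at h3
  have h4 : fracInt (1 - α) r t * t ^ α / Real.Gamma (1 + α) ≤ 1 := by linarith
  rwa [div_le_one hG] at h4

include hr hα hα1 in
theorem le_omega {t : ℝ} (ht : 0 < t) : r t ≤ omega α t := by
  have := hr.eq t ht
  have := fracInt_nonneg hα ht.le fun s h0 _ => (hr.pos hα hα1 s h0).le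
  linarith

include hr in
theorem sing_mul : Sing α fun t => t * r t := by
  refine Sing.mono (γ := α + 1) ⟨?_, fun T hT => ?_⟩ (by linarith)
  · exact (continuousOn_id.mul hr.cont).aestronglyMeasurable measurableSet_Ioi
  · obtain ⟨C, hC, h⟩ := hr.sing.bdd T hT
    refine ⟨C, hC, fun t h0 h1 => ?_⟩
    rw [norm_mul, Real.norm_of_nonneg h0.le, add_sub_cancel_right]
    calc t * ‖r t‖ ≤ t * (C * t ^ (α - 1)) := mul_le_mul_of_nonneg_left (h t h0 h1) h0.le
      _ = _ := by rw [Real.rpow_sub h0, Real.rpow_one]; field_simp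

include hr hα in
-- Multiply the resolvent equation by t = (t - s) + s under the integral and use t ω_α = α ω_{α+1};
-- the resulting terms α I^{α+1} r cancel. As all terms are nonnegative, t r(t) ≤ α follows.
theorem mul_self_add_fracInt {t : ℝ} (ht : 0 < t) :
    t * r t + fracInt α (fun s => s * r s) t = α * fracInt 1 r t := by
  have e1 : t * fracInt α r t
      = α * fracInt (α + 1) r t + fracInt α (fun s => s * r s) t := by
    rw [← smul_eq_mul α, ← fracInt_smul]
    simp only [fracInt]
    rw [← intervalIntegral.integral_const_mul, ← intervalIntegral.integral_add]
    · refine intervalIntegral.integral_congr_ae ?_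
      filter_upwards [(measure_eq_zero_iff_ae_notMem.1 (measure_singleton t) :
        ∀ᵐ s, s ∉ ({t} : Set ℝ))] with s hs hs'
      rw [uIoc_of_le ht.le] at hs'
      have hst : 0 < t - s := sub_pos.2 (lt_of_le_of_ne hs'.2 hs)
      have := omega_add_one hα hst
      simp only [smul_eq_mul]
      linear_combination (r s) * this
    · exact intervalIntegrable_fracInt (by linarith) hα
        (hr.sing.clm (α • ContinuousLinearMap.id ℝ ℝ)) ht.le
    · exact intervalIntegrable_fracInt hα hα (hr.sing_mul) ht.le
  have e2 : fracInt (α + 1) r t + fracInt 1 r t = omega (α + 1) t := by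
    rw [← fracInt_fracInt one_pos hα hα hr.sing ht, ← fracInt_omega one_pos hα ht,
      ← fracInt_add one_pos hα ((hr.sing.fracInt hα hα).mono (by linarith)) hr.sing ht.le]
    exact fracInt_congr ht.le fun s h0 _ => by rw [add_comm]; exact hr.eq s h0
  have e3 := omega_add_one hα ht
  rw [← hr.eq t ht] at e3
  linear_combination e3 - e1 - α * e2

include hr hα hα1 in
theorem mul_self_le {t : ℝ} (ht : 0 < t) : t * r t ≤ α := by
  have h1 := hr.mul_self_add_fracInt hα ht
  have h2 := hr.relax_add_integral hα hα1 ht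
  have h3 := hr.relax_nonneg hα hα1 ht
  have h4 : 0 ≤ fracInt α (fun s => s * r s) t :=
    fracInt_nonneg hα ht.le fun s h0 _ => mul_nonneg h0.le (hr.pos hα hα1 s h0).le
  nlinarith

include hr hα hα1 in
-- Geometric mean of r ≤ ω_α and r ≤ α/t. The exponent α/2 - 1 is the one that makes χ bounded
-- uniformly in y.
theorem le_rpow_half {t : ℝ} (ht : 0 < t) :
    r t ≤ √((Real.Gamma α)⁻¹ * α) * t ^ (α / 2 - 1) := by
  have h1 := hr.le_omega hα hα1 ht
  have h2 := hr.mul_self_le hα hα1 ht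
  have h0 := hr.pos hα hα1 t ht
  have hG := Real.Gamma_pos_of_pos hα
  rw [← Real.sqrt_sq h0.le, ← Real.sqrt_sq (Real.rpow_nonneg ht.le (α / 2 - 1)),
    ← Real.sqrt_mul (by positivity)]
  refine Real.sqrt_le_sqrt ?_
  have e : (t ^ (α / 2 - 1)) ^ 2 = t ^ (α - 1) * t⁻¹ := by
    rw [← Real.rpow_neg_one, ← Real.rpow_add ht, ← Real.rpow_natCast, ← Real.rpow_mul ht.le]
    congr 1
    push_cast
    ring
  rw [e, sq]
  have h3 : r t ≤ α * t⁻¹ := by rwa [← div_eq_mul_inv, le_div_iff₀ ht, mul_comm]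
  rw [omega, div_eq_inv_mul] at h1
  calc r t * r t ≤ ((Real.Gamma α)⁻¹ * t ^ (α - 1)) * (α * t⁻¹) :=
        mul_le_mul h1 h3 h0.le (h0.le.trans h1)
    _ = _ := by ring

include hr hα hα1 in
theorem relax_le_rpow {t : ℝ} (ht : 0 < t) :
    fracInt (1 - α) r t ≤ Real.Gamma (1 + α) * t ^ (-α) := by
  rw [Real.rpow_neg ht.le, ← div_eq_mul_inv, le_div_iff₀ (Real.rpow_pos_of_pos ht _)]
  exact hr.relax_mul_rpow_le hα hα1 ht

include hr hα hα1 in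
theorem relax_le_rpow_half {t : ℝ} (ht : 0 < t) :
    fracInt (1 - α) r t ≤ √(Real.Gamma (1 + α)) * t ^ (-(α / 2)) := by
  have h0 := hr.relax_nonneg hα hα1 ht
  have h1 := hr.relax_le_one hα hα1 ht
  have h2 := hr.relax_le_rpow hα hα1 ht
  have hG := Real.Gamma_pos_of_pos (by linarith : 0 < 1 + α)
  rw [← Real.sqrt_sq h0, ← Real.sqrt_sq (Real.rpow_nonneg ht.le (-(α / 2))),
    ← Real.sqrt_mul (by positivity)]
  refine Real.sqrt_le_sqrt ?_
  have e : (t ^ (-(α / 2))) ^ 2 = t ^ (-α) := by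
    rw [← Real.rpow_natCast, ← Real.rpow_mul ht.le]
    congr 1
    push_cast
    ring
  rw [e, sq]
  nlinarith

include hr hα hα1 in
-- ω_α is decreasing, so ω_α(t) ∫ s r(s) ds ≤ I^α(s r)(t) ≤ α.
theorem integral_mul_self_le {t : ℝ} (ht : 0 < t) :
    ∫ s in (0 : ℝ)..t, s * r s ≤ α * Real.Gamma α * t ^ (1 - α) := by
  have hG := Real.Gamma_pos_of_pos hα
  have h1 := hr.mul_self_add_fracInt hα ht
  have h2 := hr.relax_add_integral hα hα1 ht
  have h3 := hr.relax_nonneg hα hα1 ht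
  have h4 := mul_pos ht (hr.pos hα hα1 t ht)
  have h5 : omega α t * ∫ s in (0 : ℝ)..t, s * r s ≤ fracInt α (fun s => s * r s) t := by
    rw [← intervalIntegral.integral_const_mul, fracInt]
    refine intervalIntegral.integral_mono_on_of_le_Ioo ht.le
      (((hr.sing_mul).intervalIntegrable hα ht.le).const_mul _)
      (intervalIntegrable_fracInt hα hα (hr.sing_mul) ht.le) fun s hs => ?_
    refine mul_le_mul_of_nonneg_right (div_le_div_of_nonneg_right ?_ hG.le)
      (mul_nonneg hs.1.le (hr.pos hα hα1 s hs.1).le)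
    exact Real.rpow_le_rpow_of_nonpos (sub_pos.2 hs.2) (by linarith [hs.1]) (by linarith)
  have h6 : omega α t * ∫ s in (0 : ℝ)..t, s * r s ≤ α := by nlinarith
  have h7 := omega_pos hα ht
  rw [← le_div_iff₀' h7] at h6
  refine h6.trans (le_of_eq ?_)
  rw [omega, div_div_eq_mul_div, div_eq_mul_inv, ← Real.rpow_neg ht.le, neg_sub]

include hr hα hα1 in
-- Γ(1-α) t^α e(t) = ∫ (t/(t-s))^α r(s) ds, and the factor multiplying r(s) is at least 1.
theorem relax_mul_rpow_ge {t : ℝ} (ht : 0 < t) :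
    1 - fracInt (1 - α) r t ≤ Real.Gamma (1 - α) * (t ^ α * fracInt (1 - α) r t) := by
  have h1 : 0 < 1 - α := by linarith
  have hG := Real.Gamma_pos_of_pos h1
  have e : 1 - fracInt (1 - α) r t = fracInt 1 r t := by
    linarith [hr.relax_add_integral hα hα1 ht]
  rw [e, fracInt_one, ← mul_assoc]
  nth_rewrite 1 [fracInt]
  rw [← intervalIntegral.integral_const_mul]
  refine intervalIntegral.integral_mono_on_of_le_Ioo ht.le
    (hr.sing.intervalIntegrable hα ht.le)
    ((intervalIntegrable_fracInt h1 hα hr.sing ht.le).const_mul _) fun s hs => ?_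
  have hts := sub_pos.2 hs.2
  rw [smul_eq_mul, ← mul_assoc]
  refine le_mul_of_one_le_left (hr.pos hα hα1 s hs.1).le ?_
  have e2 : Real.Gamma (1 - α) * t ^ α * omega (1 - α) (t - s) = t ^ α * (t - s) ^ (-α) := by
    rw [omega, show 1 - α - 1 = -α by ring]
    field_simp
  rw [e2, Real.rpow_neg hts.le, ← div_eq_mul_inv, one_le_div (Real.rpow_pos_of_pos hts _)]
  exact Real.rpow_le_rpow hts.le (by linarith [hs.1]) hα.le

include hr hα hα1 in
-- In ∫ (t/(t-s))^α r(s) ds the factor exceeds 1 by at most t^(α-1)(t-s)^(-α) s. Splitting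
-- (t-s)^(-α) at distance h from t, the far part is controlled by ∫ s r and the near part by s r ≤
-- α; with h = √t both errors vanish as t → ∞.
theorem relax_mul_rpow_le_add {t : ℝ} (ht : 0 < t) :
    Real.Gamma (1 - α) * (t ^ α * fracInt (1 - α) r t)
      ≤ 1 + α * Real.Gamma α * t ^ (-(α / 2)) + α * (2 / (1 - α)) * t ^ (-((1 - α) / 4)) := by
  have h1 : 0 < 1 - α := by linarith
  have hG := Real.Gamma_pos_of_pos h1
  set q : ℝ := (1 - α) / 2 with hq
  have hq0 : 0 < q := by positivity
  set h : ℝ := t ^ (1 / 2 : ℝ) with hh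
  have hh0 : 0 < h := Real.rpow_pos_of_pos ht _
  have hta := Real.rpow_pos_of_pos ht α
  have hta1 := Real.rpow_pos_of_pos ht (α - 1)
  have i1 := hr.sing.intervalIntegrable hα ht.le
  have i2 := ((hr.sing_mul).intervalIntegrable hα ht.le).const_mul (t ^ (α - 1) * h ^ (-α))
  have i3 : IntervalIntegrable (fun s => t ^ (α - 1) * h ^ q * α * (t - s) ^ (q - 1)) volume 0 t := by
    have : IntervalIntegrable (fun s : ℝ => s ^ (q - 1)) volume 0 t :=
      intervalIntegral.intervalIntegrable_rpow' (by linarith)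
    have := (this.comp_sub_left t).symm
    rw [sub_zero, sub_self] at this
    exact this.const_mul _
  have key : Real.Gamma (1 - α) * (t ^ α * fracInt (1 - α) r t)
      ≤ ∫ s in (0 : ℝ)..t, (r s + t ^ (α - 1) * h ^ (-α) * (s * r s)
        + t ^ (α - 1) * h ^ q * α * (t - s) ^ (q - 1)) := by
    rw [← mul_assoc]
    nth_rewrite 1 [fracInt]
    rw [← intervalIntegral.integral_const_mul]
    refine intervalIntegral.integral_mono_on_of_le_Ioo ht.le
      ((intervalIntegrable_fracInt h1 hα hr.sing ht.le).const_mul _) ((i1.add i2).add i3)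
      fun s hs => ?_
    have hts := sub_pos.2 hs.2
    have hrs := hr.pos hα hα1 s hs.1
    have hsr := hr.mul_self_le hα hα1 hs.1
    have e2 : Real.Gamma (1 - α) * t ^ α * omega (1 - α) (t - s) = t ^ α * (t - s) ^ (-α) := by
      rw [omega, show 1 - α - 1 = -α by ring]
      field_simp
    rw [smul_eq_mul, ← mul_assoc, e2]
    have hts' := Real.rpow_pos_of_pos hts (-α)
    have a1 : t ^ α * (t - s) ^ (-α) ≤ 1 + t ^ (α - 1) * (t - s) ^ (-α) * s := by
      have b1 : (t - s) / t ≤ ((t - s) / t) ^ α := by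
        have : (t - s) / t ≤ 1 := by rw [div_le_one ht]; linarith [hs.1]
        simpa using Real.rpow_le_rpow_of_exponent_ge (div_pos hts ht) this hα1.le
      have b2 : (t ^ α * (t - s) ^ (-α)) * ((t - s) / t) ^ α = 1 := by
        rw [Real.div_rpow hts.le ht.le, Real.rpow_neg hts.le]
        have := Real.rpow_pos_of_pos hts α
        field_simp
      have b3 : t ^ (α - 1) = t ^ α / t := by rw [Real.rpow_sub ht, Real.rpow_one]
      have b4 := mul_le_mul_of_nonneg_left b1 (mul_pos hta hts').le
      rw [b2] at b4
      have b5 : (t ^ α * (t - s) ^ (-α)) * ((t - s) / t)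
          = t ^ α * (t - s) ^ (-α) - t ^ (α - 1) * (t - s) ^ (-α) * s := by
        rw [b3]
        field_simp
      linarith
    have a2 : (t - s) ^ (-α) ≤ h ^ (-α) + h ^ q * (t - s) ^ (q - 1) := by
      have c1 := Real.rpow_pos_of_pos hh0 (-α)
      have c2 := Real.rpow_pos_of_pos hh0 q
      have c3 := Real.rpow_pos_of_pos hts (q - 1)
      rcases le_total h (t - s) with hle | hle
      · have := Real.rpow_le_rpow_of_nonpos hh0 hle (by linarith : -α ≤ 0)
        nlinarith
      · have c4 : (t - s) ^ (-α) = (t - s) ^ q * (t - s) ^ (q - 1) := by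
          rw [← Real.rpow_add hts, hq]
          ring_nf
        have := Real.rpow_le_rpow hts.le hle hq0.le
        rw [c4]
        nlinarith
    have hy0 := mul_pos hs.1 hrs
    calc t ^ α * (t - s) ^ (-α) * r s
        ≤ (1 + t ^ (α - 1) * (t - s) ^ (-α) * s) * r s := by gcongr
      _ = r s + t ^ (α - 1) * (t - s) ^ (-α) * (s * r s) := by ring
      _ ≤ r s + t ^ (α - 1) * (h ^ (-α) + h ^ q * (t - s) ^ (q - 1)) * (s * r s) := by gcongr
      _ = r s + t ^ (α - 1) * h ^ (-α) * (s * r s)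
          + t ^ (α - 1) * h ^ q * (s * r s) * (t - s) ^ (q - 1) := by ring
      _ ≤ _ := by
        have := Real.rpow_pos_of_pos hts (q - 1)
        gcongr
  refine key.trans ?_
  rw [intervalIntegral.integral_add (i1.add i2) i3, intervalIntegral.integral_add i1 i2,
    intervalIntegral.integral_const_mul, intervalIntegral.integral_const_mul,
    intervalIntegral.integral_comp_sub_left (fun s => s ^ (q - 1)), sub_self, sub_zero,
    integral_rpow (Or.inl (by linarith)), sub_add_cancel, Real.zero_rpow hq0.ne', sub_zero]
  have f1 : ∫ s in (0 : ℝ)..t, r s ≤ 1 := by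
    have := hr.relax_add_integral hα hα1 ht
    have := hr.relax_nonneg hα hα1 ht
    rw [fracInt_one] at *
    linarith
  have f2 := hr.integral_mul_self_le hα hα1 ht
  have g1 : t ^ (α - 1) * h ^ (-α) * (α * Real.Gamma α * t ^ (1 - α))
      = α * Real.Gamma α * t ^ (-(α / 2)) := by
    have : t ^ (-(α / 2)) = t ^ (α - 1) * h ^ (-α) * t ^ (1 - α) := by
      rw [hh, ← Real.rpow_mul ht.le, ← Real.rpow_add ht, ← Real.rpow_add ht]
      ring_nf
    rw [this]
    ring
  have g2 : t ^ (α - 1) * h ^ q * α * (t ^ q / q)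
      = α * (2 / (1 - α)) * t ^ (-((1 - α) / 4)) := by
    have : t ^ (-((1 - α) / 4)) = t ^ (α - 1) * h ^ q * t ^ q := by
      rw [hh, ← Real.rpow_mul ht.le, ← Real.rpow_add ht, ← Real.rpow_add ht, hq]
      ring_nf
    rw [this, hq]
    field_simp
  rw [g2]
  have f3 := mul_le_mul_of_nonneg_left f2
    (mul_pos hta1 (Real.rpow_pos_of_pos hh0 (-α))).le
  rw [g1] at f3
  linarith

include hr hα hα1 in
theorem tendsto_relax_mul_rpow :
    Tendsto (fun t => t ^ α * fracInt (1 - α) r t) atTop (𝓝 (Real.Gamma (1 - α))⁻¹) := by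
  have h1 : 0 < 1 - α := by linarith
  have hG := Real.Gamma_pos_of_pos h1
  have l0 : Tendsto (fun t => fracInt (1 - α) r t) atTop (𝓝 0) := by
    have h := (tendsto_rpow_neg_atTop hα).const_mul (Real.Gamma (1 + α))
    rw [mul_zero] at h
    refine tendsto_of_tendsto_of_tendsto_of_le_of_le' tendsto_const_nhds h ?_ ?_
    · filter_upwards [eventually_gt_atTop 0] with t ht using hr.relax_nonneg hα hα1 ht
    · filter_upwards [eventually_gt_atTop 0] with t ht using hr.relax_le_rpow hα hα1 ht
  have l1 : Tendsto (fun t => 1 - fracInt (1 - α) r t) atTop (𝓝 1) := by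
    simpa using l0.const_sub 1
  have l2 : Tendsto (fun t : ℝ => 1 + α * Real.Gamma α * t ^ (-(α / 2))
      + α * (2 / (1 - α)) * t ^ (-((1 - α) / 4))) atTop (𝓝 1) := by
    have a := (tendsto_rpow_neg_atTop (half_pos hα)).const_mul (α * Real.Gamma α)
    have b := (tendsto_rpow_neg_atTop (by positivity : 0 < (1 - α) / 4)).const_mul
      (α * (2 / (1 - α)))
    simpa using (a.const_add 1).add b
  have l3 : Tendsto (fun t => Real.Gamma (1 - α) * (t ^ α * fracInt (1 - α) r t)) atTop (𝓝 1) := by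
    refine tendsto_of_tendsto_of_tendsto_of_le_of_le' l1 l2 ?_ ?_
    · filter_upwards [eventually_gt_atTop 0] with t ht using hr.relax_mul_rpow_ge hα hα1 ht
    · filter_upwards [eventually_gt_atTop 0] with t ht using hr.relax_mul_rpow_le_add hα hα1 ht
  have := l3.const_mul (Real.Gamma (1 - α))⁻¹
  simpa [inv_mul_cancel_left₀ hG.ne'] using this

end IsResolvent

end FracPDE

/-! ### The solution kernels as functions of the spectral variable y -/

namespace FracPDE

/-- The rate `|y|^(-2/α)`, for which `rate α y ^ α = y^(-2)`. -/
noncomputable def rate (α y : ℝ) : ℝ := |y| ^ (-(2 / α))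

theorem rate_pos (α : ℝ) {y : ℝ} (hy : y ≠ 0) : 0 < rate α y :=
  Real.rpow_pos_of_pos (abs_pos.2 hy) _

theorem rate_rpow {α y : ℝ} (hα : 0 < α) : rate α y ^ α = (y ^ 2)⁻¹ := by
  rw [rate, ← Real.rpow_mul (abs_nonneg y), show -(2 / α) * α = -(2 : ℕ) by field_simp; norm_num,
    Real.rpow_neg (abs_nonneg y), Real.rpow_natCast, sq_abs]

theorem rate_rpow_half {α y : ℝ} (hα : 0 < α) : rate α y ^ (α / 2) = |y|⁻¹ := by
  rw [rate, ← Real.rpow_mul (abs_nonneg y), show -(2 / α) * (α / 2) = -1 by field_simp,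
    Real.rpow_neg_one]

theorem continuousAt_rate (α : ℝ) {y : ℝ} (hy : y ≠ 0) : ContinuousAt (rate α) y :=
  continuous_abs.continuousAt.rpow_const (Or.inl (abs_ne_zero.2 hy))

theorem tendsto_rate {α : ℝ} (hα : 0 < α) : Tendsto (rate α) (𝓝[≠] 0) atTop :=
  (tendsto_rpow_neg_nhdsGT_zero (neg_neg_of_pos (by positivity) : -(2 / α) < 0)).comp
    tendsto_abs_nhdsNE_zero

/-- The kernel `y λ^(1/α) r(λ^(1/α) t)`, `λ = y^(-2)`. -/
noncomputable def chiFun (α : ℝ) (r : ℝ → ℝ) (t y : ℝ) : ℝ := y * (rate α y * r (rate α y * t))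

/-- The kernel `λ e(λ^(1/α) t)`, `λ = y^(-2)`, with its limit at `y = 0`. -/
noncomputable def phiFun (α : ℝ) (r : ℝ → ℝ) (t y : ℝ) : ℝ :=
  if y = 0 then omega (1 - α) t else (y ^ 2)⁻¹ * fracInt (1 - α) r (rate α y * t)

theorem fracInt_chiFun {α : ℝ} (hα : 0 < α) (r : ℝ → ℝ) {t : ℝ} (ht : 0 < t) (y : ℝ) :
    fracInt (1 - α) (fun s => chiFun α r s y) t = y * phiFun α r t y := by
  rcases eq_or_ne y 0 with rfl | hy
  · simp [chiFun, fracInt]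
  have hμ := rate_pos α hy
  have e1 := fracInt_smul (1 - α) y t fun s => rate α y * r (rate α y * s)
  have e2 := fracInt_smul (1 - α) (rate α y) t fun s => r (rate α y * s)
  simp only [smul_eq_mul] at e1 e2
  simp only [chiFun]
  rw [e1, e2, fracInt_comp_mul hμ r ht, phiFun, if_neg hy, ← rate_rpow hα, smul_eq_mul]
  rw [← mul_assoc (rate α y), show -(1 - α) = α - 1 by ring, Real.rpow_sub hμ, Real.rpow_one,
    mul_div_cancel₀ _ hμ.ne']

namespace IsResolvent

variable {α : ℝ} {r : ℝ → ℝ} (hr : IsResolvent α r) (hα : 0 < α) (hα1 : α < 1)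

include hr hα hα1

theorem abs_chiFun_le {t : ℝ} (ht : 0 < t) (y : ℝ) : |chiFun α r t y| ≤ α * t⁻¹ * |y| := by
  rcases eq_or_ne y 0 with rfl | hy
  · simp [chiFun]
  have hm := mul_pos (rate_pos α hy) ht
  have h1 := hr.mul_self_le hα hα1 hm
  have h0 := hr.pos hα hα1 _ hm
  rw [chiFun, abs_mul, abs_of_pos (mul_pos (rate_pos α hy) h0), mul_comm]
  refine mul_le_mul_of_nonneg_right ?_ (abs_nonneg y)
  rw [← div_eq_mul_inv, le_div_iff₀ ht]
  linarith

/-- Uniform in y because `rate α y ^ (α / 2)` cancels |y|. The next three bounds rest on the same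
scaling, with the estimates of r and e matching each power of y. -/
theorem abs_chiFun_le_rpow {t : ℝ} (ht : 0 < t) (y : ℝ) :
    |chiFun α r t y| ≤ √((Real.Gamma α)⁻¹ * α) * t ^ (α / 2 - 1) := by
  rcases eq_or_ne y 0 with rfl | hy
  · simp only [chiFun, zero_mul, abs_zero]
    positivity
  have hμ := rate_pos α hy
  have hm := mul_pos hμ ht
  have h1 := hr.le_rpow_half hα hα1 hm
  have h0 := hr.pos hα hα1 _ hm
  rw [chiFun, abs_mul, abs_of_pos (mul_pos hμ h0)]
  calc |y| * (rate α y * r (rate α y * t))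
      ≤ |y| * (rate α y * (√((Real.Gamma α)⁻¹ * α) * (rate α y * t) ^ (α / 2 - 1))) := by gcongr
    _ = (|y| * rate α y ^ (α / 2)) * (√((Real.Gamma α)⁻¹ * α) * t ^ (α / 2 - 1)) := by
      rw [Real.mul_rpow hμ.le ht.le, Real.rpow_sub hμ, Real.rpow_one]
      field_simp
    _ = _ := by rw [rate_rpow_half hα, mul_inv_cancel₀ (abs_ne_zero.2 hy), one_mul]

theorem abs_mul_chiFun_le {t : ℝ} (ht : 0 < t) (y : ℝ) :
    |y * chiFun α r t y| ≤ (Real.Gamma α)⁻¹ * t ^ (α - 1) := by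
  have hG := Real.Gamma_pos_of_pos hα
  rcases eq_or_ne y 0 with rfl | hy
  · simp only [zero_mul, abs_zero]
    positivity
  have hμ := rate_pos α hy
  have hm := mul_pos hμ ht
  have h1 := hr.le_omega hα hα1 hm
  have h0 := hr.pos hα hα1 _ hm
  rw [omega, div_eq_inv_mul] at h1
  rw [chiFun, ← mul_assoc, ← sq, abs_of_pos (mul_pos (by positivity) (mul_pos hμ h0))]
  calc y ^ 2 * (rate α y * r (rate α y * t))
      ≤ y ^ 2 * (rate α y * ((Real.Gamma α)⁻¹ * (rate α y * t) ^ (α - 1))) := by gcongr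
    _ = (y ^ 2 * rate α y ^ α) * ((Real.Gamma α)⁻¹ * t ^ (α - 1)) := by
      rw [Real.mul_rpow hμ.le ht.le, Real.rpow_sub hμ, Real.rpow_one]
      field_simp
    _ = _ := by rw [rate_rpow hα, mul_inv_cancel₀ (by positivity), one_mul]

theorem abs_phiFun_le {t : ℝ} (ht : 0 < t) (y : ℝ) :
    |phiFun α r t y| ≤ ((Real.Gamma (1 - α))⁻¹ + Real.Gamma (1 + α)) * t ^ (-α) := by
  have hG := Real.Gamma_pos_of_pos (by linarith : 0 < 1 - α)
  have hG' := Real.Gamma_pos_of_pos (by linarith : 0 < 1 + α)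
  have ht' := Real.rpow_pos_of_pos ht (-α)
  rcases eq_or_ne y 0 with rfl | hy
  · rw [phiFun, if_pos rfl, ← Real.norm_eq_abs, norm_omega (by linarith) ht,
      show 1 - α - 1 = -α by ring]
    gcongr
    linarith
  have hμ := rate_pos α hy
  have hm := mul_pos hμ ht
  have h1 := hr.relax_le_rpow hα hα1 hm
  have h0 := hr.relax_nonneg hα hα1 hm
  rw [phiFun, if_neg hy, abs_of_nonneg (mul_nonneg (by positivity) h0)]
  have hy2 : 0 < (y ^ 2)⁻¹ := by positivity
  calc _ ≤ (y ^ 2)⁻¹ * (Real.Gamma (1 + α) * (rate α y * t) ^ (-α)) := by gcongr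
    _ = Real.Gamma (1 + α) * t ^ (-α) := by
      rw [Real.mul_rpow hμ.le ht.le, Real.rpow_neg hμ.le, rate_rpow hα, inv_inv]
      field_simp
    _ ≤ _ := by
      gcongr
      linarith [inv_pos.2 hG]

theorem abs_mul_phiFun_le {t : ℝ} (ht : 0 < t) (y : ℝ) :
    |y * phiFun α r t y| ≤ √(Real.Gamma (1 + α)) * t ^ (-(α / 2)) := by
  rcases eq_or_ne y 0 with rfl | hy
  · simp only [zero_mul, abs_zero]
    positivity
  have hμ := rate_pos α hy
  have hm := mul_pos hμ ht
  have h1 := hr.relax_le_rpow_half hα hα1 hm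
  have h0 := hr.relax_nonneg hα hα1 hm
  have hy' := abs_pos.2 hy
  rw [phiFun, if_neg hy, abs_mul, abs_of_nonneg (mul_nonneg (by positivity) h0), ← sq_abs]
  calc _ ≤ |y| * ((|y| ^ 2)⁻¹ * (√(Real.Gamma (1 + α)) * (rate α y * t) ^ (-(α / 2)))) := by gcongr
    _ = _ := by
      rw [Real.mul_rpow hμ.le ht.le, Real.rpow_neg hμ.le, rate_rpow_half hα, inv_inv]
      field_simp

theorem continuousAt_chiFun {t : ℝ} (ht : 0 < t) (y : ℝ) :
    ContinuousAt (fun q : ℝ × ℝ => chiFun α r q.1 q.2) (t, y) := by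
  rcases eq_or_ne y 0 with rfl | hy
  · have h0 : chiFun α r t 0 = 0 := by simp [chiFun]
    rw [ContinuousAt, h0]
    have hb : Tendsto (fun q : ℝ × ℝ => α * q.1⁻¹ * |q.2|) (𝓝 (t, 0)) (𝓝 0) := by
      have : ContinuousAt (fun q : ℝ × ℝ => α * q.1⁻¹ * |q.2|) (t, 0) :=
        (continuousAt_const.mul (continuousAt_fst.inv₀ ht.ne')).mul
          (continuous_abs.continuousAt.comp continuousAt_snd)
      simpa [ContinuousAt] using this
    refine squeeze_zero_norm' ?_ hb
    filter_upwards [(continuousAt_fst (p := (t, (0 : ℝ)))).eventually (lt_mem_nhds ht)] with q hq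
    exact hr.abs_chiFun_le hα hα1 hq q.2
  · have hμ : ContinuousAt (fun q : ℝ × ℝ => rate α q.2) (t, y) :=
      ContinuousAt.comp' (x := (t, y)) (continuousAt_rate α hy) continuousAt_snd
    have hm : ContinuousAt (fun q : ℝ × ℝ => rate α q.2 * q.1) (t, y) := hμ.mul continuousAt_fst
    have hc : ContinuousAt r (rate α y * t) :=
      hr.cont.continuousAt (Ioi_mem_nhds (mul_pos (rate_pos α hy) ht))
    exact continuousAt_snd.mul (hμ.mul (ContinuousAt.comp' (x := (t, y)) hc hm))

theorem continuousAt_phiFun {t : ℝ} (ht : 0 < t) (y : ℝ) :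
    ContinuousAt (fun q : ℝ × ℝ => phiFun α r q.1 q.2) (t, y) := by
  have h1 : 0 < 1 - α := by linarith
  rcases eq_or_ne y 0 with rfl | hy
  -- Approach (t, 0) separately along the line y = 0 and off it. Off the line the argument of e
  -- tends to infinity, and the limit of x^α e(x) gives ω_{1-α}(t).
  · rw [ContinuousAt, phiFun, if_pos rfl, ← nhdsWithin_univ,
      ← union_compl_self {q : ℝ × ℝ | q.2 = 0}, nhdsWithin_union]
    refine Tendsto.sup ?_ ?_
    · have h : ContinuousAt (fun q : ℝ × ℝ => omega (1 - α) q.1) (t, 0) :=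
        ContinuousAt.comp' (x := (t, (0 : ℝ)))
          ((continuousOn_omega _).continuousAt (Ioi_mem_nhds ht)) continuousAt_fst
      refine (h.tendsto.mono_left nhdsWithin_le_nhds).congr' ?_
      filter_upwards [self_mem_nhdsWithin] with q hq
      rw [phiFun, if_pos hq]
    · have hsnd : Tendsto (fun q : ℝ × ℝ => q.2) (𝓝[{q : ℝ × ℝ | q.2 = 0}ᶜ] (t, 0)) (𝓝[≠] 0) :=
        tendsto_nhdsWithin_of_tendsto_nhds_of_eventually_within _
          (continuousAt_snd.tendsto.mono_left nhdsWithin_le_nhds) self_mem_nhdsWithin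
      have hfst : Tendsto (fun q : ℝ × ℝ => q.1) (𝓝[{q : ℝ × ℝ | q.2 = 0}ᶜ] (t, 0)) (𝓝 t) :=
        continuousAt_fst.tendsto.mono_left nhdsWithin_le_nhds
      have hm : Tendsto (fun q : ℝ × ℝ => rate α q.2 * q.1)
          (𝓝[{q : ℝ × ℝ | q.2 = 0}ᶜ] (t, 0)) atTop :=
        ((tendsto_rate hα).comp hsnd).atTop_mul_pos ht hfst
      have hpow : Tendsto (fun q : ℝ × ℝ => q.1 ^ (-α))
          (𝓝[{q : ℝ × ℝ | q.2 = 0}ᶜ] (t, 0)) (𝓝 (t ^ (-α))) :=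
        (Real.continuousAt_rpow_const t (-α) (Or.inl ht.ne')).tendsto.comp hfst
      have h := hpow.mul ((hr.tendsto_relax_mul_rpow hα hα1).comp hm)
      have e : omega (1 - α) t = t ^ (-α) * (Real.Gamma (1 - α))⁻¹ := by
        rw [omega, show 1 - α - 1 = -α by ring, div_eq_mul_inv]
      rw [e]
      refine h.congr' ?_
      filter_upwards [self_mem_nhdsWithin, hfst.eventually (lt_mem_nhds ht)] with q hq hq1
      have hq2 : q.2 ≠ 0 := hq
      simp only [Function.comp_apply]
      rw [phiFun, if_neg hq2, Real.mul_rpow (rate_pos α hq2).le hq1.le, rate_rpow hα,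
        Real.rpow_neg hq1.le]
      have := Real.rpow_pos_of_pos hq1 α
      field_simp
  · have hμ : ContinuousAt (fun q : ℝ × ℝ => rate α q.2) (t, y) :=
      ContinuousAt.comp' (x := (t, y)) (continuousAt_rate α hy) continuousAt_snd
    have hm : ContinuousAt (fun q : ℝ × ℝ => rate α q.2 * q.1) (t, y) := hμ.mul continuousAt_fst
    have hc : ContinuousAt (fracInt (1 - α) r) (rate α y * t) :=
      (continuousOn_fracInt h1 hα hr.sing).continuousAt
        (Ioi_mem_nhds (mul_pos (rate_pos α hy) ht))
    have h : ContinuousAt (fun q : ℝ × ℝ => (q.2 ^ 2)⁻¹ * fracInt (1 - α) r (rate α q.2 * q.1))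
        (t, y) :=
      ((continuousAt_snd.pow 2).inv₀ (pow_ne_zero 2 hy)).mul
        (ContinuousAt.comp' (x := (t, y)) hc hm)
    refine h.congr ?_
    filter_upwards [(continuousAt_snd (p := (t, y))).eventually_ne hy] with q hq
    rw [phiFun, if_neg hq]

/-- The rescaled equation e + I^α e = 1; at y = 0 it degenerates to I^α ω_{1-α} = 1. -/
theorem sq_mul_phiFun_add {t : ℝ} (ht : 0 < t) (y : ℝ) :
    y ^ 2 * phiFun α r t y + fracInt α (fun s => phiFun α r s y) t = 1 := by
  rcases eq_or_ne y 0 with rfl | hy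
  · simp only [phiFun, if_pos]
    rw [fracInt_omega hα (by linarith) ht, sub_add_cancel, omega_one]
    ring
  have hμ := rate_pos α hy
  have hy2 : (y ^ 2) ≠ 0 := pow_ne_zero 2 hy
  simp only [phiFun, if_neg hy, ← smul_eq_mul ((y ^ 2)⁻¹)]
  rw [fracInt_smul, fracInt_comp_mul hμ _ ht, Real.rpow_neg hμ.le, rate_rpow hα, inv_inv,
    inv_smul_smul₀ hy2, smul_eq_mul, mul_inv_cancel_left₀ hy2]
  exact hr.relax_add_fracInt hα hα1 (mul_pos hμ ht)

end IsResolvent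

end FracPDE

/-! ### Functional calculus for a symmetric contraction -/

namespace FracPDE

section PolynomialBound

open Polynomial

variable {H : Type*} [NormedAddCommGroup H] [InnerProductSpace ℝ H]

/-- In an orthonormal eigenbasis p(B) is diagonal with entries p(l i), and contractivity puts the
eigenvalues in [-1, 1]. -/
theorem norm_aeval_apply_le_of_finiteDimensional [FiniteDimensional ℝ H] {B : H →ₗ[ℝ] H}
    (hB : B.IsSymmetric) (hB1 : ∀ x, ‖B x‖ ≤ ‖x‖) (p : ℝ[X]) {c : ℝ} (hc : 0 ≤ c)
    (hp : ∀ y ∈ Icc (-1 : ℝ) 1, |p.eval y| ≤ c) (x : H) :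
    ‖aeval B p x‖ ≤ c * ‖x‖ := by
  set b := hB.eigenvectorBasis rfl
  set l := hB.eigenvalues rfl
  have hl : ∀ i, |l i| ≤ 1 := by
    intro i
    have h := hB1 (b i)
    rw [hB.apply_eigenvectorBasis rfl i, norm_smul, b.norm_eq_one, mul_one] at h
    simpa using h
  have hpb : ∀ i, aeval B p (b i) = p.eval (l i) • b i := fun i =>
    Module.End.aeval_apply_of_hasEigenvector (hB.hasEigenvector_eigenvectorBasis rfl i)
  have hinner : ∀ i, inner ℝ (b i) (aeval B p x) = p.eval (l i) * inner ℝ (b i) x := by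
    intro i
    conv_lhs => rw [← b.sum_repr x, map_sum]
    simp only [map_smul, hpb, inner_sum, inner_smul_right]
    rw [Finset.sum_eq_single i]
    · rw [b.repr_apply_apply, real_inner_self_eq_norm_sq, b.norm_eq_one]
      ring
    · intro j _ hj
      rw [b.orthonormal.2 hj.symm]
      ring
    · simp
  refine le_of_sq_le_sq ?_ (by positivity)
  rw [mul_pow, ← b.sum_sq_norm_inner_right, ← b.sum_sq_norm_inner_right x, Finset.mul_sum]
  refine Finset.sum_le_sum fun i _ => ?_
  rw [hinner i, norm_mul, mul_pow]
  have := hp (l i) (abs_le.1 (hl i))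
  rw [Real.norm_eq_abs]
  gcongr

/-- For a symmetric contraction `A` of a Hilbert space, `‖p(A)‖` is at most the supremum of `|p|`
on `[-1, 1]`. -/
theorem norm_aeval_apply_le {A : H →L[ℝ] H} (hA : (A : H →ₗ[ℝ] H).IsSymmetric) (hA1 : ‖A‖ ≤ 1)
    (p : ℝ[X]) {c : ℝ} (hc : 0 ≤ c) (hp : ∀ y ∈ Icc (-1 : ℝ) 1, |p.eval y| ≤ c) (w : H) :
    ‖aeval A p w‖ ≤ c * ‖w‖ := by
  set n := p.natDegree
  -- Krylov space of w. The compression B of A to K is again a symmetric contraction, and its powers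
  -- up to the degree of p agree with those of A on w, so p(A)w = p(B)w reduces the bound to finite
  -- dimension.
  set K : Submodule ℝ H := Submodule.span ℝ (Set.range fun k : Fin (n + 1) => (A ^ (k : ℕ)) w)
  have hK : ∀ k ≤ n, (A ^ k) w ∈ K := fun k hk =>
    Submodule.subset_span ⟨⟨k, Nat.lt_succ_of_le hk⟩, rfl⟩
  have : FiniteDimensional ℝ K := FiniteDimensional.span_of_finite ℝ (Set.finite_range _)
  let B : K →ₗ[ℝ] K := (K.orthogonalProjectionOnto.comp (A.comp K.subtypeL) : K →L[ℝ] K)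
  have hBs : B.IsSymmetric := by
    intro x y
    change inner ℝ (K.orthogonalProjectionOnto (A x)) y
      = inner ℝ x (K.orthogonalProjectionOnto (A y))
    rw [Submodule.inner_orthogonalProjectionOnto_eq_of_mem_left,
      Submodule.inner_orthogonalProjectionOnto_eq_of_mem_right]
    exact hA x y
  have hB1 : ∀ x, ‖B x‖ ≤ ‖x‖ := by
    intro x
    calc ‖K.orthogonalProjectionOnto (A x)‖ ≤ 1 * ‖A x‖ :=
          K.orthogonalProjectionOnto.le_of_opNorm_le K.orthogonalProjectionOnto_norm_le _
      _ ≤ 1 * (1 * ‖(x : H)‖) := by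
        gcongr
        exact A.le_of_opNorm_le hA1 _
      _ = ‖x‖ := by simp
  let w₀ : K := ⟨w, by simpa using hK 0 (Nat.zero_le _)⟩
  have hpow : ∀ k ≤ n, (((B ^ k) w₀ : K) : H) = (A ^ k) w := by
    intro k
    induction k with
    | zero => intro _; simp [w₀]
    | succ k ih =>
      intro hk
      have h := ih (by omega)
      rw [pow_succ', pow_succ']
      change ((K.orthogonalProjectionOnto (A ((B ^ k) w₀ : K)) : K) : H) = A ((A ^ k) w)
      rw [h]
      have hm := hK (k + 1) hk
      rw [pow_succ'] at hm
      exact congrArg Subtype.val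
        (Submodule.orthogonalProjectionOnto_mem_subspace_eq_self (K := K) ⟨_, hm⟩)
  have haev : ((aeval B p w₀ : K) : H) = aeval A p w := by
    rw [aeval_eq_sum_range, aeval_eq_sum_range]
    simp only [LinearMap.sum_apply, sum_apply, LinearMap.smul_apply, smul_apply,
      Submodule.coe_sum, Submodule.coe_smul]
    exact Finset.sum_congr rfl fun k hk => by
      rw [hpow k (Nat.lt_succ_iff.1 (Finset.mem_range.1 hk))]
  rw [← haev]
  exact norm_aeval_apply_le_of_finiteDimensional hBs hB1 p hc hp w₀

/-- Continuous functional calculus on `C([-1, 1])` for a symmetric contraction of a real Hilbert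
space. -/
theorem exists_functionalCalculus [CompleteSpace H] {A : H →L[ℝ] H}
    (hA : (A : H →ₗ[ℝ] H).IsSymmetric) (hA1 : ‖A‖ ≤ 1) :
    ∃ Θ : C(Icc (-1 : ℝ) 1, ℝ) →L[ℝ] (H →L[ℝ] H), (∀ f, ‖Θ f‖ ≤ ‖f‖) ∧ Θ 1 = 1 ∧
      ∀ f, Θ (X.toContinuousMapOn _ * f) = A * Θ f := by
  let e : ℝ[X] →ₗ[ℝ] C(Icc (-1 : ℝ) 1, ℝ) := (toContinuousMapOnAlgHom (Icc (-1 : ℝ) 1)).toLinearMap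
  let f : ℝ[X] →ₗ[ℝ] (H →L[ℝ] H) := (aeval A).toLinearMap
  have he : ∀ p : ℝ[X], e p = p.toContinuousMapOn _ := fun _ => rfl
  -- Weierstrass: polynomials are dense, and the polynomial bound lets p ↦ p(A) extend by
  -- continuity.
  have hd : DenseRange e := by
    intro g
    rw [Metric.mem_closure_iff]
    intro ε hε
    obtain ⟨p, hp⟩ := exists_polynomial_near_continuousMap (-1) 1 g ε hε
    exact ⟨_, ⟨p, rfl⟩, by rwa [dist_comm, dist_eq_norm]⟩
  have hn : ∀ p, ‖f p‖ ≤ 1 * ‖e p‖ := by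
    intro p
    rw [one_mul]
    refine ContinuousLinearMap.opNorm_le_bound _ (norm_nonneg _) fun w =>
      norm_aeval_apply_le hA hA1 p (norm_nonneg _) (fun y hy => ?_) w
    exact (e p).norm_coe_le_norm ⟨y, hy⟩
  have hext : ∀ p, f.extendOfNorm e (e p) = f p :=
    LinearMap.extendOfNorm_eq hd ⟨1, hn⟩
  refine ⟨f.extendOfNorm e, fun g => ?_, ?_, fun g => ?_⟩
  · simpa using LinearMap.norm_extendOfNorm_apply_le hd 1 hn g
  · have h := hext 1
    have h1 : e 1 = 1 := map_one (toContinuousMapOnAlgHom (Icc (-1 : ℝ) 1))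
    have h2 : f 1 = 1 := map_one (aeval A)
    rwa [h1, h2] at h
  · refine hd.induction_on (p := fun g => f.extendOfNorm e (X.toContinuousMapOn _ * g)
      = A * f.extendOfNorm e g) g ?_ fun p => ?_
    · exact isClosed_eq ((f.extendOfNorm e).continuous.comp (continuous_const.mul continuous_id))
        (continuous_const.mul (f.extendOfNorm e).continuous)
    · have h1 : (X.toContinuousMapOn _ * e p : C(Icc (-1 : ℝ) 1, ℝ)) = e (X * p) :=
        (map_mul (toContinuousMapOnAlgHom (Icc (-1 : ℝ) 1)) X p).symm
      have h2 : f (X * p) = A * f p := by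
        change aeval A (X * p) = A * aeval A p
        rw [map_mul, aeval_X]
      rw [h1, hext, hext, h2]

end PolynomialBound

end FracPDE

/-! ### Solution operators and Duhamel's formula -/

namespace FracPDE

set_option linter.unusedSectionVars false

/-- A jointly continuous function on `(0, ∞) × ℝ` is a continuous family in `C([-1, 1])`. -/
theorem exists_continuousMap_family {F : ℝ → ℝ → ℝ}
    (hF : ∀ t, 0 < t → ∀ y, ContinuousAt (fun q : ℝ × ℝ => F q.1 q.2) (t, y)) :
    ∃ f : ℝ → C(Icc (-1 : ℝ) 1, ℝ), ContinuousOn f (Ioi 0) ∧ ∀ t, 0 < t → ∀ y, f t y = F t y := by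
  have hc : Continuous fun q : Ioi (0 : ℝ) × Icc (-1 : ℝ) 1 => F q.1 q.2 := by
    rw [continuous_iff_continuousAt]
    intro q
    exact ContinuousAt.comp' (x := q) (f := fun q : Ioi (0 : ℝ) × Icc (-1 : ℝ) 1 =>
      ((q.1 : ℝ), (q.2 : ℝ))) (g := fun q : ℝ × ℝ => F q.1 q.2) (hF q.1 q.1.2 q.2)
      (Continuous.continuousAt (by fun_prop))
  -- Compactness of [-1, 1] makes the compact-open topology the sup-norm topology, so currying gives
  -- norm continuity in t.
  let k : C(Ioi (0 : ℝ), C(Icc (-1 : ℝ) 1, ℝ)) := ContinuousMap.curry ⟨_, hc⟩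
  refine ⟨fun t => if h : 0 < t then k ⟨t, h⟩ else 0, ?_, fun t ht y => ?_⟩
  · rw [continuousOn_iff_continuous_domRestrict]
    convert k.continuous using 1
    ext t : 1
    exact dif_pos t.2
  · exact (congrArg (fun q : C(Icc (-1 : ℝ) 1, ℝ) => q y) (dif_pos ht)).trans rfl

theorem fracInt_continuousMap_apply {a β t : ℝ} {f : ℝ → C(Icc (-1 : ℝ) 1, ℝ)} (ha : 0 < a)
    (hβ : 0 < β) (hf : Sing β f) (ht : 0 ≤ t) (y : Icc (-1 : ℝ) 1) :
    fracInt a f t y = fracInt a (fun s => f s y) t :=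
  (fracInt_clm (ContinuousMap.evalCLM ℝ y) ha hβ hf ht).symm

variable {H : Type*} [NormedAddCommGroup H] [InnerProductSpace ℝ H] [CompleteSpace H]

/-- The families `Φ = A^{-2} E_α(-t^α A^{-2})` and `χ = ∂_t^{1-α} (A Φ)` of solution operators. -/
structure SolutionOperators (α c : ℝ) (A : H →L[ℝ] H) (Φ χ : ℝ → H →L[ℝ] H) : Prop where
  contΦ : ContinuousOn Φ (Ioi 0)
  contχ : ContinuousOn χ (Ioi 0)
  normΦ : ∀ t, 0 < t → ‖Φ t‖ ≤ c * t ^ (1 - α - 1)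
  normAΦ : ∀ t, 0 < t → ‖A * Φ t‖ ≤ c * t ^ (1 - α / 2 - 1)
  normχ : ∀ t, 0 < t → ‖χ t‖ ≤ c * t ^ (α / 2 - 1)
  normAχ : ∀ t, 0 < t → ‖A * χ t‖ ≤ c * t ^ (α - 1)
  fracχ : ∀ t, 0 < t → fracInt (1 - α) χ t = A * Φ t
  eq : ∀ t, 0 < t → A * (A * Φ t) + fracInt α Φ t = 1

/-- The calculus is linear and contractive and turns multiplication by y into A; it also commutes
with fractional integration in time. Every scalar bound and identity therefore passes to operators.
-/
theorem exists_solutionOperators {α : ℝ} (hα : 0 < α) (hα1 : α < 1) {A : H →L[ℝ] H}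
    (hA : (A : H →ₗ[ℝ] H).IsSymmetric) (hA1 : ‖A‖ ≤ 1) :
    ∃ c Φ χ, SolutionOperators α c A Φ χ := by
  have h1 : 0 < 1 - α := by linarith
  obtain ⟨r, hr⟩ := exists_isResolvent hα hα1.le
  obtain ⟨Θ, hΘn, hΘ1, hΘX⟩ := exists_functionalCalculus hA hA1
  obtain ⟨φ, hφc, hφ⟩ := exists_continuousMap_family (F := phiFun α r)
    fun t ht y => hr.continuousAt_phiFun hα hα1 ht y
  obtain ⟨ψ, hψc, hψ⟩ := exists_continuousMap_family (F := chiFun α r)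
    fun t ht y => hr.continuousAt_chiFun hα hα1 ht y
  set c1 := (Real.Gamma (1 - α))⁻¹ + Real.Gamma (1 + α)
  set c2 := √(Real.Gamma (1 + α))
  set c3 := √((Real.Gamma α)⁻¹ * α)
  set c4 := (Real.Gamma α)⁻¹
  have hc1 : 0 ≤ c1 := add_nonneg (inv_nonneg.2 (Real.Gamma_pos_of_pos h1).le)
    (Real.Gamma_pos_of_pos (by linarith)).le
  have hc2 : 0 ≤ c2 := Real.sqrt_nonneg _
  have hc3 : 0 ≤ c3 := Real.sqrt_nonneg _
  have hc4 : 0 ≤ c4 := inv_nonneg.2 (Real.Gamma_pos_of_pos hα).le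
  let x : C(Icc (-1 : ℝ) 1, ℝ) := Polynomial.X.toContinuousMapOn _
  have hx : ∀ y, x y = y := fun y => by simp [x]
  have nφ : ∀ t, 0 < t → ‖φ t‖ ≤ c1 * t ^ (1 - α - 1) := fun t ht => by
    rw [show 1 - α - 1 = -α by ring]
    have := Real.rpow_nonneg ht.le (-α)
    refine (ContinuousMap.norm_le _ (by positivity)).2 fun y => ?_
    rw [hφ t ht]
    exact hr.abs_phiFun_le hα hα1 ht y
  have nψ : ∀ t, 0 < t → ‖ψ t‖ ≤ c3 * t ^ (α / 2 - 1) := fun t ht => by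
    have := Real.rpow_nonneg ht.le (α / 2 - 1)
    refine (ContinuousMap.norm_le _ (by positivity)).2 fun y => ?_
    rw [hψ t ht]
    exact hr.abs_chiFun_le_rpow hα hα1 ht y
  have nxφ : ∀ t, 0 < t → ‖x * φ t‖ ≤ c2 * t ^ (1 - α / 2 - 1) := fun t ht => by
    rw [show 1 - α / 2 - 1 = -(α / 2) by ring]
    have := Real.rpow_nonneg ht.le (-(α / 2))
    refine (ContinuousMap.norm_le _ (by positivity)).2 fun y => ?_
    rw [ContinuousMap.mul_apply, hx, hφ t ht]
    exact hr.abs_mul_phiFun_le hα hα1 ht y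
  have nxψ : ∀ t, 0 < t → ‖x * ψ t‖ ≤ c4 * t ^ (α - 1) := fun t ht => by
    have := Real.rpow_nonneg ht.le (α - 1)
    refine (ContinuousMap.norm_le _ (by positivity)).2 fun y => ?_
    rw [ContinuousMap.mul_apply, hx, hψ t ht]
    exact hr.abs_mul_chiFun_le hα hα1 ht y
  have sφ : Sing (1 - α) φ := Sing.of_le (hφc.aestronglyMeasurable measurableSet_Ioi) nφ
  have sψ : Sing (α / 2) ψ := Sing.of_le (hψc.aestronglyMeasurable measurableSet_Ioi) nψ
  set c := c1 + c2 + c3 + c4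
  refine ⟨c, fun t => Θ (φ t), fun t => Θ (ψ t), ?_⟩
  refine ⟨Θ.continuous.comp_continuousOn hφc, Θ.continuous.comp_continuousOn hψc,
    fun t ht => ?_, fun t ht => ?_, fun t ht => ?_, fun t ht => ?_, fun t ht => ?_, fun t ht => ?_⟩
  · refine (hΘn _).trans ((nφ t ht).trans ?_)
    gcongr
    linarith
  · rw [← hΘX]
    refine (hΘn _).trans ((nxφ t ht).trans ?_)
    gcongr
    linarith
  · refine (hΘn _).trans ((nψ t ht).trans ?_)
    gcongr
    linarith
  · rw [← hΘX]
    refine (hΘn _).trans ((nxψ t ht).trans ?_)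
    gcongr
    linarith
  · rw [← hΘX, fracInt_clm Θ h1 (half_pos hα) sψ ht.le]
    congr 1
    ext y
    rw [fracInt_continuousMap_apply h1 (half_pos hα) sψ ht.le, ContinuousMap.mul_apply, hφ t ht]
    change _ = x y * _
    rw [hx, ← fracInt_chiFun hα r ht]
    exact fracInt_congr ht.le fun s h0 _ => hψ s h0 y
  · rw [← hΘX, ← hΘX, fracInt_clm Θ hα h1 sφ ht.le, ← map_add, ← hΘ1]
    congr 1
    ext y
    rw [ContinuousMap.add_apply, fracInt_continuousMap_apply hα h1 sφ ht.le,
      ContinuousMap.mul_apply, ContinuousMap.mul_apply, hφ t ht,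
      fracInt_congr ht.le fun s h0 _ => hφ s h0 y, ContinuousMap.one_apply]
    change x y * (x y * _) + _ = _
    rw [hx, ← mul_assoc, ← sq]
    exact hr.sq_mul_phiFun_add hα hα1 ht y

/-- `v` and `U` solve `A² U + I^α U = f + ∫ (P v + Q (A U))` with `A U = I^{1-α} v`. -/
structure IsSolution (α : ℝ) (A : H →L[ℝ] H) (P Q : ℝ → H →L[ℝ] H) (f v U : ℝ → H) : Prop where
  contv : ContinuousOn v (Ioi 0)
  contU : ContinuousOn U (Ioi 0)
  singv : Sing α v
  singU : Sing (1 - α / 2) U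
  frac : ∀ t, 0 < t → A (U t) = fracInt (1 - α) v t
  eq : ∀ t, 0 < t → A (A (U t)) + fracInt α U t
    = f t + ∫ s in (0 : ℝ)..t, lowerOrder P Q (1 - α) v s

section

variable {α c p : ℝ} {A : H →L[ℝ] H} {Φ χ P Q : ℝ → H →L[ℝ] H}

theorem hconv_const_mul (L : H →L[ℝ] H) {β γ : ℝ} {w : ℝ → H} {K : ℝ → H →L[ℝ] H} (hβ : 0 < β)
    (hγ : 0 < γ) (hw : Sing β w) (hK : Sing γ K) {t : ℝ} (ht : 0 ≤ t) :
    hconv (evalL H H) w (fun s => L * K s) t = L (hconv (evalL H H) w K t) :=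
  L.intervalIntegral_comp_comm (intervalIntegrable_hconv (evalL H H) hw hK hβ hγ ht)

theorem IsSolution.add (hα : 0 < α) (hα1 : α < 1)
    (hPm : AEStronglyMeasurable P (volume.restrict (Ioi 0)))
    (hQm : AEStronglyMeasurable Q (volume.restrict (Ioi 0)))
    (hP : ∀ t, ‖P t‖ ≤ p) (hQ : ∀ t, ‖Q t‖ ≤ p)
    {f v U f' v' U' : ℝ → H} (h : IsSolution α A P Q f v U) (h' : IsSolution α A P Q f' v' U') :
    IsSolution α A P Q (fun t => f t + f' t) (fun t => v t + v' t) (fun t => U t + U' t) where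
  contv := h.contv.add h'.contv
  contU := h.contU.add h'.contU
  singv := h.singv.add h'.singv
  singU := h.singU.add h'.singU
  frac t ht := by
    rw [map_add, h.frac t ht, h'.frac t ht,
      fracInt_add (by linarith) hα h.singv h'.singv ht.le]
  eq t ht := by
    have e := h.eq t ht
    have e' := h'.eq t ht
    have h1 : 0 < 1 - α := by linarith
    have hi : ∀ {v : ℝ → H}, Sing α v →
        IntervalIntegrable (lowerOrder P Q (1 - α) v) volume 0 t := fun hv =>
      (Sing.lowerOrder hPm hQm hP hQ h1 hα hv).intervalIntegrable hα ht.le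
    have hl : ∫ s in (0 : ℝ)..t, lowerOrder P Q (1 - α) (fun t => v t + v' t) s
        = (∫ s in (0 : ℝ)..t, lowerOrder P Q (1 - α) v s)
          + ∫ s in (0 : ℝ)..t, lowerOrder P Q (1 - α) v' s := by
      rw [← intervalIntegral.integral_add (hi h.singv) (hi h'.singv)]
      refine intervalIntegral.integral_congr_ae (Eventually.of_forall fun s hs => ?_)
      rw [uIoc_of_le ht.le] at hs
      exact lowerOrder_add h1 hα h.singv h'.singv hs.1.le
    rw [hl, fracInt_add hα (by linarith) h.singU h'.singU ht.le, map_add, map_add,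
      add_add_add_comm, e, e']
    abel

/-- Perturbation of an unperturbed solution (v₀, U₀). The Volterra equation v = v₀ + χ * w with w =
P v + Q I^{1-α}v is solved for v, and then U = U₀ + Φ * w. The bound on AU = I^{1-α}v needs only v;
that on U needs Φ * w. -/
theorem exists_isSolution_of_free (hα : 0 < α) (hα1 : α < 1) (hop : SolutionOperators α c A Φ χ)
    (hPm : AEStronglyMeasurable P (volume.restrict (Ioi 0)))
    (hQm : AEStronglyMeasurable Q (volume.restrict (Ioi 0)))
    (hP : ∀ t, ‖P t‖ ≤ p) (hQ : ∀ t, ‖Q t‖ ≤ p) {β : ℝ} (hβ : α ≤ β) (T : ℝ) :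
    ∃ C, 0 ≤ C ∧ ∀ (N : ℝ) (f v₀ U₀ : ℝ → H), ContinuousOn v₀ (Ioi 0) → ContinuousOn U₀ (Ioi 0) →
      (∀ t, 0 < t → ‖v₀ t‖ ≤ N * t ^ (β - 1)) → Sing (1 - α / 2) U₀ →
      (∀ t, 0 < t → A (U₀ t) = fracInt (1 - α) v₀ t) →
      (∀ t, 0 < t → A (A (U₀ t)) + fracInt α U₀ t = f t) →
      ∃ v U, IsSolution α A P Q f v U ∧
        ∀ t, 0 < t → t ≤ T → ‖A (U t)‖ ≤ C * N * t ^ (β - α) ∧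
          ‖U t‖ ≤ ‖U₀ t‖ + C * N * t ^ (β - α) := by
  have h1 : 0 < 1 - α := by linarith
  have hβ0 : 0 < β := hα.trans_le hβ
  obtain ⟨ν, hν, hsol⟩ := exists_volterra_solution (half_pos hα) (by linarith) h1 (by linarith) hβ0
    hop.contχ hop.normχ hPm hQm hP hQ
  have hp : 0 ≤ p := (norm_nonneg _).trans (hP 0)
  have hc : 0 ≤ c := by simpa using (norm_nonneg _).trans (hop.normχ 1 one_pos)
  -- On (0, T] the exponential weight is absorbed into the constant.
  set E := 2 * Real.exp (ν * |T|) with hE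
  set g := Real.Gamma β / Real.Gamma (β + (1 - α)) with hg
  have hg0 : 0 ≤ g := div_nonneg (Real.Gamma_pos_of_pos hβ0).le
    (Real.Gamma_pos_of_pos (by linarith)).le
  set C₂ := p * E + p * (g * E * |T| ^ (1 - α)) with hC₂
  have hC₂0 : 0 ≤ C₂ := by positivity
  have hB := (ProbabilityTheory.beta_pos hβ0 h1).le
  refine ⟨g * E + 1 * C₂ * c * ProbabilityTheory.beta β (1 - α), by positivity,
    fun N f v₀ U₀ hv₀c hU₀c hv₀ hU₀ hfr heq => ?_⟩
  have hN : 0 ≤ N := by simpa using (norm_nonneg _).trans (hv₀ 1 one_pos)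
  obtain ⟨v, hvc, hvb, hv⟩ := hsol N v₀ hv₀c hv₀
  have hvs : Sing β v := Sing.of_le_exp hν (hvc.aestronglyMeasurable measurableSet_Ioi) hvb
  have hv₀s : Sing β v₀ := Sing.of_le (hv₀c.aestronglyMeasurable measurableSet_Ioi) hv₀
  have hw : Sing β (lowerOrder P Q (1 - α) v) := Sing.lowerOrder hPm hQm hP hQ h1 hβ0 hvs
  have hΦs : Sing (1 - α) Φ :=
    Sing.of_le (hop.contΦ.aestronglyMeasurable measurableSet_Ioi) hop.normΦ
  have hχs : Sing (α / 2) χ :=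
    Sing.of_le (hop.contχ.aestronglyMeasurable measurableSet_Ioi) hop.normχ
  set w := lowerOrder P Q (1 - α) v with hwd
  have hΦw := hw.hconv (evalL H H) hΦs hβ0 h1
  -- I^{1-α} falls on χ in χ * w, and I^{1-α}χ = AΦ.
  have hfrac : ∀ t, 0 < t → A (U₀ t + hconv (evalL H H) w Φ t) = fracInt (1 - α) v t := by
    intro t ht
    rw [fracInt_congr ht.le fun s h0 _ => hv s h0,
      fracInt_add h1 hβ0 hv₀s ((hw.hconv _ hχs hβ0 (half_pos hα)).mono (by linarith)) ht.le,
      ← hfr t ht, fracInt_hconv _ hw hχs hβ0 (half_pos hα) h1 ht,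
      hconv_congr_right _ ht.le fun s h0 _ => hop.fracχ s h0,
      hconv_const_mul A hβ0 h1 hw hΦs ht.le, map_add]
  have hAΦs : Sing (1 - α) fun t => A * Φ t := hΦs.clm (ContinuousLinearMap.mul ℝ _ A)
  have hAAΦs : Sing (1 - α) fun t => A * (A * Φ t) := hAΦs.clm (ContinuousLinearMap.mul ℝ _ A)
  have hΦf : Sing (1 - α) (fracInt α Φ) := (hΦs.fracInt hα h1).mono (by linarith)
  have hvT : ∀ s, 0 < s → s ≤ T → ‖v s‖ ≤ E * N * s ^ (β - 1) := by
    intro s h0 h1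
    have := Real.rpow_nonneg h0.le (β - 1)
    calc ‖v s‖ ≤ 2 * N * (s ^ (β - 1) * Real.exp (ν * s)) := hvb s h0
      _ ≤ 2 * N * (s ^ (β - 1) * Real.exp (ν * |T|)) := by
        gcongr
        exact h1.trans (le_abs_self T)
      _ = _ := by rw [hE]; ring
  have hvf : ∀ t, 0 < t → t ≤ T → ‖fracInt (1 - α) v t‖ ≤ g * (E * N) * t ^ (β - α) := by
    intro t h0 hT
    have := norm_fracInt_le h1 hβ0 h0 fun s h0 h1 => hvT s h0 (h1.trans hT)
    rwa [show β + (1 - α) - 1 = β - α by ring] at this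
  have hwT : ∀ s, 0 < s → s ≤ T → ‖w s‖ ≤ C₂ * N * s ^ (β - 1) := by
    intro s h0 hs
    have a := hvT s h0 hs
    have b := hvf s h0 hs
    have e : s ^ (β - α) ≤ |T| ^ (1 - α) * s ^ (β - 1) := by
      rw [show β - α = (1 - α) + (β - 1) by ring, Real.rpow_add h0]
      have := Real.rpow_le_rpow h0.le (hs.trans (le_abs_self T)) h1.le
      have := Real.rpow_nonneg h0.le (β - 1)
      gcongr
    calc ‖w s‖ ≤ p * ‖v s‖ + p * ‖fracInt (1 - α) v s‖ :=
          norm_add_le_of_le ((P s).le_of_opNorm_le (hP s) _) ((Q s).le_of_opNorm_le (hQ s) _)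
      _ ≤ p * (E * N * s ^ (β - 1)) + p * (g * (E * N) * (|T| ^ (1 - α) * s ^ (β - 1))) := by
        have := b.trans (mul_le_mul_of_nonneg_left e (by positivity))
        gcongr
      _ = _ := by rw [hC₂]; ring
  refine ⟨v, fun t => U₀ t + hconv (evalL H H) w Φ t, ⟨hvc, hU₀c.add
    (continuousOn_hconv _ hw hΦs hβ0 h1 hop.contΦ), hvs.mono hβ, hU₀.add (hΦw.mono (by linarith)),
    hfrac, fun t ht => ?_⟩, fun t ht hT => ⟨?_, ?_⟩⟩
  -- By A²Φ + I^α Φ = 1 the correction Φ * w contributes 1 * w = ∫ w.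
  · have e1 : fracInt α (hconv (evalL H H) w Φ) t + A (A (hconv (evalL H H) w Φ t))
        = ∫ s in (0 : ℝ)..t, w s := by
      rw [fracInt_hconv _ hw hΦs hβ0 h1 hα ht, ← hconv_const_mul A hβ0 h1 hw hΦs ht.le,
        ← hconv_const_mul A hβ0 h1 hw hAΦs ht.le]
      have : hconv (evalL H H) w (fracInt α Φ) t
          + hconv (evalL H H) w (fun s => A * (A * Φ s)) t
          = hconv (evalL H H) w (fun s => A * (A * Φ s) + fracInt α Φ s) t := by
        simp only [hconv]
        rw [← intervalIntegral.integral_add (intervalIntegrable_hconv _ hw hΦf hβ0 h1 ht.le)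
          (intervalIntegrable_hconv _ hw hAAΦs hβ0 h1 ht.le)]
        simp only [map_add, add_comm]
      rw [this, hconv_congr_right _ ht.le fun s h0 _ => hop.eq s h0]
      simp [hconv]
    rw [fracInt_add hα (by linarith) hU₀ (hΦw.mono (by linarith)) ht.le, map_add, map_add,
      ← heq t ht, ← e1]
    abel
  · rw [hfrac t ht]
    refine (hvf t ht hT).trans ?_
    have := Real.rpow_nonneg ht.le (β - α)
    have h2 : 0 ≤ 1 * C₂ * c * ProbabilityTheory.beta β (1 - α) * N * t ^ (β - α) := by positivity
    linarith
  · refine norm_add_le_of_le le_rfl ?_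
    have b := norm_hconv_le (evalL H H) hβ0 h1 ht (fun s h0 h1 => hwT s h0 (h1.trans hT))
      fun s h0 _ => hop.normΦ s h0
    rw [show β + (1 - α) - 1 = β - α by ring] at b
    refine b.trans ?_
    have h0 := Real.rpow_nonneg ht.le (β - α)
    have hev := norm_evalL_le (E := H) (F := H)
    calc _ ≤ 1 * (C₂ * N) * c * ProbabilityTheory.beta β (1 - α) * t ^ (β - α) := by gcongr
      _ = 1 * C₂ * c * ProbabilityTheory.beta β (1 - α) * N * t ^ (β - α) := by ring
      _ ≤ _ := by
        have h2 : 0 ≤ g * E * N * t ^ (β - α) := by positivity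
        linarith

end

end FracPDE

/-! ### Abstract problem with initial value and source -/

namespace FracPDE

set_option linter.unusedSectionVars false

variable {H : Type*} [NormedAddCommGroup H] [InnerProductSpace ℝ H] [CompleteSpace H]
  {α c p : ℝ} {A : H →L[ℝ] H} {Φ χ P Q : ℝ → H →L[ℝ] H}

/-- The unperturbed solution is U₀ = AΦ u₀ with v₀ = Aχ u₀ = O(t^(α-1)), so β = α; the bound
O(t^(-α/2)) for AΦ gives the weight t^(α/2). -/
theorem exists_isSolution_of_initial (hα : 0 < α) (hα1 : α < 1)
    (hop : SolutionOperators α c A Φ χ)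
    (hPm : AEStronglyMeasurable P (volume.restrict (Ioi 0)))
    (hQm : AEStronglyMeasurable Q (volume.restrict (Ioi 0)))
    (hP : ∀ t, ‖P t‖ ≤ p) (hQ : ∀ t, ‖Q t‖ ≤ p) {T : ℝ} (hT : 0 < T) :
    ∃ C, 0 ≤ C ∧ ∀ u₀ : H, ∃ v U, IsSolution α A P Q (fun _ => A u₀) v U ∧
      ∀ t, 0 < t → t ≤ T → ‖A (U t)‖ ≤ C * ‖u₀‖ ∧ t ^ (α / 2) * ‖U t‖ ≤ C * ‖u₀‖ := by
  have h1 : 0 < 1 - α := by linarith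
  obtain ⟨C, hC, hsol⟩ := exists_isSolution_of_free hα hα1 hop hPm hQm hP hQ le_rfl T
  have hc : 0 ≤ c := by simpa using (norm_nonneg _).trans (hop.normχ 1 one_pos)
  refine ⟨C * c + (c + T ^ (α / 2) * (C * c)), by positivity, fun u₀ => ?_⟩
  let L : (H →L[ℝ] H) →L[ℝ] H := A.comp (evalL H H u₀)
  have hL : ∀ K : H →L[ℝ] H, L K = A (K u₀) := fun K => rfl
  have hΦs : Sing (1 - α) Φ :=
    Sing.of_le (hop.contΦ.aestronglyMeasurable measurableSet_Ioi) hop.normΦ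
  have hχs : Sing (α / 2) χ :=
    Sing.of_le (hop.contχ.aestronglyMeasurable measurableSet_Ioi) hop.normχ
  have bU₀ : ∀ t, 0 < t → ‖L (Φ t)‖ ≤ c * ‖u₀‖ * t ^ (1 - α / 2 - 1) := fun t ht => by
    rw [mul_right_comm]
    exact (A * Φ t).le_of_opNorm_le (hop.normAΦ t ht) u₀
  have cU₀ : ContinuousOn (fun t => L (Φ t)) (Ioi 0) := L.continuous.comp_continuousOn hop.contΦ
  obtain ⟨v, U, hs, hb⟩ := hsol (c * ‖u₀‖) (fun _ => A u₀) (fun t => L (χ t)) (fun t => L (Φ t))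
    (L.continuous.comp_continuousOn hop.contχ) cU₀
    (fun t ht => by
      rw [mul_right_comm]
      exact (A * χ t).le_of_opNorm_le (hop.normAχ t ht) u₀)
    (Sing.of_le (cU₀.aestronglyMeasurable measurableSet_Ioi) bU₀)
    (fun t ht => by
      rw [fracInt_clm L h1 (half_pos hα) hχs ht.le, hop.fracχ t ht]
      rfl)
    (fun t ht => by
      rw [fracInt_clm L hα h1 hΦs ht.le]
      have := congrArg (fun K : H →L[ℝ] H => A (K u₀)) (hop.eq t ht)
      simpa [hL] using this)
  refine ⟨v, U, hs, fun t ht hT => ?_⟩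
  obtain ⟨b1, b2⟩ := hb t ht hT
  rw [sub_self, Real.rpow_zero, mul_one] at b1 b2
  have hu := norm_nonneg u₀
  constructor
  · refine b1.trans ?_
    have : 0 ≤ (c + T ^ (α / 2) * (C * c)) * ‖u₀‖ := by positivity
    linarith
  · have b3 := bU₀ t ht
    have e : t ^ (α / 2) * t ^ (1 - α / 2 - 1) = 1 := by
      rw [← Real.rpow_add ht, show α / 2 + (1 - α / 2 - 1) = 0 by ring, Real.rpow_zero]
    have hta := Real.rpow_pos_of_pos ht (α / 2)
    have htT := Real.rpow_le_rpow ht.le hT (half_pos hα).le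
    calc t ^ (α / 2) * ‖U t‖
        ≤ t ^ (α / 2) * (c * ‖u₀‖ * t ^ (1 - α / 2 - 1) + C * (c * ‖u₀‖)) := by
          gcongr
          exact b2.trans (by gcongr)
      _ = c * ‖u₀‖ * (t ^ (α / 2) * t ^ (1 - α / 2 - 1)) + t ^ (α / 2) * (C * (c * ‖u₀‖)) := by ring
      _ ≤ c * ‖u₀‖ * 1 + T ^ (α / 2) * (C * (c * ‖u₀‖)) := by rw [e]; gcongr
      _ ≤ _ := by
        have : 0 ≤ C * c * ‖u₀‖ := by positivity
        linarith

/-- The unperturbed solution is U₀ = AΦ * g with v₀ = Aχ * g. Convolution with g = O(t^(η-1)) raises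
each exponent by η, so β = η + α. -/
theorem exists_isSolution_of_source (hα : 0 < α) (hα1 : α < 1)
    (hop : SolutionOperators α c A Φ χ)
    (hPm : AEStronglyMeasurable P (volume.restrict (Ioi 0)))
    (hQm : AEStronglyMeasurable Q (volume.restrict (Ioi 0)))
    (hP : ∀ t, ‖P t‖ ≤ p) (hQ : ∀ t, ‖Q t‖ ≤ p) {η T : ℝ} (hη : 0 < η) (hT : 0 < T) :
    ∃ C, 0 ≤ C ∧ ∀ (M : ℝ) (g : ℝ → H), AEStronglyMeasurable g (volume.restrict (Ioi 0)) →
      (∀ t, 0 < t → ‖g t‖ ≤ M * t ^ (η - 1)) →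
      ∃ v U, IsSolution α A P Q (fun t => A (∫ s in (0 : ℝ)..t, g s)) v U ∧
        ∀ t, 0 < t → t ≤ T →
          ‖A (U t)‖ ≤ C * (M * t ^ η) ∧ t ^ (α / 2) * ‖U t‖ ≤ C * (M * t ^ η) := by
  have h1 : 0 < 1 - α := by linarith
  have h2 : 0 < 1 - α / 2 := by linarith
  obtain ⟨C, hC, hsol⟩ := exists_isSolution_of_free (β := η + α) hα hα1 hop hPm hQm hP hQ
    (by linarith) T
  have hc : 0 ≤ c := by simpa using (norm_nonneg _).trans (hop.normχ 1 one_pos)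
  set B := ProbabilityTheory.beta η α
  set B' := ProbabilityTheory.beta η (1 - α / 2)
  have hB : 0 ≤ B := (ProbabilityTheory.beta_pos hη hα).le
  have hB' : 0 ≤ B' := (ProbabilityTheory.beta_pos hη h2).le
  refine ⟨C * (c * B) + (c * B' + T ^ (α / 2) * (C * (c * B))), by positivity,
    fun M g hgm hg => ?_⟩
  have hM : 0 ≤ M := by simpa using (norm_nonneg _).trans (hg 1 one_pos)
  have hgs : Sing η g := Sing.of_le hgm hg
  have hΦs : Sing (1 - α) Φ :=
    Sing.of_le (hop.contΦ.aestronglyMeasurable measurableSet_Ioi) hop.normΦ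
  have hχs : Sing (α / 2) χ :=
    Sing.of_le (hop.contχ.aestronglyMeasurable measurableSet_Ioi) hop.normχ
  have cAΦ : ContinuousOn (fun t => A * Φ t) (Ioi 0) := continuousOn_const.mul hop.contΦ
  have cAχ : ContinuousOn (fun t => A * χ t) (Ioi 0) := continuousOn_const.mul hop.contχ
  have sAΦ : Sing (1 - α / 2) fun t => A * Φ t :=
    Sing.of_le (cAΦ.aestronglyMeasurable measurableSet_Ioi) hop.normAΦ
  have sAχ : Sing α fun t => A * χ t :=
    Sing.of_le (cAχ.aestronglyMeasurable measurableSet_Ioi) hop.normAχ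
  have sAAΦ : Sing (1 - α) fun t => A * (A * Φ t) :=
    (hΦs.clm (ContinuousLinearMap.mul ℝ _ A)).clm (ContinuousLinearMap.mul ℝ _ A)
  have sfΦ : Sing (1 - α) (fracInt α Φ) := (hΦs.fracInt hα h1).mono (by linarith)
  have hev := norm_evalL_le (E := H) (F := H)
  have bU₀ : ∀ t, 0 < t → ‖hconv (evalL H H) g (fun t => A * Φ t) t‖
      ≤ c * B' * M * t ^ (η + (1 - α / 2) - 1) := fun t ht => by
    refine (norm_hconv_le (evalL H H) hη h2 ht (fun s h0 _ => hg s h0)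
      fun s h0 _ => hop.normAΦ s h0).trans ?_
    have := Real.rpow_pos_of_pos ht (η + (1 - α / 2) - 1)
    calc _ ≤ 1 * M * c * B' * t ^ (η + (1 - α / 2) - 1) := by gcongr
      _ = _ := by ring
  obtain ⟨v, U, hs, hb⟩ := hsol (c * B * M) (fun t => A (∫ s in (0 : ℝ)..t, g s))
    (hconv (evalL H H) g fun t => A * χ t) (hconv (evalL H H) g fun t => A * Φ t)
    (continuousOn_hconv _ hgs sAχ hη hα cAχ) (continuousOn_hconv _ hgs sAΦ hη h2 cAΦ)
    (fun t ht => by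
      refine (norm_hconv_le (evalL H H) hη hα ht (fun s h0 _ => hg s h0)
        fun s h0 _ => hop.normAχ s h0).trans ?_
      have := Real.rpow_pos_of_pos ht (η + α - 1)
      calc _ ≤ 1 * M * c * B * t ^ (η + α - 1) := by gcongr
        _ = _ := by ring)
    ((hgs.hconv _ sAΦ hη h2).mono (by linarith))
    (fun t ht => by
      rw [fracInt_hconv _ hgs sAχ hη hα h1 ht, ← hconv_const_mul A hη h2 hgs sAΦ ht.le]
      refine hconv_congr_right _ ht.le fun s h0 _ => ?_
      rw [← hop.fracχ s h0]
      exact (fracInt_clm (ContinuousLinearMap.mul ℝ _ A) h1 (half_pos hα) hχs h0.le).symm)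
    (fun t ht => by
      have e1 : fracInt α (hconv (evalL H H) g fun t => A * Φ t) t
          = A (hconv (evalL H H) g (fracInt α Φ) t) := by
        rw [fracInt_hconv _ hgs sAΦ hη h2 hα ht, ← hconv_const_mul A hη h1 hgs sfΦ ht.le]
        refine hconv_congr_right _ ht.le fun s h0 _ => ?_
        exact fracInt_clm (ContinuousLinearMap.mul ℝ _ A) hα h1 hΦs h0.le
      have e2 : A (hconv (evalL H H) g (fun t => A * Φ t) t)
          = hconv (evalL H H) g (fun s => A * (A * Φ s)) t :=
        (hconv_const_mul A hη h2 hgs sAΦ ht.le).symm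
      rw [e1, e2, ← map_add]
      congr 1
      have e3 : hconv (evalL H H) g (fun s => A * (A * Φ s)) t
          + hconv (evalL H H) g (fracInt α Φ) t
          = hconv (evalL H H) g (fun s => A * (A * Φ s) + fracInt α Φ s) t := by
        simp only [hconv]
        rw [← intervalIntegral.integral_add (intervalIntegrable_hconv _ hgs sAAΦ hη h1 ht.le)
          (intervalIntegrable_hconv _ hgs sfΦ hη h1 ht.le)]
        simp only [map_add]
      rw [e3, hconv_congr_right _ ht.le fun s h0 _ => hop.eq s h0]
      simp [hconv])
  refine ⟨v, U, hs, fun t ht hT => ?_⟩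
  obtain ⟨b1, b2⟩ := hb t ht hT
  rw [add_sub_cancel_right] at b1 b2
  have htη := Real.rpow_pos_of_pos ht η
  constructor
  · refine b1.trans ?_
    have : 0 ≤ (c * B' + T ^ (α / 2) * (C * (c * B))) * (M * t ^ η) := by positivity
    linarith
  · have b3 := bU₀ t ht
    have e : t ^ (α / 2) * t ^ (η + (1 - α / 2) - 1) = t ^ η := by
      rw [← Real.rpow_add ht]
      ring_nf
    have hta := Real.rpow_pos_of_pos ht (α / 2)
    have htT := Real.rpow_le_rpow ht.le hT (half_pos hα).le
    calc t ^ (α / 2) * ‖U t‖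
        ≤ t ^ (α / 2) * (c * B' * M * t ^ (η + (1 - α / 2) - 1) + C * (c * B * M) * t ^ η) := by
          gcongr
          exact b2.trans (by gcongr)
      _ = c * B' * M * (t ^ (α / 2) * t ^ (η + (1 - α / 2) - 1))
          + t ^ (α / 2) * (C * (c * B * M) * t ^ η) := by ring
      _ ≤ c * B' * M * t ^ η + T ^ (α / 2) * (C * (c * B * M) * t ^ η) := by rw [e]; gcongr
      _ ≤ _ := by
        have : 0 ≤ C * (c * B) * (M * t ^ η) := by positivity
        linarith

/-- Well-posedness of the abstract problem. -/
theorem exists_isSolution (hα : 0 < α) (hα1 : α < 1) (hA : (A : H →ₗ[ℝ] H).IsSymmetric)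
    (hA1 : ‖A‖ ≤ 1) (hPm : AEStronglyMeasurable P (volume.restrict (Ioi 0)))
    (hQm : AEStronglyMeasurable Q (volume.restrict (Ioi 0)))
    (hP : ∀ t, ‖P t‖ ≤ p) (hQ : ∀ t, ‖Q t‖ ≤ p) {η T : ℝ} (hη : 0 < η) (hT : 0 < T) :
    ∃ C, 0 ≤ C ∧ ∀ (M : ℝ) (g : ℝ → H) (u₀ : H),
      AEStronglyMeasurable g (volume.restrict (Ioi 0)) →
      (∀ t, 0 < t → ‖g t‖ ≤ M * t ^ (η - 1)) →
      ∃ v U, IsSolution α A P Q (fun t => A (u₀ + ∫ s in (0 : ℝ)..t, g s)) v U ∧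
        ∀ t, 0 < t → t ≤ T → ‖A (U t)‖ ≤ C * (‖u₀‖ + M * t ^ η) ∧
          t ^ (α / 2) * ‖U t‖ ≤ C * (‖u₀‖ + M * t ^ η) := by
  obtain ⟨c, Φ, χ, hop⟩ := exists_solutionOperators hα hα1 hA hA1
  obtain ⟨C₁, hC₁, h1⟩ := exists_isSolution_of_initial hα hα1 hop hPm hQm hP hQ hT
  obtain ⟨C₂, hC₂, h2⟩ := exists_isSolution_of_source hα hα1 hop hPm hQm hP hQ hη hT
  refine ⟨C₁ + C₂, by positivity, fun M g u₀ hgm hg => ?_⟩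
  have hM : 0 ≤ M := by simpa using (norm_nonneg _).trans (hg 1 one_pos)
  obtain ⟨v₁, U₁, s1, b1⟩ := h1 u₀
  obtain ⟨v₂, U₂, s2, b2⟩ := h2 M g hgm hg
  refine ⟨_, _, by simpa only [map_add] using s1.add hα hα1 hPm hQm hP hQ s2, fun t ht hT => ?_⟩
  obtain ⟨b11, b12⟩ := b1 t ht hT
  obtain ⟨b21, b22⟩ := b2 t ht hT
  have hu := norm_nonneg u₀
  have htη := Real.rpow_pos_of_pos ht η
  have x1 : 0 ≤ C₁ * (M * t ^ η) := by positivity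
  have x2 : 0 ≤ C₂ * ‖u₀‖ := by positivity
  constructor
  · rw [map_add]
    have := norm_add_le_of_le b11 b21
    linarith
  · have hta := Real.rpow_pos_of_pos ht (α / 2)
    have := mul_le_mul_of_nonneg_left (norm_add_le (U₁ t) (U₂ t)) hta.le
    linarith

end FracPDE

/-! ### The energy space -/

namespace FracPDE

section Renorming

/-- A copy of the vector space `V` without norm. -/
def Renormed (V : Type*) := V

instance (V : Type*) [AddCommGroup V] : AddCommGroup (Renormed V) :=
  inferInstanceAs (AddCommGroup V)

instance (V : Type*) [AddCommGroup V] [Module ℝ V] : Module ℝ (Renormed V) :=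
  inferInstanceAs (Module ℝ V)

/-- A bounded coercive symmetric bilinear form on a Banach space is the inner product of an
isomorphic Hilbert space. -/
theorem exists_hilbert_equiv.{u} {V : Type u} [NormedAddCommGroup V] [NormedSpace ℝ V]
    [CompleteSpace V] {B : V → V → ℝ} {c C : ℝ} (hc : 0 < c)
    (hadd : ∀ x y z, B (x + y) z = B x z + B y z) (hsmul : ∀ (r : ℝ) x y, B (r • x) y = r * B x y)
    (hsymm : ∀ x y, B x y = B y x) (hlow : ∀ x, c ^ 2 * ‖x‖ ^ 2 ≤ B x x)
    (hupp : ∀ x, B x x ≤ C ^ 2 * ‖x‖ ^ 2) (hC : 0 ≤ C) :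
    ∃ (W : Type u) (_ : NormedAddCommGroup W) (_ : InnerProductSpace ℝ W) (_ : CompleteSpace W)
      (e : W ≃L[ℝ] V), ∀ w z, inner ℝ w z = B (e w) (e z) := by
  have hdef : ∀ x : V, B x x = 0 → x = 0 := fun x hx => by
    by_contra hn
    have h1 := norm_pos_iff.2 hn
    have h2 : 0 < c ^ 2 * ‖x‖ ^ 2 := by positivity
    linarith [hlow x]
  have hpos : ∀ x : V, 0 ≤ B x x := fun x => le_trans (by positivity) (hlow x)
  let core : InnerProductSpace.Core ℝ (Renormed V) :=
    { inner := B
      conj_inner_symm := fun x y => hsymm y x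
      re_inner_nonneg := hpos
      add_left := hadd
      smul_left := fun x y r => hsmul r x y
      definite := hdef }
  let _ : NormedAddCommGroup (Renormed V) := core.toNormedAddCommGroup
  let _ : InnerProductSpace ℝ (Renormed V) := InnerProductSpace.ofCore core.toCore
  have hB : ∀ w z : Renormed V, inner ℝ w z = B w z := fun _ _ => rfl
  have hn : ∀ w : Renormed V, ‖w‖ ^ 2 = B w w := fun w => by
    rw [← real_inner_self_eq_norm_sq, hB]
  let l : Renormed V ≃ₗ[ℝ] V := LinearEquiv.refl ℝ V
  have h1 : ∀ w, ‖l w‖ ≤ c⁻¹ * ‖w‖ := fun w => by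
    rw [inv_mul_eq_div, le_div_iff₀ hc, mul_comm]
    refine le_of_sq_le_sq ?_ (norm_nonneg _)
    rw [mul_pow, hn]
    exact hlow w
  have h2 : ∀ w, ‖l.symm w‖ ≤ C * ‖w‖ := fun w => by
    refine le_of_sq_le_sq ?_ (by positivity)
    rw [mul_pow, hn]
    exact hupp w
  let e := l.toContinuousLinearEquivOfBounds _ _ h1 h2
  exact ⟨Renormed V, _, inferInstance, (completeSpace_congr (e := e.toEquiv) e.isUniformEmbedding).2 inferInstance,
    e, hB⟩

/-- The energy space of a coercive form `⟪S p, q⟫` on the graph `V` of a gradient. -/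
theorem exists_energySpace_of_graph.{u} {H X : Type u} [NormedAddCommGroup H]
    [InnerProductSpace ℝ H] [NormedAddCommGroup X] [InnerProductSpace ℝ X]
    (V : Submodule ℝ (H × X)) [CompleteSpace V] {S : X →L[ℝ] X} {κ₀ : ℝ} (hκ₀ : 0 < κ₀)
    (hsymm : ∀ p q, inner ℝ (S p) q = inner ℝ (S q) p)
    (hco : ∀ p, κ₀ * ‖p‖ ^ 2 ≤ inner ℝ (S p) p) :
    ∃ (W : Type u) (_ : NormedAddCommGroup W) (_ : InnerProductSpace ℝ W) (_ : CompleteSpace W)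
      (ι : W →L[ℝ] H) (D : W →L[ℝ] X), ‖ι‖ ≤ 1 ∧
      (∀ w z, inner ℝ w z = inner ℝ (S (D w)) (D z) + inner ℝ (ι w) (ι z)) ∧
      (∀ w, (ι w, D w) ∈ V) ∧ ∀ v Dv, (v, Dv) ∈ V → ∃ w, ι w = v ∧ D w = Dv := by
  obtain ⟨W, i1, i2, i3, e, he⟩ := exists_hilbert_equiv (V := V)
    (B := fun q r => inner ℝ (S q.1.2) r.1.2 + inner ℝ q.1.1 r.1.1)
    -- Square roots because the form is compared with squared norms. The norm on V is the maximum of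
    -- the norms of value and gradient.
    (c := √(min κ₀ 1)) (C := √(‖S‖ + 1)) (by positivity)
    (fun x y z => by
      simp only [Submodule.coe_add, Prod.fst_add, Prod.snd_add, map_add, inner_add_left]
      ring)
    (fun r x y => by
      simp only [Submodule.coe_smul, Prod.smul_fst, Prod.smul_snd, map_smul,
        real_inner_smul_left]
      ring)
    (fun x y => by rw [hsymm, real_inner_comm x.1.1])
    (fun x => by
      rw [Real.sq_sqrt (by positivity), real_inner_self_eq_norm_sq]
      have hm : 0 < min κ₀ 1 := by positivity
      have h1 := hco x.1.2
      have h2 : min κ₀ 1 * ‖x.1.2‖ ^ 2 ≤ κ₀ * ‖x.1.2‖ ^ 2 := by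
        gcongr
        exact min_le_left _ _
      have h3 : min κ₀ 1 * ‖x.1.1‖ ^ 2 ≤ 1 * ‖x.1.1‖ ^ 2 := by
        gcongr
        exact min_le_right _ _
      have h4 : min κ₀ 1 * ‖x‖ ^ 2 ≤ min κ₀ 1 * ‖x.1.2‖ ^ 2 + min κ₀ 1 * ‖x.1.1‖ ^ 2 := by
        rw [← mul_add]
        gcongr
        rw [Submodule.coe_norm, Prod.norm_def]
        rcases max_choice ‖x.1.1‖ ‖x.1.2‖ with h | h <;> rw [h] <;> nlinarith [sq_nonneg ‖x.1.1‖, sq_nonneg ‖x.1.2‖]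
      linarith)
    (fun x => by
      rw [Real.sq_sqrt (by positivity), real_inner_self_eq_norm_sq, add_mul, one_mul]
      have a1 : ‖x.1.1‖ ≤ ‖x‖ := norm_fst_le x.1
      have a2 : ‖x.1.2‖ ≤ ‖x‖ := norm_snd_le x.1
      refine add_le_add ?_ (by gcongr)
      calc _ ≤ ‖S x.1.2‖ * ‖x.1.2‖ := real_inner_le_norm _ _
        _ ≤ ‖S‖ * ‖x.1.2‖ * ‖x.1.2‖ := by gcongr; exact (S).le_opNorm _
        _ ≤ ‖S‖ * ‖x‖ * ‖x‖ := by gcongr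
        _ = _ := by ring)
    (by positivity)
  refine ⟨W, i1, i2, i3, ContinuousLinearMap.fst ℝ _ _ ∘L V.subtypeL ∘L e.toContinuousLinearMap,
    ContinuousLinearMap.snd ℝ _ _ ∘L V.subtypeL ∘L e.toContinuousLinearMap, ?_, he,
    fun w => (e w).2, fun v Dv hv => ⟨e.symm ⟨(v, Dv), hv⟩, by simp, by simp⟩⟩
  refine ContinuousLinearMap.opNorm_le_bound _ zero_le_one fun w => ?_
  rw [one_mul]
  refine le_of_sq_le_sq ?_ (norm_nonneg _)
  rw [← real_inner_self_eq_norm_sq, ← real_inner_self_eq_norm_sq w, he]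
  have : 0 ≤ κ₀ * ‖(e w).1.2‖ ^ 2 := by positivity
  have h1 := hco (e w).1.2
  simp only [ContinuousLinearMap.comp_apply]
  change inner ℝ (e w).1.1 (e w).1.1 ≤ _
  linarith

end Renorming

variable {d : ℕ} {Ω : Set (EuclideanSpace ℝ (Fin d))}

/-! ### Multiplication operators and ellipticity -/

section Multiplication

theorem norm_mulL2_le (c : LInf Ω) (v : L2 Ω) : ‖mulL2 c v‖ ≤ ‖c‖ * ‖v‖ :=
  Lp.norm_smul_le c v

theorem mulL2_add (c : LInf Ω) (v w : L2 Ω) : mulL2 c (v + w) = mulL2 c v + mulL2 c w :=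
  Lp.add_smul c v w

theorem add_mulL2 (c e : LInf Ω) (v : L2 Ω) : mulL2 (c + e) v = mulL2 c v + mulL2 e v :=
  Lp.smul_add c e v

theorem smul_mulL2 (r : ℝ) (c : LInf Ω) (v : L2 Ω) : mulL2 (r • c) v = r • mulL2 c v :=
  Lp.smul_assoc r c v

theorem mulL2_smul (r : ℝ) (c : LInf Ω) (v : L2 Ω) : mulL2 c (r • v) = r • mulL2 c v :=
  (Lp.smul_comm r c v).symm

/-- Multiplication with a fixed function as a bounded operator. -/
noncomputable def mulL (c : LInf Ω) : L2 Ω →L[ℝ] L2 Ω :=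
  LinearMap.mkContinuous
    { toFun := mulL2 c, map_add' := mulL2_add c, map_smul' := fun r v => mulL2_smul r c v }
    ‖c‖ (norm_mulL2_le c)

/-- Multiplication `L_∞(Ω) × L_2(Ω) → L_2(Ω)` as a bounded bilinear map. -/
noncomputable def mulB (Ω : Set (EuclideanSpace ℝ (Fin d))) : LInf Ω →L[ℝ] L2 Ω →L[ℝ] L2 Ω :=
  LinearMap.mkContinuous
    { toFun := mulL
      map_add' := fun c e => ContinuousLinearMap.ext (add_mulL2 c e)
      map_smul' := fun r c => ContinuousLinearMap.ext (smul_mulL2 r c) } 1 fun c => by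
    rw [one_mul]
    exact ContinuousLinearMap.opNorm_le_bound (mulL c) (norm_nonneg c) (norm_mulL2_le c)

theorem mulB_apply (c : LInf Ω) (v : L2 Ω) : mulB Ω c v = mulL2 c v := rfl

theorem inner_mulL2 (c : LInf Ω) (v w : L2 Ω) :
    inner ℝ (mulL2 c v) w = ∫ x in Ω, c x * v x * w x := by
  rw [L2.inner_def]
  refine integral_congr_ae ?_
  filter_upwards [coeFn_mulL2 c v] with x hx
  rw [hx]
  simp [mul_comm]

theorem integrable_mul_mul (c : LInf Ω) (v w : L2 Ω) :
    Integrable (fun x => c x * v x * w x) (volume.restrict Ω) := by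
  refine (L2.integrable_inner (𝕜 := ℝ) (mulL2 c v) w).congr ?_
  filter_upwards [coeFn_mulL2 c v] with x hx
  rw [hx]
  simp [mul_comm]

variable {κ : Matrix (Fin d) (Fin d) (LInf Ω)}

/-- Multiplication with a matrix function as a bounded operator. -/
noncomputable def matMulL (κ : Matrix (Fin d) (Fin d) (LInf Ω)) : L2Vec Ω →L[ℝ] L2Vec Ω :=
  (PiLp.continuousLinearEquiv 2 ℝ fun _ : Fin d => L2 Ω).symm.toContinuousLinearMap ∘L
    ContinuousLinearMap.pi fun i => ∑ j, mulB Ω (κ i j) ∘L PiLp.proj 2 (fun _ : Fin d => L2 Ω) j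

theorem matMulL_apply (p : L2Vec Ω) : matMulL κ p = matMul κ p := by
  ext1 i
  simp [matMulL, matMul, mulB_apply]

theorem inner_matMul (p q : L2Vec Ω) :
    inner ℝ (matMul κ p) q = ∑ i, ∑ j, ∫ x in Ω, κ i j x * p j x * q i x := by
  simp [PiLp.inner_apply, matMul, sum_inner, inner_mulL2]

theorem UniformlyElliptic.inner_matMul_comm (hκ : UniformlyElliptic κ) (p q : L2Vec Ω) :
    inner ℝ (matMul κ p) q = inner ℝ (matMul κ q) p := by
  rw [inner_matMul, inner_matMul, Finset.sum_comm]
  refine Finset.sum_congr rfl fun i _ => Finset.sum_congr rfl fun j _ => integral_congr_ae ?_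
  filter_upwards [hκ.1] with x hx
  rw [hx]
  ring

theorem UniformlyElliptic.coercive (hκ : UniformlyElliptic κ) :
    ∃ κ₀, 0 < κ₀ ∧ ∀ p : L2Vec Ω, κ₀ * ‖p‖ ^ 2 ≤ inner ℝ (matMul κ p) p := by
  obtain ⟨-, κ₀, h0, h⟩ := hκ
  refine ⟨κ₀, h0, fun p => ?_⟩
  have hi : ∀ i, Integrable (fun x => p i x ^ 2) (volume.restrict Ω) := fun i =>
    (L2.integrable_inner (𝕜 := ℝ) (p i) (p i)).congr
      (Eventually.of_forall fun x => by simp [pow_two])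
  have hn : ‖p‖ ^ 2 = ∫ x in Ω, ∑ i, p i x ^ 2 := by
    rw [integral_finsetSum _ fun i _ => hi i, ← real_inner_self_eq_norm_sq, PiLp.inner_apply]
    refine Finset.sum_congr rfl fun i _ => ?_
    rw [L2.inner_def]
    exact integral_congr_ae (Eventually.of_forall fun x => by simp [pow_two])
  have hk : inner ℝ (matMul κ p) p = ∫ x in Ω, ∑ i, ∑ j, κ i j x * p j x * p i x := by
    rw [inner_matMul]
    refine Eq.trans (Finset.sum_congr rfl fun i _ => ?_)
      (integral_finsetSum _ fun i _ => integrable_finsetSum _ fun j _ =>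
        integrable_mul_mul (κ i j) (p j) (p i)).symm
    exact (integral_finsetSum _ fun j _ => integrable_mul_mul (κ i j) (p j) (p i)).symm
  rw [hn, hk, ← integral_const_mul]
  refine integral_mono_ae ((integrable_finsetSum _ fun i _ => hi i).const_mul κ₀)
    (integrable_finsetSum _ fun i _ => integrable_finsetSum _ fun j _ =>
      integrable_mul_mul _ _ _) ?_
  filter_upwards [h] with x hx using hx fun i => p i x

end Multiplication

/-! ### Test functions and the Sobolev space -/

section Sobolev

/-- The pairs `(φ, ∇φ)` for test functions `φ`. -/
noncomputable def testGraph (Ω : Set (EuclideanSpace ℝ (Fin d))) :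
    Submodule ℝ (L2 Ω × L2Vec Ω) where
  carrier := {q | ∃ φ, IsTestFunction Ω φ ∧
    q.1 =ᵐ[volume.restrict Ω] φ ∧ ∀ i : Fin d, q.2 i =ᵐ[volume.restrict Ω] partialDeriv i φ}
  zero_mem' := by
    refine ⟨0, ⟨contDiff_const, HasCompactSupport.zero, by simp [tsupport]⟩, Lp.coeFn_zero _ _ _, fun i => ?_⟩
    refine (Lp.coeFn_zero _ _ _).trans (Eventually.of_forall fun x => ?_)
    simp [partialDeriv]
  add_mem' := by
    rintro p q ⟨φ, hφ, h1, h2⟩ ⟨ψ, hψ, h3, h4⟩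
    refine ⟨φ + ψ, ⟨hφ.smooth.add hψ.smooth, hφ.compact.add hψ.compact,
      (tsupport_add φ ψ).trans (union_subset hφ.support hψ.support)⟩,
      (Lp.coeFn_add _ _).trans (h1.add h3), fun i => ?_⟩
    refine (Lp.coeFn_add _ _).trans (((h2 i).add (h4 i)).trans (Eventually.of_forall fun x => ?_))
    simp [partialDeriv, fderiv_add ((hφ.smooth.differentiable (by simp)) x)
      ((hψ.smooth.differentiable (by simp)) x)]
  smul_mem' := by
    rintro c p ⟨φ, hφ, h1, h2⟩
    refine ⟨c • φ, ⟨hφ.smooth.const_smul c, hφ.compact.smul_left (f := fun _ => c),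
      (tsupport_smul_subset_right (fun _ => c) φ).trans hφ.support⟩,
      (Lp.coeFn_smul _ _).trans (h1.const_smul c), fun i => ?_⟩
    refine (Lp.coeFn_smul _ _).trans (((h2 i).const_smul c).trans
      (Eventually.of_forall fun x => ?_))
    simp [partialDeriv, fderiv_const_smul ((hφ.smooth.differentiable (by simp)) x)]

/-- `H^1_0(Ω)` is dense in `L_2(Ω)`. -/
theorem eq_zero_of_forall_inner_eq_zero (hΩ : IsOpen Ω) {h : L2 Ω}
    (h0 : ∀ v Dv, HasH10Grad Ω v Dv → inner ℝ h v = 0) : h = 0 := by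
  have key := hΩ.ae_eq_zero_of_integral_contDiff_smul_eq_zero (μ := volume.restrict Ω)
    (f := h) (((Lp.memLp h).locallyIntegrable (by norm_num)).locallyIntegrableOn Ω) ?_
  · refine Lp.ext ?_
    filter_upwards [key, ae_restrict_mem hΩ.measurableSet, Lp.coeFn_zero ℝ 2 (volume.restrict Ω)]
      with x h1 h2 h3
    rw [h1 h2, h3]
    rfl
  intro φ h1 h2 h3
  have hφ : IsTestFunction Ω φ := ⟨h1, h2, h3⟩
  have m0 : MemLp φ 2 (volume.restrict Ω) :=
    (h1.continuous.memLp_of_hasCompactSupport h2).restrict _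
  have m1 : ∀ i, MemLp (partialDeriv i φ) 2 (volume.restrict Ω) := fun i =>
    (((h1.continuous_fderiv (by simp)).clm_apply continuous_const).memLp_of_hasCompactSupport
      (h2.fderiv_apply ℝ (EuclideanSpace.single i 1))).restrict _
  rw [← h0 m0.toLp (WithLp.toLp 2 fun i => (m1 i).toLp) (subset_closure
    ⟨φ, hφ, m0.coeFn_toLp, fun i => (m1 i).coeFn_toLp⟩), L2.inner_def]
  refine integral_congr_ae ?_
  filter_upwards [m0.coeFn_toLp] with x hx
  rw [hx]
  simp

/-- The space `H^1_0(Ω)` with the energy inner product. -/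
theorem exists_energySpace {κ : Matrix (Fin d) (Fin d) (LInf Ω)} (hκ : UniformlyElliptic κ) :
    ∃ (W : Type) (_ : NormedAddCommGroup W) (_ : InnerProductSpace ℝ W) (_ : CompleteSpace W)
      (ι : W →L[ℝ] L2 Ω) (D : W →L[ℝ] L2Vec Ω), ‖ι‖ ≤ 1 ∧
      (∀ w z, inner ℝ w z = inner ℝ (matMul κ (D w)) (D z) + inner ℝ (ι w) (ι z)) ∧
      (∀ w, HasH10Grad Ω (ι w) (D w)) ∧
      ∀ v Dv, HasH10Grad Ω v Dv → ∃ w, ι w = v ∧ D w = Dv := by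
  obtain ⟨κ₀, hκ₀, hco⟩ := hκ.coercive
  have hV : CompleteSpace (testGraph Ω).topologicalClosure := inferInstance
  obtain ⟨W, i1, i2, i3, ι, D, h1, h2, h3, h4⟩ := exists_energySpace_of_graph
    (testGraph Ω).topologicalClosure (S := matMulL κ) hκ₀
    (fun p q => by rw [matMulL_apply, matMulL_apply]; exact hκ.inner_matMul_comm p q)
    (fun p => by rw [matMulL_apply]; exact hco p)
  refine ⟨W, i1, i2, i3, ι, D, h1, fun w z => ?_, h3, h4⟩
  rw [h2, matMulL_apply]

end Sobolev

end FracPDE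

/-! ### Reduction of the two-space problem to a symmetric operator -/

namespace FracPDE

set_option linter.unusedSectionVars false

section Block

variable {H W : Type*} [NormedAddCommGroup H] [InnerProductSpace ℝ H] [CompleteSpace H]
  [NormedAddCommGroup W] [InnerProductSpace ℝ W] [CompleteSpace W]

variable (H W) in
/-- The inclusion of the first factor. -/
noncomputable def inlL : H →L[ℝ] WithLp 2 (H × W) :=
  (WithLp.prodContinuousLinearEquiv 2 ℝ H W).symm.toContinuousLinearMap ∘L
    ContinuousLinearMap.inl ℝ H W

variable (H W) in
/-- The inclusion of the second factor. -/
noncomputable def inrL : W →L[ℝ] WithLp 2 (H × W) :=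
  (WithLp.prodContinuousLinearEquiv 2 ℝ H W).symm.toContinuousLinearMap ∘L
    ContinuousLinearMap.inr ℝ H W

/-- The operator `(h, w) ↦ (ι w, ι* h)`. -/
noncomputable def blockOp (ι : W →L[ℝ] H) : WithLp 2 (H × W) →L[ℝ] WithLp 2 (H × W) :=
  inlL H W ∘L ι ∘L WithLp.sndL 2 ℝ H W
    + inrL H W ∘L ContinuousLinearMap.adjoint ι ∘L WithLp.fstL 2 ℝ H W

variable (ι : W →L[ℝ] H)

@[simp] theorem inlL_fst (h : H) : (inlL H W h).fst = h := rfl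

@[simp] theorem inlL_snd (h : H) : (inlL H W h).snd = 0 := rfl

@[simp] theorem inrL_fst (w : W) : (inrL H W w).fst = 0 := rfl

@[simp] theorem inrL_snd (w : W) : (inrL H W w).snd = w := rfl

theorem norm_inlL (h : H) : ‖inlL H W h‖ = ‖h‖ := WithLp.norm_toLp_fst 2 H W h

@[simp] theorem blockOp_fst (x : WithLp 2 (H × W)) : (blockOp ι x).fst = ι x.snd := by
  simp [blockOp]

@[simp] theorem blockOp_snd (x : WithLp 2 (H × W)) :
    (blockOp ι x).snd = ContinuousLinearMap.adjoint ι x.fst := by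
  simp [blockOp]

theorem blockOp_isSymmetric : (blockOp ι : WithLp 2 (H × W) →ₗ[ℝ] WithLp 2 (H × W)).IsSymmetric := by
  intro x y
  simp only [ContinuousLinearMap.coe_coe, WithLp.prod_inner_apply, blockOp_fst, blockOp_snd,
    ContinuousLinearMap.adjoint_inner_left, ContinuousLinearMap.adjoint_inner_right, WithLp.ofLp_fst, WithLp.ofLp_snd]
  ring

variable {ι}

theorem norm_blockOp_le (hι : ‖ι‖ ≤ 1) : ‖blockOp ι‖ ≤ 1 := by
  refine ContinuousLinearMap.opNorm_le_bound _ zero_le_one fun x => ?_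
  rw [one_mul]
  refine le_of_sq_le_sq ?_ (norm_nonneg _)
  rw [WithLp.prod_norm_sq_eq_of_L2, WithLp.prod_norm_sq_eq_of_L2, blockOp_fst, blockOp_snd, add_comm]
  have h1 : ‖ι x.snd‖ ≤ ‖x.snd‖ := by simpa using ι.le_of_opNorm_le hι x.snd
  have h2 : ‖ContinuousLinearMap.adjoint ι x.fst‖ ≤ ‖x.fst‖ := by
    rw [← one_mul ‖x.fst‖]
    exact (ContinuousLinearMap.adjoint ι).le_of_opNorm_le
      ((ContinuousLinearMap.adjoint.norm_map ι).trans_le hι) x.fst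
  gcongr

variable {α p : ℝ} {P Q : ℝ → H →L[ℝ] W}

/-- `ι* ι U + I^α U = f + ∫ (P v + Q (ι U))` with `ι U = I^{1-α} v`. -/
structure IsEnergySolution (α : ℝ) (ι : W →L[ℝ] H) (P Q : ℝ → H →L[ℝ] W) (f : ℝ → W)
    (v : ℝ → H) (U : ℝ → W) : Prop where
  contv : ContinuousOn v (Ioi 0)
  contU : ContinuousOn U (Ioi 0)
  singv : Sing α v
  singU : Sing (1 - α / 2) U
  frac : ∀ t, 0 < t → ι (U t) = fracInt (1 - α) v t
  eq : ∀ t, 0 < t → ContinuousLinearMap.adjoint ι (ι (U t)) + fracInt α U t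
    = f t + ∫ s in (0 : ℝ)..t, lowerOrder P Q (1 - α) v s

/-- The one-space result for A = `blockOp ι` on H ⊕ W with data (u₀, 0) and (g, 0). Since A(h, 0) =
(0, ι*h), the W-component of the equation and the H-component of AU = I^{1-α}v form the required
system. -/
theorem exists_isEnergySolution (hα : 0 < α) (hα1 : α < 1) (hι : ‖ι‖ ≤ 1)
    (hPm : AEStronglyMeasurable P (volume.restrict (Ioi 0)))
    (hQm : AEStronglyMeasurable Q (volume.restrict (Ioi 0)))
    (hP : ∀ t, ‖P t‖ ≤ p) (hQ : ∀ t, ‖Q t‖ ≤ p) {η T : ℝ} (hη : 0 < η) (hT : 0 < T) :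
    ∃ C, 0 ≤ C ∧ ∀ (M : ℝ) (g : ℝ → H) (u₀ : H),
      AEStronglyMeasurable g (volume.restrict (Ioi 0)) →
      (∀ t, 0 < t → ‖g t‖ ≤ M * t ^ (η - 1)) →
      ∃ v U, IsEnergySolution α ι P Q
        (fun t => ContinuousLinearMap.adjoint ι (u₀ + ∫ s in (0 : ℝ)..t, g s)) v U ∧
        ∀ t, 0 < t → t ≤ T → ‖ι (U t)‖ ≤ C * (‖u₀‖ + M * t ^ η) ∧
          t ^ (α / 2) * ‖U t‖ ≤ C * (‖u₀‖ + M * t ^ η) := by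
  have h1α : 0 < 1 - α := by linarith
  -- Coefficients act from the first component into the second, so they only see the H-parts of v
  -- and AU.
  let R : (H →L[ℝ] W) → (WithLp 2 (H × W) →L[ℝ] WithLp 2 (H × W)) := fun T =>
    inrL H W ∘L T ∘L WithLp.fstL 2 ℝ H W
  have hR : Continuous R :=
    (ContinuousLinearMap.postcomp (WithLp 2 (H × W)) (inrL H W)).continuous.comp
      (ContinuousLinearMap.precomp W (WithLp.fstL 2 ℝ H W)).continuous
  have hRb : ∀ T, ‖T‖ ≤ p → ‖R T‖ ≤ ‖inrL H W‖ * (p * ‖WithLp.fstL 2 ℝ H W‖) := fun T hT =>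
    (ContinuousLinearMap.opNorm_comp_le _ _).trans (mul_le_mul_of_nonneg_left
      ((ContinuousLinearMap.opNorm_comp_le _ _).trans
        (mul_le_mul_of_nonneg_right hT (norm_nonneg _))) (norm_nonneg _))
  have hPm' := hR.comp_aestronglyMeasurable hPm
  have hQm' := hR.comp_aestronglyMeasurable hQm
  obtain ⟨C, hC, h⟩ := exists_isSolution hα hα1 (blockOp_isSymmetric ι) (norm_blockOp_le hι)
    hPm' hQm' (fun t => hRb _ (hP t)) (fun t => hRb _ (hQ t)) hη hT
  refine ⟨C, hC, fun M g u₀ hgm hg => ?_⟩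
  obtain ⟨v, U, hs, hb⟩ := h M (fun t => inlL H W (g t)) (inlL H W u₀)
    ((inlL H W).continuous.comp_aestronglyMeasurable hgm)
    (fun t ht => by rw [norm_inlL]; exact hg t ht)
  have hgs : Sing η g := Sing.of_le hgm hg
  have e1 : ∀ {φ : ℝ → WithLp 2 (H × W)} {a β t : ℝ}, 0 < a → 0 < β → Sing β φ → 0 ≤ t →
      fracInt a (fun s => (φ s).fst) t = (fracInt a φ t).fst := fun ha hβ hφ ht =>
    fracInt_clm (WithLp.fstL 2 ℝ H W) ha hβ hφ ht
  have e2 : ∀ {φ : ℝ → WithLp 2 (H × W)} {a β t : ℝ}, 0 < a → 0 < β → Sing β φ → 0 ≤ t →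
      fracInt a (fun s => (φ s).snd) t = (fracInt a φ t).snd := fun ha hβ hφ ht =>
    fracInt_clm (WithLp.sndL 2 ℝ H W) ha hβ hφ ht
  refine ⟨fun t => (v t).fst, fun t => (U t).snd,
    ⟨(WithLp.fstL 2 ℝ H W).continuous.comp_continuousOn hs.contv,
      (WithLp.sndL 2 ℝ H W).continuous.comp_continuousOn hs.contU,
      hs.singv.clm (WithLp.fstL 2 ℝ H W), hs.singU.clm (WithLp.sndL 2 ℝ H W), fun t ht => ?_,
      fun t ht => ?_⟩, fun t ht hT => ?_⟩
  · rw [e1 h1α hα hs.singv ht.le, ← hs.frac t ht, blockOp_fst]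
  · have key := congrArg (WithLp.sndL 2 ℝ H W) (hs.eq t ht)
    rw [map_add, map_add, ← (WithLp.sndL 2 ℝ H W).intervalIntegral_comp_comm
      ((Sing.lowerOrder hPm' hQm' (fun t => hRb _ (hP t)) (fun t => hRb _ (hQ t)) h1α hα
        hs.singv).intervalIntegrable hα ht.le),
      ContinuousLinearMap.intervalIntegral_comp_comm _ (hgs.intervalIntegrable hη ht.le),
      ← map_add (inlL H W)] at key
    simp only [WithLp.sndL_apply, blockOp_snd, blockOp_fst, inlL_fst] at key
    rw [e2 hα (by linarith) hs.singU ht.le, key]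
    congr 1
    refine intervalIntegral.integral_congr fun s hs' => ?_
    rw [uIcc_of_le ht.le] at hs'
    simp [lowerOrder, R, e1 h1α hα hs.singv hs'.1]
  · obtain ⟨b1, b2⟩ := hb t ht hT
    rw [norm_inlL] at b1 b2
    refine ⟨le_trans ?_ b1, le_trans ?_ b2⟩
    · rw [← blockOp_fst]
      exact WithLp.norm_fst_le _ (blockOp ι (U t))
    · have := Real.rpow_nonneg ht.le (α / 2)
      gcongr
      exact WithLp.norm_snd_le _ (U t)

end Block

end FracPDE

/-! ### From the energy equation to the weak formulation -/

namespace FracPDE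

set_option linter.unusedSectionVars false

/-- For γ > 1 the bound t^(γ-1) forces the limit 0 at the origin. -/
theorem Sing.continuousOn_Icc {E : Type*} [NormedAddCommGroup E] [NormedSpace ℝ E] {f : ℝ → E}
    {γ : ℝ} (hf : Sing γ f) (hγ : 1 < γ) (hc : ContinuousOn f (Ioi 0)) (h0 : f 0 = 0) (T : ℝ) :
    ContinuousOn f (Icc 0 T) := by
  intro t ht
  rcases ht.1.eq_or_lt with rfl | h
  · obtain ⟨C, hC, hb⟩ := hf.bdd (T + 1) (by linarith [ht.2])
    have hz : Tendsto (fun t : ℝ => C * t ^ (γ - 1)) (𝓝[Icc 0 T] 0) (𝓝 0) := by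
      have : ContinuousAt (fun t : ℝ => C * t ^ (γ - 1)) 0 :=
        continuousAt_const.mul (Real.continuousAt_rpow_const _ _ (Or.inr (by linarith)))
      have h := this.tendsto.mono_left (nhdsWithin_le_nhds (s := Icc 0 T))
      rwa [Real.zero_rpow (by linarith), mul_zero] at h
    rw [ContinuousWithinAt, h0]
    refine squeeze_zero_norm' (eventually_mem_nhdsWithin.mono fun t ht => ?_) hz
    rcases ht.1.eq_or_lt with rfl | h
    · rw [h0, norm_zero, Real.zero_rpow (by linarith), mul_zero]
    · exact hb t h (by linarith [ht.2])
  · exact (hc.continuousAt (Ioi_mem_nhds h)).continuousWithinAt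

theorem ContinuousOn.indicator_bounded {E : Type*} [NormedAddCommGroup E] {c : ℝ → E} {T : ℝ}
    (hc : ContinuousOn c (Icc 0 T)) :
    AEStronglyMeasurable ((Icc 0 T).indicator c) (volume.restrict (Ioi 0)) ∧
      ∃ p, ∀ t, ‖(Icc 0 T).indicator c t‖ ≤ p := by
  constructor
  · refine AEStronglyMeasurable.restrict ?_
    rw [aestronglyMeasurable_indicator_iff measurableSet_Icc]
    exact hc.aestronglyMeasurable_of_isCompact isCompact_Icc measurableSet_Icc
  · obtain ⟨p, hp⟩ := isCompact_Icc.exists_bound_of_continuousOn hc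
    refine ⟨max p 0, fun t => ?_⟩
    by_cases ht : t ∈ Icc 0 T
    · rw [indicator_of_mem ht]
      exact (hp t ht).trans (le_max_left _ _)
    · rw [indicator_of_notMem ht, norm_zero]
      exact le_max_right _ _

/-- Weak convergence of a bounded family follows from convergence on a dense subspace. -/
theorem tendsto_inner_of_dense {H : Type*} [NormedAddCommGroup H] [InnerProductSpace ℝ H]
    [CompleteSpace H] {S : Submodule ℝ H} (hS : ∀ h : H, (∀ v ∈ S, inner ℝ h v = 0) → h = 0)
    {l : Filter ℝ} {u : ℝ → H} {u₀ : H} {B : ℝ} (hB : ∀ᶠ t in l, ‖u t‖ ≤ B)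
    (h : ∀ v ∈ S, Tendsto (fun t => inner ℝ (u t) v) l (𝓝 (inner ℝ u₀ v))) (v : H) :
    Tendsto (fun t => inner ℝ (u t) v) l (𝓝 (inner ℝ u₀ v)) := by
  have hd : S.topologicalClosure = ⊤ := by
    rw [Submodule.topologicalClosure_eq_top_iff, Submodule.eq_bot_iff]
    exact fun x hx => hS x fun w hw => (Submodule.mem_orthogonal' S x).1 hx w hw
  rw [Metric.tendsto_nhds]
  intro ε hε
  set K := |B| + ‖u₀‖ + 1
  have hK : 0 < K := by positivity
  have hv : v ∈ closure (S : Set H) := by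
    rw [← Submodule.topologicalClosure_coe, hd]
    trivial
  obtain ⟨w, hw, hvw⟩ := Metric.mem_closure_iff.1 hv (ε / (2 * K)) (by positivity)
  filter_upwards [hB, Metric.tendsto_nhds.1 (h w hw) (ε / 2) (by positivity)] with t h1 h2
  rw [Real.dist_eq, ← inner_sub_left] at h2 ⊢
  rw [dist_eq_norm, lt_div_iff₀ (by positivity)] at hvw
  have h3 : |inner ℝ (u t - u₀) (v - w)| ≤ K * ‖v - w‖ := by
    refine (abs_real_inner_le_norm _ _).trans ?_
    gcongr
    refine (norm_sub_le _ _).trans ?_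
    have := h1.trans (le_abs_self B)
    linarith
  have h4 : inner ℝ (u t - u₀) v = inner ℝ (u t - u₀) (v - w) + inner ℝ (u t - u₀) w := by
    rw [← inner_add_right, sub_add_cancel]
  rw [h4]
  refine (abs_add_le _ _).trans_lt ?_
  linarith

section Solution

variable {H W : Type*} [NormedAddCommGroup H] [InnerProductSpace ℝ H] [CompleteSpace H]
  [NormedAddCommGroup W] [InnerProductSpace ℝ W] [CompleteSpace W]
  {α : ℝ} {ι : W →L[ℝ] H} {P Q : ℝ → H →L[ℝ] W} {f : ℝ → W} {v u : ℝ → H} {U : ℝ → W}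

namespace IsEnergySolution

variable (hs : IsEnergySolution α ι P Q f v U) (hα : 0 < α) (hα1 : α < 1)
  (hu : ∀ t, 0 < t → u t = ι (U t))

include hs hα hα1 hu

theorem sing : Sing 1 u := by
  have h := hs.singv.fracInt (by linarith : 0 < 1 - α) hα
  exact (h.mono (by linarith)).congr fun t ht => by rw [hu t ht, hs.frac t ht]

/-- I^α I^{1-α} v = I^1 v. This identifies v with ∂_t^{1-α}u and gives absolute continuity of I^α u.
-/
theorem fracInt_eq_integral {t : ℝ} (ht : 0 ≤ t) : fracInt α u t = ∫ s in (0 : ℝ)..t, v s := by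
  rcases ht.eq_or_lt with rfl | ht'
  · rw [fracInt_zero_right, intervalIntegral.integral_same]
  rw [fracInt_congr ht fun s h0 _ => (hu s h0).trans (hs.frac s h0),
    fracInt_fracInt hα (by linarith) hα hs.singv ht', sub_add_cancel, fracInt_one]

theorem hasDerivAt_fracInt {t : ℝ} (ht : 0 < t) : HasDerivAt (fracInt α u) (v t) t := by
  have h := intervalIntegral.integral_hasDerivAt_right (hs.singv.intervalIntegrable hα ht.le)
    (hs.contv.stronglyMeasurableAtFilter isOpen_Ioi t ht)
    (hs.contv.continuousAt (Ioi_mem_nhds ht))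
  refine h.congr_of_eventuallyEq ?_
  filter_upwards [Ioi_mem_nhds ht] with s hs'
  exact hs.fracInt_eq_integral hα hα1 hu (le_of_lt hs')

theorem rlDeriv_eq {t : ℝ} (ht : 0 < t) : rlDeriv α u t = v t :=
  (hs.hasDerivAt_fracInt hα hα1 hu ht).deriv

theorem intervalIntegrable_rlDeriv {t : ℝ} (ht : 0 ≤ t) :
    IntervalIntegrable (rlDeriv α u) volume 0 t :=
  (hs.singv.intervalIntegrable hα ht).congr fun s hs' => by
    rw [uIoc_of_le ht] at hs'
    exact (hs.rlDeriv_eq hα hα1 hu hs'.1).symm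

theorem fracInt_eq_integral_rlDeriv {t : ℝ} (ht : 0 ≤ t) :
    fracInt α u t = ∫ s in (0 : ℝ)..t, rlDeriv α u s := by
  rw [hs.fracInt_eq_integral hα hα1 hu ht]
  refine intervalIntegral.integral_congr_ae (Eventually.of_forall fun s hs' => ?_)
  rw [uIoc_of_le ht] at hs'
  exact (hs.rlDeriv_eq hα hα1 hu hs'.1).symm

theorem continuousOn_fracInt {T : ℝ} (hT : 0 ≤ T) : ContinuousOn (fracInt α u) (Icc 0 T) := by
  have h := intervalIntegral.continuousOn_primitive_interval
    ((intervalIntegrable_iff' (by simp)).1 (hs.singv.intervalIntegrable hα hT))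
  rw [uIcc_of_le hT] at h
  exact h.congr fun t ht => hs.fracInt_eq_integral hα hα1 hu ht.1

end IsEnergySolution

end Solution

section LowerOrder

variable {d : ℕ} {Ω : Set (EuclideanSpace ℝ (Fin d))} {W : Type*} [NormedAddCommGroup W]
  [InnerProductSpace ℝ W] [CompleteSpace W] {α T : ℝ} {ι : W →L[ℝ] L2 Ω} {P Q : ℝ → L2 Ω →L[ℝ] W}
  {f : ℝ → W} {v u : ℝ → L2 Ω} {U : ℝ → W} {c e : ℝ → LInf Ω}

/-- The integrand of `opB`, with coefficients cut off outside `[0, T]`. -/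
noncomputable def opBIntegrand (T α : ℝ) (c e : ℝ → LInf Ω) (v : ℝ → L2 Ω) : ℝ → L2 Ω :=
  lowerOrder ((Icc 0 T).indicator fun s => mulB Ω (c s))
    ((Icc 0 T).indicator fun s => mulB Ω (e s)) (1 - α) v

theorem Sing.opBIntegrand (hv : Sing α v) (hα : 0 < α) (hα1 : α < 1)
    (hc : ContinuousOn c (Icc 0 T)) (he : ContinuousOn e (Icc 0 T)) :
    Sing α (opBIntegrand T α c e v) := by
  obtain ⟨m1, p1, h1⟩ := ContinuousOn.indicator_bounded ((mulB Ω).continuous.comp_continuousOn hc)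
  obtain ⟨m2, p2, h2⟩ := ContinuousOn.indicator_bounded ((mulB Ω).continuous.comp_continuousOn he)
  exact Sing.lowerOrder m1 m2 (fun t => (h1 t).trans (le_max_left p1 p2))
    (fun t => (h2 t).trans (le_max_right p1 p2)) (by linarith) hα hv

theorem IsEnergySolution.opB_eq (hs : IsEnergySolution α ι P Q f v U) (hα : 0 < α) (hα1 : α < 1)
    (hu : ∀ t, 0 < t → u t = ι (U t)) {t : ℝ} (ht : t ∈ Icc 0 T) :
    opB α c e u t = ∫ s in (0 : ℝ)..t, opBIntegrand T α c e v s := by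
  refine intervalIntegral.integral_congr_ae (Eventually.of_forall fun s hs' => ?_)
  rw [uIoc_of_le ht.1] at hs'
  have hm : s ∈ Icc 0 T := ⟨hs'.1.le, hs'.2.trans ht.2⟩
  rw [opBIntegrand, lowerOrder, indicator_of_mem hm, indicator_of_mem hm,
    hs.rlDeriv_eq hα hα1 hu hs'.1, hu s hs'.1, hs.frac s hs'.1, mulB_apply, mulB_apply]

theorem IsEnergySolution.continuousOn_opB (hs : IsEnergySolution α ι P Q f v U) (hα : 0 < α)
    (hα1 : α < 1) (hu : ∀ t, 0 < t → u t = ι (U t)) (hT : 0 ≤ T)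
    (hc : ContinuousOn c (Icc 0 T)) (he : ContinuousOn e (Icc 0 T)) :
    ContinuousOn (opB α c e u) (Icc 0 T) := by
  have h := intervalIntegral.continuousOn_primitive_interval ((intervalIntegrable_iff' (by simp)).1
    ((hs.singv.opBIntegrand hα hα1 hc he).intervalIntegrable hα hT))
  rw [uIcc_of_le hT] at h
  exact h.congr fun t ht => hs.opB_eq hα hα1 hu ht

/-- The operator `φ ↦ -ι* (c φ) + ∑ i, (∂ i)* (F i φ)`. -/
noncomputable def formOp (ι : W →L[ℝ] L2 Ω) (D : W →L[ℝ] L2Vec Ω) (c : LInf Ω)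
    (F : Fin d → LInf Ω) : L2 Ω →L[ℝ] W :=
  ∑ i, ContinuousLinearMap.adjoint (PiLp.proj 2 (fun _ : Fin d => L2 Ω) i ∘L D) ∘L mulB Ω (F i)
    - ContinuousLinearMap.adjoint ι ∘L mulB Ω c

theorem formOp_apply (ι : W →L[ℝ] L2 Ω) (D : W →L[ℝ] L2Vec Ω) (c : LInf Ω)
    (F : Fin d → LInf Ω) (x : L2 Ω) : formOp ι D c F x =
      ∑ i, ContinuousLinearMap.adjoint (PiLp.proj 2 (fun _ : Fin d => L2 Ω) i ∘L D)
        (mulB Ω (F i) x) - ContinuousLinearMap.adjoint ι (mulB Ω c x) := by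
  simp [formOp]

variable {D : W →L[ℝ] L2Vec Ω} {F G : ℝ → Fin d → LInf Ω}

theorem continuousOn_formOp {S : Set ℝ} (hc : ContinuousOn c S)
    (hF : ∀ i, ContinuousOn (fun s => F s i) S) :
    ContinuousOn (fun s => formOp ι D (c s) (F s)) S := by
  refine ContinuousOn.sub (continuousOn_finsetSum _ fun i _ => ?_) ?_
  · exact continuousOn_const.clm_comp ((mulB Ω).continuous.comp_continuousOn (hF i))
  · exact continuousOn_const.clm_comp ((mulB Ω).continuous.comp_continuousOn hc)

/-- Testing in W removes the adjoints and recovers the B_1 and B_2 terms; the additional ι* in the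
first coefficient leaves the term ⟨∫ v, ιw⟩. -/
theorem inner_integral_lowerOrder (hv : Sing α v) (hα : 0 < α) (hα1 : α < 1)
    (hc : ContinuousOn c (Icc 0 T)) (he : ContinuousOn e (Icc 0 T))
    (hF : ∀ i, ContinuousOn (fun s => F s i) (Icc 0 T))
    (hG : ∀ i, ContinuousOn (fun s => G s i) (Icc 0 T)) {t : ℝ} (ht : t ∈ Icc 0 T) (w : W) :
    inner ℝ (∫ s in (0 : ℝ)..t, lowerOrder
        ((Icc 0 T).indicator fun s => ContinuousLinearMap.adjoint ι + formOp ι D (c s) (F s))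
        ((Icc 0 T).indicator fun s => formOp ι D (e s) (G s)) (1 - α) v s) w
      = inner ℝ (∫ s in (0 : ℝ)..t, v s) (ι w)
        + ∑ i, inner ℝ (∫ s in (0 : ℝ)..t,
          opBIntegrand T α (fun s => F s i) (fun s => G s i) v s) (D w i)
        - inner ℝ (∫ s in (0 : ℝ)..t, opBIntegrand T α c e v s) (ι w) := by
  have i0 := hv.intervalIntegrable hα ht.1
  have i1 := (hv.opBIntegrand hα hα1 hc he).intervalIntegrable hα ht.1
  have i2 := fun i => (hv.opBIntegrand hα hα1 (hF i) (hG i)).intervalIntegrable hα ht.1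
  let A := fun i => ContinuousLinearMap.adjoint (PiLp.proj 2 (fun _ : Fin d => L2 Ω) i ∘L D)
  let ι' := ContinuousLinearMap.adjoint ι
  have key : ∀ s ∈ uIcc 0 t, lowerOrder
        ((Icc 0 T).indicator fun s => ContinuousLinearMap.adjoint ι + formOp ι D (c s) (F s))
        ((Icc 0 T).indicator fun s => formOp ι D (e s) (G s)) (1 - α) v s
      = ι' (v s) + ∑ i, A i (opBIntegrand T α (fun s => F s i) (fun s => G s i) v s)
        - ι' (opBIntegrand T α c e v s) := by
    intro s hs
    rw [uIcc_of_le ht.1] at hs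
    have hm : s ∈ Icc 0 T := ⟨hs.1, hs.2.trans ht.2⟩
    simp only [opBIntegrand, lowerOrder, indicator_of_mem hm, formOp_apply, map_add,
      add_apply, Finset.sum_add_distrib, A, ι']
    abel
  have j2 := fun i => ((hv.opBIntegrand hα hα1 (hF i) (hG i)).clm (A i)).intervalIntegrable hα ht.1
  have j0 := (hv.clm ι').intervalIntegrable hα ht.1
  have j1 := ((hv.opBIntegrand hα hα1 hc he).clm ι').intervalIntegrable hα ht.1
  have j3 : IntervalIntegrable (fun s => ∑ i, A i (opBIntegrand T α (fun s => F s i)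
      (fun s => G s i) v s)) volume 0 t := by
    simpa only [Finset.sum_fn] using IntervalIntegrable.sum Finset.univ fun i _ => j2 i
  rw [intervalIntegral.integral_congr key, intervalIntegral.integral_sub (j0.add j3) j1,
    intervalIntegral.integral_add j0 j3,
    intervalIntegral.integral_finsetSum fun i _ => j2 i, ι'.intervalIntegral_comp_comm i0,
    ι'.intervalIntegral_comp_comm i1, inner_sub_left, inner_add_left, sum_inner,
    ContinuousLinearMap.adjoint_inner_left, ContinuousLinearMap.adjoint_inner_left]
  congr 2
  refine Finset.sum_congr rfl fun i _ => ?_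
  rw [(A i).intervalIntegral_comp_comm (i2 i), ContinuousLinearMap.adjoint_inner_left]
  rfl

/-- The variational equation, without the auxiliary zeroth-order term of the energy space. -/
theorem IsEnergySolution.inner_eq {κ : Matrix (Fin d) (Fin d) (LInf Ω)} {h : ℝ → L2 Ω}
    (hs : IsEnergySolution α ι
      ((Icc 0 T).indicator fun s => ContinuousLinearMap.adjoint ι + formOp ι D (c s) (F s))
      ((Icc 0 T).indicator fun s => formOp ι D (e s) (G s))
      (fun t => ContinuousLinearMap.adjoint ι (h t)) v U)
    (hin : ∀ w z, inner ℝ w z = inner ℝ (matMul κ (D w)) (D z) + inner ℝ (ι w) (ι z))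
    (hα : 0 < α) (hα1 : α < 1) (hu : ∀ t, 0 < t → u t = ι (U t))
    (hc : ContinuousOn c (Icc 0 T)) (he : ContinuousOn e (Icc 0 T))
    (hF : ∀ i, ContinuousOn (fun s => F s i) (Icc 0 T))
    (hG : ∀ i, ContinuousOn (fun s => G s i) (Icc 0 T)) {t : ℝ} (ht : t ∈ Ioc 0 T) (w : W) :
    inner ℝ (u t) (ι w) + inner ℝ (matMul κ (fracInt α (fun t => D (U t)) t)) (D w)
        - ∑ i, inner ℝ (opB α (fun s => F s i) (fun s => G s i) u t) (D w i)
        + inner ℝ (opB α c e u t) (ι w) = inner ℝ (h t) (ι w) := by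
  have ht' := Ioc_subset_Icc_self ht
  have hα2 : 0 < 1 - α / 2 := by linarith
  have key := congrArg (fun x => inner ℝ x w) (hs.eq t ht.1)
  simp only [inner_add_left] at key
  rw [inner_integral_lowerOrder hs.singv hα hα1 hc he hF hG ht' w,
    ContinuousLinearMap.adjoint_inner_left, ContinuousLinearMap.adjoint_inner_left, hin,
    ← fracInt_clm ι hα hα2 hs.singU ht'.1, ← fracInt_clm D hα hα2 hs.singU ht'.1,
    ← fracInt_congr (ψ := fun s => ι (U s)) ht'.1 fun s h _ => hu s h,
    hs.fracInt_eq_integral hα hα1 hu ht'.1, ← hu t ht.1, ← hs.opB_eq hα hα1 hu ht'] at key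
  simp only [← hs.opB_eq hα hα1 hu ht'] at key
  -- ⟨I^α u, ιw⟩ occurs on both sides, on the left from the inner product of W and on the right from
  -- the additional ι*, and cancels.
  linarith

/-- The equation expresses ⟨u(t), x⟩ through functions continuous on [0, T], all of which except
⟨h(t), x⟩ vanish at 0. -/
theorem tendsto_inner_of_variational {κ : Matrix (Fin d) (Fin d) (LInf Ω)} (hT : 0 < T)
    {r h : ℝ → L2 Ω} {p q : ℝ → L2Vec Ω} (hr : ContinuousOn r (Icc 0 T))
    (hh : ContinuousOn h (Icc 0 T)) (hp : ContinuousOn p (Icc 0 T)) (hq : ContinuousOn q (Icc 0 T))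
    (hr0 : r 0 = 0) (hp0 : p 0 = 0) (hq0 : q 0 = 0) {x : L2 Ω} {Dx : L2Vec Ω}
    (heq : ∀ t ∈ Ioc 0 T, inner ℝ (u t) x + inner ℝ (matMul κ (p t)) Dx - inner ℝ (q t) Dx
      + inner ℝ (r t) x = inner ℝ (h t) x) :
    Tendsto (fun t => inner ℝ (u t) x) (𝓝[>] 0) (𝓝 (inner ℝ (h 0) x)) := by
  have hmem : Ioc 0 T ∈ 𝓝[>] (0 : ℝ) := Ioc_mem_nhdsGT hT
  have hc : ContinuousOn (fun t => inner ℝ (h t) x - inner ℝ (matMulL κ (p t)) Dx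
      + inner ℝ (q t) Dx - inner ℝ (r t) x) (Icc 0 T) :=
    (((hh.inner continuousOn_const).sub
      (((matMulL κ).continuous.comp_continuousOn hp).inner continuousOn_const)).add
      (hq.inner continuousOn_const)).sub (hr.inner continuousOn_const)
  have hl := (hc 0 ⟨le_rfl, hT.le⟩).mono_left
    ((nhdsWithin_le_iff).2 (mem_of_superset hmem Ioc_subset_Icc_self))
  simp only [hr0, hp0, hq0, map_zero, inner_zero_left, sub_zero, add_zero] at hl
  refine hl.congr' ?_
  filter_upwards [hmem] with t ht
  rw [matMulL_apply]
  linarith [heq t ht]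

end LowerOrder

end FracPDE

/-! ### The initial-boundary value problem -/

theorem theorem4p2 {d : ℕ} (hd : 1 ≤ d) (Ω : Set (EuclideanSpace ℝ (Fin d)))
    (hΩo : IsOpen Ω) (hΩb : Bornology.IsBounded Ω)
    (T α η : ℝ) (hT : 0 < T) (hα0 : 0 < α) (hα1 : α < 1) (hη : 0 < η)
    (κ : Matrix (Fin d) (Fin d) (LInf Ω)) (hκ : UniformlyElliptic κ)
    (F G : ℝ → Fin d → W1Inf Ω)
    (hF : ContDiffOn ℝ 2 F (Icc 0 T)) (hG : ContDiffOn ℝ 2 G (Icc 0 T))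
    (a b : ℝ → LInf Ω)
    (ha : ContDiffOn ℝ 1 a (Icc 0 T)) (hb : ContDiffOn ℝ 1 b (Icc 0 T)) :
    -- the constant depends only on `Ω`, `T`, `α`, `η` and the coefficients
    ∃ C : ℝ, ∀ (M : ℝ) (g : ℝ → L2 Ω) (u₀ : L2 Ω), 0 < M →
      AEStronglyMeasurable g (volume.restrict (Ioc 0 T)) →
      (∀ t ∈ Ioc 0 T, ‖g t‖ ≤ M * t ^ (η - 1)) →
      ∃ (u : ℝ → L2 Ω) (Du : ℝ → L2Vec Ω),
        -- 1. continuity on `(0, T]`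
        ContinuousOn u (Ioc 0 T) ∧
        -- 2. `u(t) ∈ H^1_0(Ω)`, with gradient `Du(t)`, and the a priori bound
        (∀ t ∈ Ioc 0 T, HasH10Grad Ω (u t) (Du t) ∧
          ‖u t‖ + t ^ (α / 2) * ‖Du t‖ ≤ C * (‖u₀‖ + M * t ^ η)) ∧
        -- the fractional integrals of `u` and `∇u` exist as Bochner integrals
        (∀ t ∈ Icc 0 T,
          IntervalIntegrable (fun s => omega α (t - s) • u s) volume 0 t ∧
          IntervalIntegrable (fun s => omega α (t - s) • Du s) volume 0 t) ∧
        -- `I^α u` is absolutely continuous with almost everywhere derivative `∂_t^{1-α} u`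
        (∀ᵐ t ∂(volume.restrict (Ioc 0 T)), DifferentiableAt ℝ (fracInt α u) t) ∧
        IntervalIntegrable (rlDeriv α u) volume 0 T ∧
        (∀ t ∈ Icc 0 T, fracInt α u t = ∫ s in (0 : ℝ)..t, rlDeriv α u s) ∧
        -- 3. continuity on `[0, T]`
        ContinuousOn (fracInt α u) (Icc 0 T) ∧
        ContinuousOn (opB α a b u) (Icc 0 T) ∧
        ContinuousOn (fracInt α Du) (Icc 0 T) ∧
        ContinuousOn (opBVec α F G u) (Icc 0 T) ∧
        -- 4. values at `t = 0`
        fracInt α u 0 = 0 ∧ opB α a b u 0 = 0 ∧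
        fracInt α Du 0 = 0 ∧ opBVec α F G u 0 = 0 ∧ u 0 = u₀ ∧
        -- 5. weak continuity at `t = 0`
        (∀ v : L2 Ω, Tendsto (fun t => inner ℝ (u t) v) (𝓝[>] 0) (𝓝 (inner ℝ (u 0) v))) ∧
        -- 6. the variational equation
        (∀ t ∈ Icc 0 T, ∀ (v : L2 Ω) (Dv : L2Vec Ω), HasH10Grad Ω v Dv →
          inner ℝ (u t) v + inner ℝ (matMul κ (fracInt α Du t)) Dv
            - inner ℝ (opBVec α F G u t) Dv + inner ℝ (opB α a b u t) v
          = inner ℝ (u₀ + ∫ s in (0 : ℝ)..t, g s) v) := by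
  obtain ⟨W, _, _, _, ι, D, hι, hin, hW, hW'⟩ := exists_energySpace hκ
  have h1α : 0 < 1 - α := by linarith
  have hac := ha.continuousOn
  have hbc := hb.continuousOn
  have hcoef : ∀ {X : ℝ → Fin d → W1Inf Ω}, ContinuousOn X (Icc 0 T) →
      ∀ i, ContinuousOn (fun s => (X s i).1.1) (Icc 0 T) := fun hX i =>
    continuous_fst.comp_continuousOn (continuous_subtype_val.comp_continuousOn
      ((continuous_apply i).comp_continuousOn hX))
  have hFc := hcoef hF.continuousOn
  have hGc := hcoef hG.continuousOn
  have hPc : ContinuousOn (fun s => ContinuousLinearMap.adjoint ι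
      + formOp ι D (a s) fun i => (F s i).1.1) (Icc 0 T) :=
    continuousOn_const.add (continuousOn_formOp hac hFc)
  obtain ⟨mP, p₁, hP⟩ := ContinuousOn.indicator_bounded hPc
  obtain ⟨mQ, p₂, hQ⟩ := ContinuousOn.indicator_bounded (T := T)
    (continuousOn_formOp (ι := ι) (D := D) (F := fun s i => (G s i).1.1) hbc hGc)
  obtain ⟨C, hC, hsol⟩ := exists_isEnergySolution hα0 hα1 hι mP mQ
    (fun t => (hP t).trans (le_max_left p₁ p₂)) (fun t => (hQ t).trans (le_max_right p₁ p₂)) hη hT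
  -- The abstract estimate bounds U in W, and ‖∇u‖ ≤ ‖D‖ ‖U‖.
  refine ⟨C * (1 + ‖D‖), fun M g u₀ hM hgm hg => ?_⟩
  -- The abstract problem lives on (0, ∞), so g is extended by zero beyond T, as the coefficients
  -- were.
  have hg' : ∀ t, 0 < t → ‖(Ioc 0 T).indicator g t‖ ≤ M * t ^ (η - 1) := fun t ht => by
    by_cases h : t ∈ Ioc 0 T
    · rw [indicator_of_mem h]
      exact hg t h
    · rw [indicator_of_notMem h, norm_zero]
      positivity
  have hgm' : AEStronglyMeasurable ((Ioc 0 T).indicator g) (volume.restrict (Ioi 0)) :=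
    ((aestronglyMeasurable_indicator_iff measurableSet_Ioc).2 hgm).restrict
  obtain ⟨v, U, hs, hbd⟩ := hsol M _ u₀ hgm' hg'
  -- The value at 0 must be prescribed: the energy equation only concerns t > 0.
  let u : ℝ → L2 Ω := fun t => if t = 0 then u₀ else ι (U t)
  have hu0 : u 0 = u₀ := if_pos rfl
  have hu : ∀ t, 0 < t → u t = ι (U t) := fun t ht => if_neg ht.ne'
  have hDU : Sing (1 - α / 2) fun t => D (U t) := hs.singU.clm D
  have hα2 : 0 < 1 - α / 2 := by linarith
  have hDUc : ContinuousOn (fracInt α fun t => D (U t)) (Icc 0 T) :=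
    (hDU.fracInt hα0 hα2).continuousOn_Icc (by linarith)
      (FracPDE.continuousOn_fracInt hα0 hα2 hDU) (fracInt_zero_right _ _) T
  have huc := hs.continuousOn_fracInt hα0 hα1 hu hT.le
  have hBc := hs.continuousOn_opB hα0 hα1 hu hT.le hac hbc
  have hBVc : ContinuousOn (opBVec α F G u) (Icc 0 T) :=
    (PiLp.continuous_toLp 2 _).comp_continuousOn (continuousOn_pi.2 fun i =>
      hs.continuousOn_opB hα0 hα1 hu hT.le (hFc i) (hGc i))
  have hB0 : ∀ c e : ℝ → LInf Ω, opB α c e u 0 = 0 := fun c e => intervalIntegral.integral_same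
  have hBV0 : opBVec α F G u 0 = 0 := by
    ext1 i
    exact hB0 _ _
  have hIg : ∀ t ∈ Icc 0 T, ∫ s in (0 : ℝ)..t, (Ioc 0 T).indicator g s
      = ∫ s in (0 : ℝ)..t, g s := fun t ht => by
    refine intervalIntegral.integral_congr_ae (Eventually.of_forall fun s hs' => ?_)
    rw [uIoc_of_le ht.1] at hs'
    have hm : s ∈ Ioc 0 T := ⟨hs'.1, hs'.2.trans ht.2⟩
    rw [indicator_of_mem hm]
  have heq : ∀ t ∈ Icc 0 T, ∀ (w : L2 Ω) (Dw : L2Vec Ω), HasH10Grad Ω w Dw →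
      inner ℝ (u t) w + inner ℝ (matMul κ (fracInt α (fun t => D (U t)) t)) Dw
        - inner ℝ (opBVec α F G u t) Dw + inner ℝ (opB α a b u t) w
      = inner ℝ (u₀ + ∫ s in (0 : ℝ)..t, g s) w := by
    intro t ht _ _ hw
    obtain ⟨w, rfl, rfl⟩ := hW' _ _ hw
    rcases ht.1.eq_or_lt with rfl | h0
    · rw [hu0, fracInt_zero_right, hBV0, hB0, intervalIntegral.integral_same, ← matMulL_apply]
      simp
    have key := hs.inner_eq hin hα0 hα1 hu hac hbc hFc hGc ⟨h0, ht.2⟩ w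
    rw [hIg t ht] at key
    rwa [PiLp.inner_apply]
  refine ⟨u, fun t => D (U t), ?_, fun t ht => ⟨?_, ?_⟩, fun t ht => ⟨?_, ?_⟩, ?_,
    hs.intervalIntegrable_rlDeriv hα0 hα1 hu hT.le,
    fun t ht => hs.fracInt_eq_integral_rlDeriv hα0 hα1 hu ht.1, huc, hBc, hDUc, hBVc,
    fracInt_zero_right _ _, hB0 _ _, fracInt_zero_right _ _, hBV0, hu0, ?_, heq⟩
  · exact ((ι.continuous.comp_continuousOn hs.contU).mono Ioc_subset_Ioi_self).congr
      fun t ht => hu t ht.1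
  · rw [hu t ht.1]
    exact hW (U t)
  · obtain ⟨b1, b2⟩ := hbd t ht.1 ht.2
    have h2 := mul_le_mul_of_nonneg_left (D.le_opNorm (U t)) (Real.rpow_nonneg ht.1.le (α / 2))
    have h3 := mul_le_mul_of_nonneg_left b2 (norm_nonneg D)
    rw [hu t ht.1]
    linarith
  · exact intervalIntegrable_fracInt hα0 one_pos (hs.sing hα0 hα1 hu) ht.1
  · exact intervalIntegrable_fracInt hα0 hα2 hDU ht.1
  · exact (ae_restrict_iff' measurableSet_Ioc).2 (Eventually.of_forall fun t ht =>
      (hs.hasDerivAt_fracInt hα0 hα1 hu ht.1).differentiableAt)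
  · have hmem : Ioc 0 T ∈ 𝓝[>] (0 : ℝ) := Ioc_mem_nhdsGT hT
    rw [hu0]
    -- The range of ι is H^1_0(Ω), dense in L_2(Ω), and u is bounded on (0, T] by the a priori
    -- estimate.
    refine tendsto_inner_of_dense (S := LinearMap.range (ι : W →ₗ[ℝ] L2 Ω))
      (B := C * (‖u₀‖ + M * T ^ η)) (fun h hh => eq_zero_of_forall_inner_eq_zero hΩo
        fun x Dx hx => ?_) ?_ ?_
    · obtain ⟨w, rfl, -⟩ := hW' x Dx hx
      exact hh _ ⟨w, rfl⟩
    · filter_upwards [hmem] with t ht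
      rw [hu t ht.1]
      refine (hbd t ht.1 ht.2).1.trans ?_
      have := Real.rpow_le_rpow ht.1.le ht.2 hη.le
      gcongr
    · rintro _ ⟨w, rfl⟩
      have hgI : ContinuousOn (fun t => ∫ s in (0 : ℝ)..t, (Ioc 0 T).indicator g s) (Icc 0 T) := by
        have h := intervalIntegral.continuousOn_primitive_interval
          ((intervalIntegrable_iff' (by simp)).1
            ((Sing.of_le hgm' hg').intervalIntegrable hη hT.le))
        rwa [uIcc_of_le hT.le] at h
      have h := tendsto_inner_of_variational hT hBc (continuousOn_const.add hgI) hDUc hBVc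
        (hB0 _ _) (fracInt_zero_right _ _) hBV0 (u := u) (x := ι w) (Dx := D w) fun t ht =>
          (hIg t (Ioc_subset_Icc_self ht)).symm ▸ heq t (Ioc_subset_Icc_self ht) _ _ (hW w)
      simpa using h
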